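/- For a closed connected Riemannian surface $(\Sigma,g)$ let $\lambda_1(\Sigma)$ be the first non-zero eigenvalue of $-\Delta=-\operatorname{div}\nabla$, let $\operatorname{diam}(\Sigma)$ be the intrinsic diameter, let $\rho(x)$ be the smallest eigenvalue of the Ricci tensor at $x$ (here, the Gaussian curvature), and for $K\ge 0$ and $p>1$ put $$\rho_K=\max\{-\rho+K,0\},\qquad \bar k(p,K)_\Sigma=\left(\frac1{\operatorname{vol}(\Sigma)}\int_\Sigma \rho_K^{\,p}\,dv\right)^{1/p}.$$ **Theorem 1.1.** For every $K\ge 0$ there exist $p>1$ (in fact $p=3/2$), constants $C>0$ and $D>0$, and a sequence $(\Sigma_i,g_i)_{i\ge 1}$ of closed connected $\mathcal C^\infty$ Riemannian surfaces such that $\operatorname{diam}(\Sigma_i)\le D$ and $\bar k(p,K)_{\Sigma_i}\le C$ for all $i$, and $$\lim_{i\to\infty}\lambda_1(\Sigma_i)=0 .$$ Moreover, the $\Sigma_i$ can be taken to be dumbbells of revolution with handle of radius $1/i$: there are $R>1$ and $L>0$, independent of $i$, such that $\Sigma_i$ is isometric to a surface of revolution in $\mathbb R^3$ (with the metric inherited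 from $\mathbb R^3$) which is symmetric under reflection in a plane orthogonal to the axis and consists of a cylinder of length $L$ and radius $1/i$, two half spheres of radius $R$, and two necks that join them to the cylinder, along which the radius is non-decreasing from $1/i$ to $R$. -/

import Mathlib

open Set Filter MeasureTheory Manifold Bundle
open scoped Topology ENNReal ContDiff Matrix

noncomputable section

/-- The model plane of surface charts. -/
abbrev Plane : Type := EuclideanSpace ℝ (Fin 2)

/-- Euclidean three-space. -/
abbrev Space : Type := EuclideanSpace ℝ (Fin 3)

/-! ### Riemannian geometry of a metric tensor `G = (g_ij)` given on a coordinate domain -/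

namespace CoordMetric

/-- The coordinate partial derivative `∂_i f` at `y`. -/
def pd (i : Fin 2) (f : Plane → ℝ) (y : Plane) : ℝ :=
  fderiv ℝ f y (EuclideanSpace.single i (1 : ℝ))

/-- Christoffel symbols of the Levi-Civita connection,
`Γ^k_ij = ½ g^{kl} (∂_i g_jl + ∂_j g_il - ∂_l g_ij)`. -/
def christoffel (G : Plane → Matrix (Fin 2) (Fin 2) ℝ) (k i j : Fin 2) (y : Plane) : ℝ :=
  (1 / 2 : ℝ) * ∑ l, (G y)⁻¹ k l *
    (pd i (fun z => G z j l) y + pd j (fun z => G z i l) y - pd l (fun z => G z i j) y)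

/-- The Ricci tensor,
`R_ij = ∂_k Γ^k_ij - ∂_i Γ^k_kj + Γ^k_kl Γ^l_ij - Γ^k_il Γ^l_kj`. -/
def ricci (G : Plane → Matrix (Fin 2) (Fin 2) ℝ) (y : Plane) : Matrix (Fin 2) (Fin 2) ℝ :=
  Matrix.of fun i j =>
    ∑ k, (pd k (christoffel G k i j) y - pd i (christoffel G k k j) y
      + ∑ l, (christoffel G k k l y * christoffel G l i j y
        - christoffel G k i l y * christoffel G l k j y))

/-- The components `(∇u)^i = g^{ij} ∂_j u` of the gradient. -/
def grad (G : Plane → Matrix (Fin 2) (Fin 2) ℝ) (u : Plane → ℝ) (i : Fin 2) (y : Plane) : ℝ :=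
  ∑ j, (G y)⁻¹ i j * pd j u y

/-- The divergence `(det G)^{-1/2} ∂_i ((det G)^{1/2} X^i)` of a vector field. -/
def div (G : Plane → Matrix (Fin 2) (Fin 2) ℝ) (X : Fin 2 → Plane → ℝ) (y : Plane) : ℝ :=
  (Real.sqrt (G y).det)⁻¹ * ∑ i, pd i (fun z => Real.sqrt (G z).det * X i z) y

end CoordMetric

/-! ### Closed Riemannian surfaces -/

/-- A closed (compact, without boundary) connected smooth surface with a smooth Riemannian
metric. -/
structure ClosedRiemannianSurface where
  carrier : Type
  [topology : TopologicalSpace carrier]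
  [t2 : T2Space carrier]
  [compact : CompactSpace carrier]
  [connected : ConnectedSpace carrier]
  [charted : ChartedSpace Plane carrier]
  [smooth : IsManifold (𝓡 2) ∞ carrier]
  metric : ContMDiffRiemannianMetric (𝓡 2) ∞ Plane
    (fun x : carrier => TangentSpace (𝓡 2) x)

namespace ClosedRiemannianSurface

attribute [instance] topology t2 compact connected charted smooth

variable (S : ClosedRiemannianSurface)

/-- The inner products on the tangent spaces given by the metric. -/
instance instRiemannianBundle :
    RiemannianBundle (fun x : S.carrier => TangentSpace (𝓡 2) x) :=
  ⟨S.metric.toRiemannianMetric⟩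

instance instMeasurableSpace : MeasurableSpace S.carrier := borel S.carrier

instance instBorelSpace : BorelSpace S.carrier := ⟨rfl⟩

/-- The coordinate vector field `∂_i` of the chart at `p`, at the point with coordinates `y`. -/
def coordVec (p : S.carrier) (i : Fin 2) (y : Plane) :
    TangentSpace (𝓡 2) ((chartAt Plane p).symm y) :=
  mfderiv 𝓘(ℝ, Plane) (𝓡 2) (chartAt Plane p).symm y (EuclideanSpace.single i (1 : ℝ) : Plane)

/-- The metric coefficients `g_ij = g(∂_i, ∂_j)` in the chart at `p`. -/
def gram (p : S.carrier) (y : Plane) : Matrix (Fin 2) (Fin 2) ℝ :=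
  Matrix.of fun i j => S.metric.inner ((chartAt Plane p).symm y) (S.coordVec p i y)
    (S.coordVec p j y)

/-- The intrinsic diameter: the supremum of the Riemannian distances (infima of lengths of `C^1`
paths). -/
def diam : ℝ≥0∞ :=
  ⨆ (x : S.carrier) (y : S.carrier), riemannianEDist (𝓡 2) x y

/-- The Riemannian area measure `√(det g_ij) dy` on the domain of the chart at `p`, extended
by zero. -/
def chartArea (p : S.carrier) : Measure S.carrier :=
  (((volume : Measure Plane).restrict (chartAt Plane p).target).withDensity
    (fun y => ENNReal.ofReal (Real.sqrt (S.gram p y).det))).map (chartAt Plane p).symm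

/-- The Riemannian area measure. The measures `chartArea p` are the restrictions of the area
measure to the chart domains, so that it is the least measure above all of them. -/
def area : Measure S.carrier := ⨆ p : S.carrier, S.chartArea p

/-- The smallest eigenvalue `ρ(p)` of the Ricci tensor at `p` with respect to the metric: the
least `μ` with `Ric(v, ·) = μ g(v, ·)` for some `v ≠ 0`. -/
def ricciMin (p : S.carrier) : ℝ :=
  sInf {μ : ℝ | ∃ v : Fin 2 → ℝ, v ≠ 0 ∧
    CoordMetric.ricci (S.gram p) (chartAt Plane p p) *ᵥ v =
      μ • (S.gram p (chartAt Plane p p) *ᵥ v)}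

/-- `ρ_K = max {-ρ + (n - 1) K, 0}` with `n = 2`. -/
def rho (K : ℝ) (p : S.carrier) : ℝ := max (-S.ricciMin p + (2 - 1) * K) 0

/-- `k̄(q, K) = (area⁻¹ ∫ ρ_K ^ q) ^ (1 / q)`. -/
def kbar (q K : ℝ) : ℝ≥0∞ :=
  ((S.area univ)⁻¹ * ∫⁻ p, ENNReal.ofReal (S.rho K p) ^ q ∂S.area) ^ (1 / q)

/-- The Laplace-Beltrami operator `Δ u = div (∇ u)`, computed at `p` in the chart at `p`. -/
def laplacian (u : S.carrier → ℝ) (p : S.carrier) : ℝ :=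
  CoordMetric.div (S.gram p)
    (CoordMetric.grad (S.gram p) (u ∘ (chartAt Plane p).symm)) (chartAt Plane p p)

/-- `c` is an eigenvalue of `-Δ`, with a `C^2` eigenfunction. -/
def IsEigenvalue (c : ℝ) : Prop :=
  ∃ u : S.carrier → ℝ, ContMDiff (𝓡 2) 𝓘(ℝ, ℝ) 2 u ∧ u ≠ 0 ∧
    ∀ p, -S.laplacian u p = c * u p

/-- The first non-zero eigenvalue `λ_1` of `-Δ`, as the infimum of the positive eigenvalues
(which form a discrete set); the infimum of the empty set would be `∞`. -/
def lambda1 : ℝ≥0∞ :=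
  ⨅ (c : ℝ) (_ : 0 < c ∧ S.IsEigenvalue c), ENNReal.ofReal c

end ClosedRiemannianSurface

/-! ### Dumbbells of revolution -/

/-- `f` is the profile of a dumbbell of revolution about the first axis, over the interval
`[-(a + R), a + R]`: a handle `[-L/2, L/2]` of constant radius `ε`, two necks
`L/2 ≤ |x| ≤ a` on which the radius increases with `|x|`, and two half spheres of radius `R`
centred at `x = ± a`. -/
structure IsDumbbellProfile (R L ε a : ℝ) (f : ℝ → ℝ) : Prop where
  lt : L / 2 < a
  even : ∀ x, f (-x) = f x
  smooth : ContDiffOn ℝ ∞ f (Ioo (-(a + R)) (a + R))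
  handle : ∀ x ∈ Icc 0 (L / 2), f x = ε
  neck : MonotoneOn f (Icc (L / 2) a)
  cap : ∀ x ∈ Icc a (a + R), f x = Real.sqrt (R ^ 2 - (x - a) ^ 2)

/-- `S` is isometric to a dumbbell of revolution in Euclidean three-space, with the metric
inherited from there, that consists of a cylindrical handle of length `L` and radius `ε`, two
necks, and two half spheres of radius `R`. -/
def ClosedRiemannianSurface.IsDumbbell (S : ClosedRiemannianSurface) (R L ε : ℝ) : Prop :=
  ∃ (a : ℝ) (f : ℝ → ℝ) (F : S.carrier → Space),
    IsDumbbellProfile R L ε a f ∧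
    ContMDiff (𝓡 2) 𝓘(ℝ, Space) ∞ F ∧ Function.Injective F ∧
    (∀ (p : S.carrier) (v w : TangentSpace (𝓡 2) p),
      inner (𝕜 := ℝ) (E := Space) (mfderiv (𝓡 2) 𝓘(ℝ, Space) F p v)
        (mfderiv (𝓡 2) 𝓘(ℝ, Space) F p w) = S.metric.inner p v w) ∧
    range F = {q : Space | |q 0| ≤ a + R ∧ q 1 ^ 2 + q 2 ^ 2 = f (q 0) ^ 2}

end

/-! Write `h` for the squared radius of a surface of revolution, as a function of the position `x`
on the axis, and `w² = h + h'²/4`. Then `w` is the area density in the coordinates `(x, θ)`, and the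
Gaussian curvature is `(h'² - 2 h h'') / (4 w⁴)`. Working with `h` rather than with the radius keeps
everything smooth up to the poles.

The profile interpolates between `ε²` on the handle and `x(4 - x)` on the caps, with the sixth power
of a smooth step `s` as weight. Since `3 s⁶ ≤ h`, while `h' = O(s³)` and `h'' = O(s⁴)` on the neck,
this gives `h'² ≤ C h` and `|h''|³ ≤ C h²` with `C` independent of `ε` (`exists_bound_radiusSq`).
The first inequality bounds the slope of the neck, hence the diameter (`exists_diam_bound`). Both
are used for the curvature: its negative part `Z` is at most `h |h''| / (2 w⁴)`, so `Z³ w² ≤ (C/8)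
(h/w²)⁵ ≤ C/8` (`exists_bound_curvature`). Thus `Z^(3/2) w` is bounded pointwise, which is the case
`p = 3/2`; the caps keep the total area away from zero (`exists_kbar_bound`).

For the eigenvalue no variational principle is used: a positive eigenvalue `c ≤ ε` is exhibited. A
function `u(x)` is an eigenfunction if `(h u' / w)' = -c w u`, regularly at the poles. The solution
with value `1` at the right pole is constructed as a power series in `-c`. For `c = ε` it cannot
stay positive up to the middle: it is at least `1/2` on part of the cap, so its flux through the
handle is large, and because `h = ε²` and `w = ε` there, this forces `u' ≥ 1` in the variable `x`
over the unit length of the half handle (`exists_radial_nonpos`). By continuity in `c`, some `c` in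
`(0, ε]` makes `u` vanish exactly in the middle (`exists_first_root`). The odd extension of `u` is
then an eigenfunction (`isEigenvalue_surface`). -/

noncomputable section

/-! ### Embedded surfaces in Euclidean space as closed Riemannian surfaces -/

/-- A parametrization of a piece of a subset `M` of Euclidean space, with a smooth inverse that is
defined on an open subset of the ambient space. -/
structure SurfaceChart (M : Set Space) where
  toPlane : Space → Plane
  ofPlane : Plane → Space
  source : Set Space
  target : Set Plane
  isOpen_source : IsOpen source
  isOpen_target : IsOpen target
  smooth_toPlane : ContDiffOn ℝ ∞ toPlane source
  smooth_ofPlane : ContDiffOn ℝ ∞ ofPlane target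
  toPlane_mem : ∀ q ∈ M, q ∈ source → toPlane q ∈ target
  ofPlane_mem : ∀ y ∈ target, ofPlane y ∈ M
  ofPlane_mem_source : ∀ y ∈ target, ofPlane y ∈ source
  left_inv : ∀ q ∈ M, q ∈ source → ofPlane (toPlane q) = q
  right_inv : ∀ y ∈ target, toPlane (ofPlane y) = y

namespace SurfaceChart

variable {M : Set Space} (c : SurfaceChart M)

open Classical in
/-- The parametrization as a map into the subtype, with an arbitrary value off its domain. -/
def param [Nonempty M] (y : Plane) : M :=
  if h : c.ofPlane y ∈ M then ⟨c.ofPlane y, h⟩ else Classical.arbitrary M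

lemma coe_param [Nonempty M] {y : Plane} (hy : y ∈ c.target) :
    (c.param y : Space) = c.ofPlane y := by
  simp [param, c.ofPlane_mem y hy]

lemma continuousOn_param [Nonempty M] : ContinuousOn c.param c.target := by
  rw [Topology.IsInducing.subtypeVal.continuousOn_iff]
  exact c.smooth_ofPlane.continuousOn.congr fun y hy => c.coe_param hy

/-- The chart of the subtype `M` given by a parametrization. -/
def toOpenPartialHomeomorph [Nonempty M] : OpenPartialHomeomorph M Plane where
  toFun p := c.toPlane p
  invFun := c.param
  source := (fun p : M => (p : Space)) ⁻¹' c.source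
  target := c.target
  map_source' p hp := c.toPlane_mem p p.2 hp
  map_target' y hy := by
    rw [mem_preimage, c.coe_param hy]
    exact c.ofPlane_mem_source y hy
  left_inv' p hp := by
    apply Subtype.ext
    rw [c.coe_param (c.toPlane_mem p p.2 hp), c.left_inv p p.2 hp]
  right_inv' y hy := by
    rw [c.coe_param hy, c.right_inv y hy]
  open_source := c.isOpen_source.preimage continuous_subtype_val
  open_target := c.isOpen_target
  continuousOn_toFun := c.smooth_toPlane.continuousOn.comp continuous_subtype_val.continuousOn
    fun _ hp => hp
  continuousOn_invFun := c.continuousOn_param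

lemma injective_fderiv {y : Plane} (hy : y ∈ c.target) :
    Function.Injective (fderiv ℝ c.ofPlane y) := by
  have h1 : DifferentiableAt ℝ c.ofPlane y :=
    (c.smooth_ofPlane.contDiffAt (c.isOpen_target.mem_nhds hy)).differentiableAt (by simp)
  have h2 : DifferentiableAt ℝ c.toPlane (c.ofPlane y) :=
    (c.smooth_toPlane.contDiffAt
      (c.isOpen_source.mem_nhds (c.ofPlane_mem_source y hy))).differentiableAt (by simp)
  have h3 : HasFDerivAt (c.toPlane ∘ c.ofPlane) (ContinuousLinearMap.id ℝ Plane) y := by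
    refine (hasFDerivAt_id y).congr_of_eventuallyEq ?_
    filter_upwards [c.isOpen_target.mem_nhds hy] with z hz using c.right_inv z hz
  have h4 := (h2.hasFDerivAt.comp y h1.hasFDerivAt).unique h3
  refine Function.LeftInverse.injective (g := fderiv ℝ c.toPlane (c.ofPlane y)) fun v => ?_
  exact congrArg (fun A : Plane →L[ℝ] Plane => A v) h4

end SurfaceChart

/-- A compact connected subset of Euclidean space that is covered by smooth parametrizations. -/
structure EmbeddedSurface where
  carrier : Set Space
  isCompact : IsCompact carrier
  isConnected : IsConnected carrier
  Index : Type
  chart : Index → SurfaceChart carrier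
  index : carrier → Index
  mem_source : ∀ p : carrier, (p : Space) ∈ (chart (index p)).source

namespace EmbeddedSurface

variable (X : EmbeddedSurface)

/-- The points of an embedded surface. -/
def Point : Type := X.carrier

variable {X} in
/-- The inclusion in Euclidean space. -/
def incl (p : X.Point) : Space := p.1

/-- The index of the preferred chart at a point. -/
def idx (p : X.Point) : X.Index := X.index p

lemma injective_incl : Function.Injective (incl : X.Point → Space) := Subtype.val_injective

lemma range_incl : range (incl : X.Point → Space) = X.carrier := Subtype.range_val

instance : TopologicalSpace X.Point := inferInstanceAs (TopologicalSpace X.carrier)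
instance : T2Space X.Point := inferInstanceAs (T2Space X.carrier)
instance : CompactSpace X.Point := isCompact_iff_compactSpace.mp X.isCompact
instance : ConnectedSpace X.Point := isConnected_iff_connectedSpace.mp X.isConnected
instance : Nonempty X.carrier := X.isConnected.nonempty.to_subtype

lemma continuous_incl : Continuous (incl : X.Point → Space) := continuous_subtype_val

/-- The charts of an embedded surface. -/
def pointChart (j : X.Index) : OpenPartialHomeomorph X.Point Plane :=
  (X.chart j).toOpenPartialHomeomorph

instance : ChartedSpace Plane X.Point where
  atlas := range X.pointChart
  chartAt p := X.pointChart (X.idx p)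
  mem_chart_source p := X.mem_source p
  chart_mem_atlas _ := mem_range_self _

lemma pointChart_apply (j : X.Index) (p : X.Point) :
    X.pointChart j p = (X.chart j).toPlane (incl p) := rfl

lemma mem_pointChart_source {j : X.Index} {p : X.Point} :
    p ∈ (X.pointChart j).source ↔ incl p ∈ (X.chart j).source := Iff.rfl

lemma incl_pointChart_symm {j : X.Index} {y : Plane} (hy : y ∈ (X.chart j).target) :
    incl ((X.pointChart j).symm y) = (X.chart j).ofPlane y :=
  (X.chart j).coe_param hy

instance : IsManifold (𝓡 2) ∞ X.Point := by
  apply isManifold_of_contDiffOn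
  rintro _ _ ⟨j, rfl⟩ ⟨k, rfl⟩
  have hs : ∀ y, y ∈ ((X.pointChart j).symm ≫ₕ X.pointChart k).source →
      y ∈ (X.chart j).target ∧ (X.chart j).ofPlane y ∈ (X.chart k).source := by
    intro y hy
    rw [OpenPartialHomeomorph.trans_source] at hy
    have h1 : y ∈ (X.chart j).target := hy.1
    have h2 := hy.2
    rw [mem_preimage, mem_pointChart_source, X.incl_pointChart_symm h1] at h2
    exact ⟨h1, h2⟩
  have : ContDiffOn ℝ ∞ ((X.chart k).toPlane ∘ (X.chart j).ofPlane)
      ((X.pointChart j).symm ≫ₕ X.pointChart k).source :=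
    (X.chart k).smooth_toPlane.comp ((X.chart j).smooth_ofPlane.mono fun y hy => (hs y hy).1)
      fun y hy => (hs y hy).2
  refine (this.congr fun y hy => ?_).mono fun y hy => hy.1
  change X.pointChart k ((X.pointChart j).symm y) = _
  rw [pointChart_apply, X.incl_pointChart_symm (hs y hy).1]
  rfl

/-- Near a point, the inclusion in coordinates is the parametrization. -/
lemma incl_comp_symm_eventuallyEq {j : X.Index} {y : Plane} (hy : y ∈ (X.chart j).target) :
    incl ∘ (X.pointChart j).symm =ᶠ[𝓝 y] (X.chart j).ofPlane := by
  filter_upwards [(X.chart j).isOpen_target.mem_nhds hy] with z hz using X.incl_pointChart_symm hz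

lemma pointChart_mem_target (p : X.Point) :
    (X.chart (X.idx p)).toPlane (incl p) ∈ (X.chart (X.idx p)).target :=
  (X.chart _).toPlane_mem _ p.2 (X.mem_source p)

lemma contMDiff_incl : ContMDiff (𝓡 2) 𝓘(ℝ, Space) ∞ (incl : X.Point → Space) := by
  intro p
  rw [contMDiffAt_iff]
  refine ⟨X.continuous_incl.continuousAt, ?_⟩
  have hy := X.pointChart_mem_target p
  have h1 : ContDiffAt ℝ ∞ (X.chart (X.idx p)).ofPlane
      ((X.chart (X.idx p)).toPlane (incl p)) :=
    (X.chart _).smooth_ofPlane.contDiffAt ((X.chart _).isOpen_target.mem_nhds hy)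
  exact (h1.congr_of_eventuallyEq (X.incl_comp_symm_eventuallyEq hy)).contDiffWithinAt

/-- The Euclidean inner product, pulled back by a linear map. -/
def pullbackInner (A : Plane →L[ℝ] Space) : Plane →L[ℝ] Plane →L[ℝ] ℝ :=
  (ContinuousLinearMap.compL ℝ Plane Space ℝ).flip A ∘L
    (innerSL ℝ : Space →L[ℝ] Space →L[ℝ] ℝ) ∘L A

lemma contDiff_pullbackInner : ContDiff ℝ ∞ pullbackInner := by
  unfold pullbackInner
  fun_prop

/-- The derivative of the inclusion, in the chart at `p`. -/
def inclDeriv (p : X.Point) : Plane →L[ℝ] Space :=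
  fderiv ℝ (X.chart (X.idx p)).ofPlane ((X.chart (X.idx p)).toPlane (incl p))

lemma hasMFDerivAt_incl (p : X.Point) :
    HasMFDerivAt (𝓡 2) 𝓘(ℝ, Space) incl p (X.inclDeriv p) := by
  refine ⟨X.continuous_incl.continuousAt, ?_⟩
  have hy := X.pointChart_mem_target p
  have h1 : DifferentiableAt ℝ (X.chart (X.idx p)).ofPlane
      ((X.chart (X.idx p)).toPlane (incl p)) :=
    ((X.chart _).smooth_ofPlane.contDiffAt
      ((X.chart _).isOpen_target.mem_nhds hy)).differentiableAt (by simp)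
  exact (h1.hasFDerivAt.congr_of_eventuallyEq
    (X.incl_comp_symm_eventuallyEq hy)).hasFDerivWithinAt

lemma mfderiv_incl (p : X.Point) :
    mfderiv (𝓡 2) 𝓘(ℝ, Space) incl p = X.inclDeriv p :=
  (X.hasMFDerivAt_incl p).mfderiv

lemma injective_inclDeriv (p : X.Point) : Function.Injective (X.inclDeriv p) :=
  (X.chart _).injective_fderiv (X.pointChart_mem_target p)

/-- The metric induced by the ambient Euclidean space, in the chart at `p`. -/
def firstForm (p : X.Point) : Plane →L[ℝ] Plane →L[ℝ] ℝ :=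
  pullbackInner (X.inclDeriv p)

/-- An injective linear map on a finite-dimensional space is antilipschitz, so a bound on the image
of a vector bounds the vector. -/
lemma isVonNBounded_firstForm (p : X.Point) :
    Bornology.IsVonNBounded ℝ {v : Plane | X.firstForm p v v < 1} := by
  obtain ⟨K, hK, hL⟩ := (X.inclDeriv p).toLinearMap.exists_antilipschitzWith
    (LinearMap.ker_eq_bot.mpr (X.injective_inclDeriv p))
  refine (NormedSpace.isVonNBounded_ball ℝ Plane (K + 1)).subset fun v hv => ?_
  have h1 : ‖X.inclDeriv p v‖ < 1 := by
    have : ‖X.inclDeriv p v‖ ^ 2 < 1 := by rw [← real_inner_self_eq_norm_sq]; exact hv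
    nlinarith [norm_nonneg (X.inclDeriv p v)]
  have h2 := hL.le_mul_dist v 0
  simp only [map_zero, dist_zero_right] at h2
  have h3 : (K : ℝ) * ‖X.inclDeriv p v‖ ≤ K * 1 := by gcongr
  rw [mem_ball_zero_iff]
  change ‖v‖ ≤ K * ‖X.inclDeriv p v‖ at h2
  linarith

/-- The metric induced by the ambient Euclidean space, as a form on the tangent space. -/
def tangentForm (p : X.Point) :
    TangentSpace (𝓡 2) p →L[ℝ] TangentSpace (𝓡 2) p →L[ℝ] ℝ := X.firstForm p

/-- The derivative of the inclusion near `p`, in the chart at `p`. -/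
def inclDerivAt (p q : X.Point) : Plane →L[ℝ] Space :=
  inTangentCoordinates (𝓡 2) 𝓘(ℝ, Space) id incl (fun q : X.Point => X.inclDeriv q) p q

lemma inclDerivAt_apply {p q : X.Point} (hq : q ∈ (chartAt Plane p).source) (v : Plane) :
    X.inclDerivAt p q v = X.inclDeriv q ((tangentBundleCore (𝓡 2) X.Point).coordChange
      (achart Plane p) (achart Plane q) q v) := by
  have h := inTangentCoordinates_eq (I := 𝓡 2) (I' := 𝓘(ℝ, Space)) id (incl : X.Point → Space)
    (fun q => X.inclDeriv q) (x₀ := p) (x := q) hq (mem_univ _)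
  rw [TangentBundle.coordChange_model_space] at h
  rw [inclDerivAt, h]
  rfl

lemma contMDiffAt_inclDerivAt (p : X.Point) :
    ContMDiffAt (𝓡 2) 𝓘(ℝ, Plane →L[ℝ] Space) ∞ (X.inclDerivAt p) p := by
  have h := (X.contMDiff_incl p).mfderiv_const (m := ∞) (by simp)
  have h1 : mfderiv (𝓡 2) 𝓘(ℝ, Space) (incl : X.Point → Space) = fun q => X.inclDeriv q :=
    funext X.mfderiv_incl
  rw [h1] at h
  exact h

lemma tangent_symm_apply {p q : X.Point} (hq : q ∈ (chartAt Plane p).source) (v : Plane) :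
    (trivializationAt Plane (TangentSpace (𝓡 2)) p).symm q v =
      (tangentBundleCore (𝓡 2) X.Point).coordChange (achart Plane p) (achart Plane q) q v := by
  rw [← TangentBundle.symmL_trivializationAt_eq_core hq]
  exact (Trivialization.symmL_apply (R := ℝ) _ hq v).symm

/-- In the trivialization at `p` the form is `pullbackInner` of `inclDerivAt`, whose smoothness is
that of the differential of the smooth inclusion. -/
lemma contMDiff_tangentForm :
    ContMDiff (𝓡 2) ((𝓡 2).prod 𝓘(ℝ, Plane →L[ℝ] Plane →L[ℝ] ℝ)) ∞
      (fun p : X.Point => TotalSpace.mk' (Plane →L[ℝ] Plane →L[ℝ] ℝ)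
        (E := fun x : X.Point => TangentSpace (𝓡 2) x →L[ℝ] TangentSpace (𝓡 2) x →L[ℝ] ℝ)
        p (X.tangentForm p)) := by
  intro p
  rw [contMDiffAt_section]
  have h0 := X.contMDiffAt_inclDerivAt p
  have h1 := contDiff_pullbackInner.contDiffAt.contMDiffAt.comp p h0
  refine h1.congr_of_eventuallyEq ?_
  filter_upwards [(chartAt Plane p).open_source.mem_nhds (mem_chart_source Plane p)] with q hq
  ext v w
  rw [hom_trivializationAt_apply, inCoordinates_apply_eq₂ hq hq (mem_univ _),
    tangent_symm_apply X hq, tangent_symm_apply X hq]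
  change _ = inner ℝ (X.inclDerivAt p q v) (X.inclDerivAt p q w)
  rw [inclDerivAt_apply X hq, inclDerivAt_apply X hq]
  simp only [Trivial.fiberBundle_trivializationAt', Trivial.linearMapAt_trivialization]
  rfl

/-- The metric induced by the ambient Euclidean space. -/
def metric : ContMDiffRiemannianMetric (𝓡 2) ∞ Plane
    (fun x : X.Point => TangentSpace (𝓡 2) x) where
  inner p := X.tangentForm p
  symm p v w := real_inner_comm (F := Space) (X.inclDeriv p w) (X.inclDeriv p v)
  pos p v hv := by
    refine (real_inner_self_pos (F := Space) (x := X.inclDeriv p v)).mpr fun h => hv ?_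
    exact X.injective_inclDeriv p (h.trans (map_zero _).symm)
  isVonNBounded p := X.isVonNBounded_firstForm p
  contMDiff := X.contMDiff_tangentForm

/-- An embedded surface as a Riemannian surface. -/
@[reducible] def toSurface : ClosedRiemannianSurface where
  carrier := X.Point
  metric := X.metric

end EmbeddedSurface

/-! ### Curvature, Laplacian and area of an embedded surface in terms of its parametrizations -/

namespace CoordMetric

variable {G G' : Plane → Matrix (Fin 2) (Fin 2) ℝ} {f f' : Plane → ℝ} {y : Plane}

lemma pd_congr (i : Fin 2) (h : f =ᶠ[𝓝 y] f') : pd i f y = pd i f' y := by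
  rw [pd, pd, h.fderiv_eq]

lemma christoffel_congr (k i j : Fin 2) (h : G =ᶠ[𝓝 y] G') :
    christoffel G k i j y = christoffel G' k i j y := by
  have h1 : ∀ a b : Fin 2, (fun z => G z a b) =ᶠ[𝓝 y] fun z => G' z a b := fun a b => by
    filter_upwards [h] with z hz using by rw [hz]
  unfold christoffel
  simp only [h.eq_of_nhds, pd_congr _ (h1 _ _)]

lemma ricci_congr (h : G =ᶠ[𝓝 y] G') : ricci G y = ricci G' y := by
  have h1 : ∀ k i j : Fin 2, christoffel G k i j =ᶠ[𝓝 y] christoffel G' k i j := fun k i j => by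
    filter_upwards [h.eventuallyEq_nhds] with z hz using christoffel_congr k i j hz
  unfold ricci
  simp only [pd_congr _ (h1 _ _ _), (h1 _ _ _).eq_of_nhds]

lemma grad_congr (i : Fin 2) (h : G =ᶠ[𝓝 y] G') (hf : f =ᶠ[𝓝 y] f') :
    grad G f i y = grad G' f' i y := by
  unfold grad
  simp only [h.eq_of_nhds, pd_congr _ hf]

lemma div_grad_congr (h : G =ᶠ[𝓝 y] G') (hf : f =ᶠ[𝓝 y] f') :
    div G (grad G f) y = div G' (grad G' f') y := by
  have h1 : ∀ i, (fun z => √(G z).det * grad G f i z) =ᶠ[𝓝 y]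
      fun z => √(G' z).det * grad G' f' i z := fun i => by
    filter_upwards [h.eventuallyEq_nhds, hf.eventuallyEq_nhds] with z hz hz'
    rw [hz.eq_of_nhds, grad_congr i hz hz']
  unfold div
  simp only [h.eq_of_nhds, pd_congr _ (h1 _)]

end CoordMetric

/-- The matrix of inner products of the partial derivatives of a parametrization. -/
def SurfaceChart.gram {M : Set Space} (c : SurfaceChart M) (y : Plane) :
    Matrix (Fin 2) (Fin 2) ℝ :=
  Matrix.of fun i j => inner ℝ (fderiv ℝ c.ofPlane y (EuclideanSpace.single i (1 : ℝ)))
    (fderiv ℝ c.ofPlane y (EuclideanSpace.single j (1 : ℝ)))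

lemma SurfaceChart.continuousOn_gram {M : Set Space} (c : SurfaceChart M) :
    ContinuousOn c.gram c.target := by
  have h : ContinuousOn (fderiv ℝ c.ofPlane) c.target :=
    c.smooth_ofPlane.continuousOn_fderiv_of_isOpen c.isOpen_target (by simp)
  refine continuousOn_pi.mpr fun i => continuousOn_pi.mpr fun j => ?_
  exact ContinuousOn.inner (h.clm_apply continuousOn_const) (h.clm_apply continuousOn_const)

/-- The integrand is arbitrary because `rho` is not shown to be measurable; for an upper bound this
inequality is enough. -/
lemma lintegral_withDensity_le_lintegral_mul_of_aemeasurable {α : Type*} [MeasurableSpace α]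
    {μ : Measure α} {d : α → ℝ≥0∞} (hd : AEMeasurable d μ) (f : α → ℝ≥0∞) :
    ∫⁻ a, f a ∂μ.withDensity d ≤ ∫⁻ a, d a * f a ∂μ := by
  rw [withDensity_congr_ae hd.ae_eq_mk]
  refine (lintegral_withDensity_le_lintegral_mul μ hd.measurable_mk f).trans (le_of_eq ?_)
  refine lintegral_congr_ae ?_
  filter_upwards [hd.ae_eq_mk] with a ha
  rw [Pi.mul_apply, ← ha]

namespace EmbeddedSurface

variable (X : EmbeddedSurface)

instance : MeasurableSpace X.Point := borel X.Point
instance : BorelSpace X.Point := ⟨rfl⟩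

/-- The coordinates of a point in its preferred chart. -/
def coord (p : X.Point) : Plane := (X.chart (X.idx p)).toPlane (incl p)

lemma coord_mem (p : X.Point) : X.coord p ∈ (X.chart (X.idx p)).target :=
  X.pointChart_mem_target p

/-- Chain rule for the inclusion after the inverse chart, which near `y` is the parametrization. -/
lemma inclDeriv_coordVec (p : X.Point) (i : Fin 2) {y : Plane}
    (hy : y ∈ (X.chart (X.idx p)).target) :
    X.inclDeriv ((chartAt Plane p).symm y) (X.toSurface.coordVec p i y) =
      fderiv ℝ (X.chart (X.idx p)).ofPlane y (EuclideanSpace.single i (1 : ℝ)) := by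
  have h1 : MDifferentiableAt 𝓘(ℝ, Plane) (𝓡 2) (chartAt Plane p).symm y :=
    mdifferentiableAt_atlas_symm (chart_mem_atlas Plane p) hy
  have h2 := (X.hasMFDerivAt_incl ((chartAt Plane p).symm y)).comp y h1.hasMFDerivAt
  have h3 : HasFDerivAt (incl ∘ (chartAt Plane p).symm)
      (fderiv ℝ (X.chart (X.idx p)).ofPlane y) y := by
    have h4 : DifferentiableAt ℝ (X.chart (X.idx p)).ofPlane y :=
      ((X.chart _).smooth_ofPlane.contDiffAt
        ((X.chart _).isOpen_target.mem_nhds hy)).differentiableAt (by simp)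
    exact h4.hasFDerivAt.congr_of_eventuallyEq (X.incl_comp_symm_eventuallyEq hy)
  have h5 := hasMFDerivAt_unique h2 h3.hasMFDerivAt
  exact congrArg (fun A : Plane →L[ℝ] Space => A (EuclideanSpace.single i (1 : ℝ))) h5

lemma toSurface_gram (p : X.Point) {y : Plane} (hy : y ∈ (X.chart (X.idx p)).target) :
    X.toSurface.gram p y = (X.chart (X.idx p)).gram y := by
  ext i j
  change inner ℝ (X.inclDeriv _ (X.toSurface.coordVec p i y))
    (X.inclDeriv _ (X.toSurface.coordVec p j y)) = _
  exact congrArg₂ (inner ℝ) (inclDeriv_coordVec X p i hy) (inclDeriv_coordVec X p j hy)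

lemma toSurface_gram_eventuallyEq (p : X.Point) :
    X.toSurface.gram p =ᶠ[𝓝 (X.coord p)] (X.chart (X.idx p)).gram := by
  filter_upwards [(X.chart _).isOpen_target.mem_nhds (X.coord_mem p)] with y hy
    using X.toSurface_gram p hy

lemma toSurface_ricciMin (p : X.Point) :
    X.toSurface.ricciMin p = sInf {μ : ℝ | ∃ v : Fin 2 → ℝ, v ≠ 0 ∧
      CoordMetric.ricci (X.chart (X.idx p)).gram (X.coord p) *ᵥ v =
        μ • ((X.chart (X.idx p)).gram (X.coord p) *ᵥ v)} := by
  have h := X.toSurface_gram_eventuallyEq p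
  change sInf {μ : ℝ | ∃ v : Fin 2 → ℝ, v ≠ 0 ∧
      CoordMetric.ricci (X.toSurface.gram p) (X.coord p) *ᵥ v =
        μ • (X.toSurface.gram p (X.coord p) *ᵥ v)} = _
  rw [CoordMetric.ricci_congr h, h.eq_of_nhds]

lemma toSurface_laplacian (g : Space → ℝ) (p : X.Point) :
    X.toSurface.laplacian (g ∘ incl) p =
      CoordMetric.div (X.chart (X.idx p)).gram
        (CoordMetric.grad (X.chart (X.idx p)).gram (g ∘ (X.chart (X.idx p)).ofPlane))
        (X.coord p) := by
  refine CoordMetric.div_grad_congr (X.toSurface_gram_eventuallyEq p) ?_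
  filter_upwards [X.incl_comp_symm_eventuallyEq (X.coord_mem p)] with y hy
  exact congrArg g hy

lemma contMDiff_comp_incl {g : Space → ℝ} (hg : ∀ q ∈ X.carrier, ContDiffAt ℝ 2 g q) :
    ContMDiff (𝓡 2) 𝓘(ℝ, ℝ) 2 (g ∘ incl : X.Point → ℝ) := fun p =>
  (hg _ p.2).contMDiffAt.comp p ((X.contMDiff_incl p).of_le (by norm_cast))

lemma aemeasurable_density (j : X.Index) :
    AEMeasurable (fun y => ENNReal.ofReal √((X.chart j).gram y).det)
      (volume.restrict (X.chart j).target) := by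
  refine ContinuousOn.aemeasurable ?_ (X.chart j).isOpen_target.measurableSet
  refine ENNReal.continuous_ofReal.comp_continuousOn (Real.continuous_sqrt.comp_continuousOn ?_)
  exact continuous_id.matrix_det.comp_continuousOn (X.chart j).continuousOn_gram

/-- The area measure on the domain of the chart with index `j`. -/
def indexArea (j : X.Index) : Measure X.Point :=
  (((volume : Measure Plane).restrict (X.chart j).target).withDensity
    (fun y => ENNReal.ofReal √((X.chart j).gram y).det)).map (X.pointChart j).symm

lemma chartArea_eq (p : X.Point) : X.toSurface.chartArea p = X.indexArea (X.idx p) := by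
  have h : ((volume : Measure Plane).restrict (X.chart (X.idx p)).target).withDensity
      (fun y => ENNReal.ofReal √(X.toSurface.gram p y).det) =
      ((volume : Measure Plane).restrict (X.chart (X.idx p)).target).withDensity
      (fun y => ENNReal.ofReal √((X.chart (X.idx p)).gram y).det) := by
    refine withDensity_congr_ae ?_
    filter_upwards [ae_restrict_mem (X.chart _).isOpen_target.measurableSet] with y hy
    rw [X.toSurface_gram p hy]
  exact congrArg (Measure.map (X.pointChart (X.idx p)).symm) h

/-- A supremum of measures lies below their sum. Overlaps of charts are counted several times, which
is harmless for an upper bound. -/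
lemma lintegral_area_le [Fintype X.Index] (f : X.Point → ℝ≥0∞) :
    ∫⁻ p, f p ∂X.toSurface.area ≤ ∑ j, ∫⁻ y in (X.chart j).target,
      ENNReal.ofReal √((X.chart j).gram y).det * f ((X.pointChart j).symm y) := by
  have h1 : X.toSurface.area ≤ Measure.sum X.indexArea := by
    refine iSup_le fun p => ?_
    rw [X.chartArea_eq p]
    exact Measure.le_sum _ _
  refine (lintegral_mono' h1 le_rfl).trans ?_
  rw [lintegral_sum_measure, tsum_fintype]
  refine Finset.sum_le_sum fun j _ => ?_
  refine (lintegral_map_le _ _).trans ?_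
  exact lintegral_withDensity_le_lintegral_mul_of_aemeasurable (X.aemeasurable_density j) _

lemma le_area (p : X.Point) : ∫⁻ y in (X.chart (X.idx p)).target,
    ENNReal.ofReal √((X.chart (X.idx p)).gram y).det ≤ X.toSurface.area univ := by
  have h1 : X.toSurface.chartArea p ≤ X.toSurface.area := le_iSup X.toSurface.chartArea p
  refine le_trans (le_of_eq ?_) (h1 univ)
  rw [X.chartArea_eq, indexArea, Measure.map_apply_of_aemeasurable ?_ MeasurableSet.univ,
    preimage_univ, withDensity_apply _ MeasurableSet.univ, Measure.restrict_univ]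
  refine AEMeasurable.mono_ac ?_ (withDensity_absolutelyContinuous _ _)
  exact ContinuousOn.aemeasurable (X.pointChart _).continuousOn_symm
    (X.chart _).isOpen_target.measurableSet

end EmbeddedSurface

/-! ### Riemannian distance and curves in Euclidean space -/

namespace EmbeddedSurface

variable (X : EmbeddedSurface)

/-- Charts are restrictions of maps that are smooth on open subsets of the ambient space, so
regularity of a curve can be tested there. -/
lemma contMDiffWithinAt_of_incl {γ : ℝ → X.Point} {s : Set ℝ} {t : ℝ}
    (h : ContDiffWithinAt ℝ 1 (incl ∘ γ) s t) : ContMDiffWithinAt 𝓘(ℝ, ℝ) (𝓡 2) 1 γ s t := by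
  rw [contMDiffWithinAt_iff_target]
  have h1 : ContinuousWithinAt γ s t :=
    (Topology.IsInducing.subtypeVal (t := X.carrier)).continuousWithinAt_iff.mpr
      h.continuousWithinAt
  refine ⟨h1, ?_⟩
  have h2 : ContDiffAt ℝ 1 (X.chart (X.idx (γ t))).toPlane (incl (γ t)) :=
    ((X.chart _).smooth_toPlane.contDiffAt
      ((X.chart _).isOpen_source.mem_nhds (X.mem_source _))).of_le (by norm_cast)
  exact (h2.comp_contDiffWithinAt t h).contMDiffWithinAt

lemma enorm_tangent (p : X.Point) (v : TangentSpace (𝓡 2) p) :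
    letI : RiemannianBundle (fun x : X.Point => TangentSpace (𝓡 2) x) :=
      ⟨X.metric.toRiemannianMetric⟩
    ‖v‖ₑ = ‖X.inclDeriv p v‖ₑ := by
  let : RiemannianBundle (fun x : X.Point => TangentSpace (𝓡 2) x) :=
      ⟨X.metric.toRiemannianMetric⟩
  have h1 : ‖v‖ = ‖X.inclDeriv p v‖ := by
    rw [norm_eq_sqrt_real_inner, norm_eq_sqrt_real_inner]
    rfl
  simp only [enorm, nnnorm, h1]

lemma inclDeriv_mfderiv {γ : ℝ → X.Point} {t : ℝ}
    (h : ContDiffAt ℝ 1 (incl ∘ γ) t) :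
    X.inclDeriv (γ t) (mfderiv 𝓘(ℝ, ℝ) (𝓡 2) γ t (1 : ℝ)) = deriv (incl ∘ γ) t := by
  have h1 : MDifferentiableAt 𝓘(ℝ, ℝ) (𝓡 2) γ t :=
    (contMDiffWithinAt_univ.mp (X.contMDiffWithinAt_of_incl
      (contDiffWithinAt_univ.mpr h))).mdifferentiableAt one_ne_zero
  have h2 := (X.hasMFDerivAt_incl (γ t)).comp t h1.hasMFDerivAt
  have h3 := (h.differentiableAt one_ne_zero).hasFDerivAt.hasMFDerivAt
  have h5 := hasMFDerivAt_unique h2 h3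
  have h6 := congrArg (fun A : ℝ →L[ℝ] Space => A (1 : ℝ)) h5
  exact h6.trans (fderiv_apply_one_eq_deriv)

/-- The Riemannian distance on an embedded surface. -/
def edist (p q : X.Point) : ℝ≥0∞ :=
  letI : RiemannianBundle (fun x : X.Point => TangentSpace (𝓡 2) x) :=
    ⟨X.metric.toRiemannianMetric⟩
  riemannianEDist (𝓡 2) p q

lemma edist_comm (p q : X.Point) : X.edist p q = X.edist q p := by
  let : RiemannianBundle (fun x : X.Point => TangentSpace (𝓡 2) x) :=
    ⟨X.metric.toRiemannianMetric⟩
  exact riemannianEDist_comm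

lemma edist_triangle (p q r : X.Point) : X.edist p r ≤ X.edist p q + X.edist q r := by
  let : RiemannianBundle (fun x : X.Point => TangentSpace (𝓡 2) x) :=
    ⟨X.metric.toRiemannianMetric⟩
  have : IsManifold (𝓡 2) 1 X.Point := .of_le (n := ∞) (by norm_cast)
  exact riemannianEDist_triangle

lemma diam_le {D : ℝ≥0∞} (h : ∀ p q, X.edist p q ≤ D) : X.toSurface.diam ≤ D :=
  iSup_le fun p => iSup_le fun q => h p q

-- The inclusion is isometric, so the length of a curve is computed from its Euclidean speed.
open Classical in
lemma edist_le_of_curve {c : ℝ → Space} {a b B : ℝ} (hab : a ≤ b)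
    (hc : ∀ t ∈ Icc a b, ContDiffAt ℝ 1 c t) (hm : ∀ t ∈ Icc a b, c t ∈ X.carrier)
    (hB : ∀ t ∈ Ioo a b, ‖deriv c t‖ ≤ B) {p q : X.Point} (hp : incl p = c a)
    (hq : incl q = c b) : X.edist p q ≤ ENNReal.ofReal (B * (b - a)) := by
  let : RiemannianBundle (fun x : X.Point => TangentSpace (𝓡 2) x) :=
    ⟨X.metric.toRiemannianMetric⟩
  -- The value `p` where `c` leaves the surface is irrelevant: on `[a, b]` the curve stays in the
  -- carrier.
  set γ : ℝ → X.Point := fun t => if h : c t ∈ X.carrier then ⟨c t, h⟩ else p with hγ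
  have hγc : ∀ t ∈ Icc a b, incl (γ t) = c t := fun t ht => by
    have h : γ t = ⟨c t, hm t ht⟩ := dif_pos (hm t ht)
    rw [h]
    rfl
  have h1 : riemannianEDist (𝓡 2) p q ≤ pathELength (𝓡 2) γ a b := by
    refine riemannianEDist_le_pathELength (fun t ht => ?_) ?_ ?_ hab
    · refine X.contMDiffWithinAt_of_incl ?_
      exact (hc t ht).contDiffWithinAt.congr hγc (hγc t ht)
    · exact X.injective_incl ((hγc a ⟨le_rfl, hab⟩).trans hp.symm)
    · exact X.injective_incl ((hγc b ⟨hab, le_rfl⟩).trans hq.symm)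
  refine h1.trans ?_
  rw [pathELength_eq_lintegral_mfderiv_Ioo]
  have h2 : ∀ t ∈ Ioo a b, ‖mfderiv 𝓘(ℝ, ℝ) (𝓡 2) γ t (1 : ℝ)‖ₑ ≤ ENNReal.ofReal B := by
    intro t ht
    have h3 : incl ∘ γ =ᶠ[𝓝 t] c := by
      filter_upwards [Ioo_mem_nhds ht.1 ht.2] with s hs using hγc s (Ioo_subset_Icc_self hs)
    have h4 := X.inclDeriv_mfderiv
      ((hc t (Ioo_subset_Icc_self ht)).congr_of_eventuallyEq h3)
    refine (X.enorm_tangent _ _).trans_le ?_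
    rw [h4, h3.deriv_eq, ← ofReal_norm]
    exact ENNReal.ofReal_le_ofReal (hB t ht)
  refine (setLIntegral_mono' measurableSet_Ioo h2).trans ?_
  rw [setLIntegral_const, Real.volume_Ioo]
  -- The sign of `B` is known only if the open interval contains a point.
  rcases hab.eq_or_lt with rfl | hlt
  · simp
  · have hB0 : 0 ≤ B := (norm_nonneg _).trans (hB ((a + b) / 2) ⟨by linarith, by linarith⟩)
    rw [ENNReal.ofReal_mul hB0]

end EmbeddedSurface

/-! ### The profile of the dumbbell -/

namespace Dumbbell

/-- A smooth step from `0` at `1` to `1` at `2`. -/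
def step (x : ℝ) : ℝ := Real.smoothTransition (x - 1)

lemma contDiff_step : ContDiff ℝ ∞ step :=
  Real.smoothTransition.contDiff.comp (contDiff_id.sub contDiff_const)

lemma step_nonneg (x : ℝ) : 0 ≤ step x := Real.smoothTransition.nonneg _

lemma step_le_one (x : ℝ) : step x ≤ 1 := Real.smoothTransition.le_one _

lemma step_of_le {x : ℝ} (hx : x ≤ 1) : step x = 0 :=
  Real.smoothTransition.zero_of_nonpos (by linarith)

lemma step_of_ge {x : ℝ} (hx : 2 ≤ x) : step x = 1 :=
  Real.smoothTransition.one_of_one_le (by linarith)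

lemma monotone_step : Monotone step := fun _ _ h =>
  Real.smoothTransition.monotone (by linarith)

/-- The square of the radius of the right half of the dumbbell. -/
def rightSq (ε x : ℝ) : ℝ := ε ^ 2 + step x ^ 6 * (x * (4 - x) - ε ^ 2)

/-- The square of the radius of the dumbbell. -/
def radiusSq (ε x : ℝ) : ℝ := rightSq ε x + rightSq ε (-x) - ε ^ 2

variable {ε x : ℝ}

lemma contDiff_rightSq : ContDiff ℝ ∞ (rightSq ε) := by
  unfold rightSq
  have := contDiff_step
  fun_prop

lemma contDiff_radiusSq : ContDiff ℝ ∞ (radiusSq ε) := by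
  unfold radiusSq
  have := contDiff_rightSq (ε := ε)
  fun_prop

lemma radiusSq_neg (ε x : ℝ) : radiusSq ε (-x) = radiusSq ε x := by
  simp only [radiusSq, neg_neg]
  ring

lemma radiusSq_abs (ε x : ℝ) : radiusSq ε |x| = radiusSq ε x := by
  rcases abs_choice x with h | h <;> rw [h]
  exact radiusSq_neg ε x

lemma radiusSq_eq_rightSq (hx : -1 ≤ x) : radiusSq ε x = rightSq ε x := by
  simp [radiusSq, rightSq, step_of_le (show -x ≤ 1 by linarith)]

lemma radiusSq_of_abs_le (hx : |x| ≤ 1) : radiusSq ε x = ε ^ 2 := by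
  rw [← radiusSq_abs, radiusSq_eq_rightSq (by linarith [abs_nonneg x]), rightSq, step_of_le hx]
  ring

lemma radiusSq_of_two_le (hx : 2 ≤ x) : radiusSq ε x = x * (4 - x) := by
  rw [radiusSq_eq_rightSq (by linarith), rightSq, step_of_ge hx]
  ring

lemma radiusSq_of_two_le_abs (hx : 2 ≤ |x|) : radiusSq ε x = |x| * (4 - |x|) := by
  rw [← radiusSq_abs, radiusSq_of_two_le hx]

/-- As a convex combination of `ε²` and `x(4 - x)`, the profile shows its sign and its bounds. -/
lemma rightSq_eq : rightSq ε x = ε ^ 2 * (1 - step x ^ 6) + step x ^ 6 * (x * (4 - x)) := by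
  rw [rightSq]
  ring

/-- On `[1, 2]` one has `x(4 - x) ≥ 3`, and the term with `ε²` is nonnegative; before `1` the step
vanishes. The derivatives of the profile are measured against this lower bound. -/
lemma step_pow_le (hx0 : 0 ≤ x) (hx : x ≤ 2) : 3 * step x ^ 6 ≤ radiusSq ε x := by
  rw [radiusSq_eq_rightSq (by linarith), rightSq_eq]
  have h1 : step x ^ 6 ≤ 1 := pow_le_one₀ (step_nonneg x) (step_le_one x)
  have h0 : 0 ≤ step x ^ 6 := by positivity
  rcases le_total x 1 with h | h
  · rw [step_of_le h]
    nlinarith [sq_nonneg ε]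
  · nlinarith [mul_nonneg (sq_nonneg ε) (sub_nonneg.mpr h1),
      mul_nonneg h0 (mul_nonneg (sub_nonneg.mpr h) (show 0 ≤ 3 - x by linarith))]

lemma radiusSq_pos (hε : 0 < ε) (hx : |x| < 4) : 0 < radiusSq ε x := by
  rw [← radiusSq_abs, radiusSq_eq_rightSq (by linarith [abs_nonneg x]), rightSq_eq]
  set y := |x|
  have h1 : step y ^ 6 ≤ 1 := pow_le_one₀ (step_nonneg y) (step_le_one y)
  rcases le_total y 1 with h | h
  · rw [step_of_le h]
    nlinarith [sq_pos_of_pos hε]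
  · have h2 : 0 < y * (4 - y) := mul_pos (by linarith) (by linarith)
    have h0 : 0 ≤ step y ^ 6 := pow_nonneg (step_nonneg y) 6
    rcases h0.eq_or_lt with h3 | h3
    · rw [← h3]
      nlinarith [sq_pos_of_pos hε]
    · nlinarith [mul_pos h3 h2, mul_nonneg (sq_nonneg ε) (sub_nonneg.mpr h1)]

lemma radiusSq_nonneg (hε : 0 < ε) (hx : |x| ≤ 4) : 0 ≤ radiusSq ε x := by
  rcases hx.eq_or_lt with h | h
  · rw [radiusSq_of_two_le_abs (by linarith), h]
    norm_num
  · exact (radiusSq_pos hε h).le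

lemma radiusSq_le (hε : 0 < ε) (hε1 : ε ≤ 1) : radiusSq ε x ≤ 4 := by
  rw [← radiusSq_abs, radiusSq_eq_rightSq (by linarith [abs_nonneg x]), rightSq_eq]
  set y := |x|
  have h1 : step y ^ 6 ≤ 1 := pow_le_one₀ (step_nonneg y) (step_le_one y)
  have h0 : 0 ≤ step y ^ 6 := pow_nonneg (step_nonneg y) 6
  nlinarith [mul_nonneg h0 (sq_nonneg (y - 2)), mul_nonneg (sub_nonneg.mpr h1)
    (show 0 ≤ 4 - ε ^ 2 by nlinarith)]

/-- Both the step and `x(4 - x) - ε²` increase on `[1, 2]`, and the latter is nonnegative. -/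
lemma monotoneOn_radiusSq (hε : 0 < ε) (hε1 : ε ≤ 1) : MonotoneOn (radiusSq ε) (Icc 1 2) := by
  intro a ha b hb hab
  rw [radiusSq_eq_rightSq (by linarith [ha.1]), radiusSq_eq_rightSq (by linarith [hb.1]),
    rightSq, rightSq]
  have h1 : step a ^ 6 ≤ step b ^ 6 := pow_le_pow_left₀ (step_nonneg a) (monotone_step hab) 6
  have h2 : a * (4 - a) ≤ b * (4 - b) := by nlinarith [ha.1, ha.2, hb.1, hb.2]
  have h3 : 0 ≤ a * (4 - a) - ε ^ 2 := by nlinarith [ha.1, ha.2]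
  have h4 : 0 ≤ step b ^ 6 := pow_nonneg (step_nonneg b) 6
  nlinarith [mul_le_mul_of_nonneg_right h1 h3, mul_le_mul_of_nonneg_left
    (sub_le_sub_right h2 (ε ^ 2)) h4]

/-! ### Derivatives of the profile -/

/-- The derivative of the squared radius. -/
def radiusSq' (ε : ℝ) : ℝ → ℝ := deriv (radiusSq ε)

/-- The second derivative of the squared radius. -/
def radiusSq'' (ε : ℝ) : ℝ → ℝ := deriv (radiusSq' ε)

lemma contDiff_radiusSq' : ContDiff ℝ ∞ (radiusSq' ε) :=
  (contDiff_infty_iff_deriv.mp contDiff_radiusSq).2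

lemma contDiff_radiusSq'' : ContDiff ℝ ∞ (radiusSq'' ε) :=
  (contDiff_infty_iff_deriv.mp contDiff_radiusSq').2

lemma hasDerivAt_radiusSq (ε x : ℝ) : HasDerivAt (radiusSq ε) (radiusSq' ε x) x :=
  (contDiff_radiusSq.differentiable (by simp) x).hasDerivAt

lemma hasDerivAt_radiusSq' (ε x : ℝ) : HasDerivAt (radiusSq' ε) (radiusSq'' ε x) x :=
  (contDiff_radiusSq'.differentiable (by simp) x).hasDerivAt

lemma radiusSq'_neg (ε x : ℝ) : radiusSq' ε (-x) = -radiusSq' ε x := by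
  have h : (fun y => radiusSq ε (-y)) = radiusSq ε := funext (radiusSq_neg ε)
  have h1 := deriv_comp_neg (radiusSq ε) x
  rw [h] at h1
  rw [radiusSq', h1, neg_neg]

lemma radiusSq''_neg (ε x : ℝ) : radiusSq'' ε (-x) = radiusSq'' ε x := by
  have h : (fun y => radiusSq' ε (-y)) = -radiusSq' ε := funext (radiusSq'_neg ε)
  have h1 := deriv_comp_neg (radiusSq' ε) x
  rw [h, deriv.neg] at h1
  exact (neg_injective h1).symm

lemma radiusSq'_sq_abs (ε x : ℝ) : radiusSq' ε |x| ^ 2 = radiusSq' ε x ^ 2 := by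
  rcases abs_choice x with h | h <;> rw [h]
  rw [radiusSq'_neg, neg_sq]

lemma radiusSq''_abs (ε x : ℝ) : radiusSq'' ε |x| = radiusSq'' ε x := by
  rcases abs_choice x with h | h <;> rw [h]
  exact radiusSq''_neg ε x

lemma hasDerivAt_step (x : ℝ) : HasDerivAt step (deriv step x) x :=
  (contDiff_step.differentiable (by simp) x).hasDerivAt

lemma hasDerivAt_deriv_step (x : ℝ) : HasDerivAt (deriv step) (deriv (deriv step) x) x :=
  ((contDiff_infty_iff_deriv.mp contDiff_step).2.differentiable (by simp) x).hasDerivAt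

lemma radiusSq'_eq (hx : -1 < x) : radiusSq' ε x =
    6 * step x ^ 5 * deriv step x * (x * (4 - x) - ε ^ 2) + step x ^ 6 * (4 - 2 * x) := by
  have h1 : radiusSq ε =ᶠ[𝓝 x] rightSq ε := by
    filter_upwards [Ioi_mem_nhds hx] with y hy using radiusSq_eq_rightSq (le_of_lt hy)
  have h2 : HasDerivAt (fun y : ℝ => y * (4 - y) - ε ^ 2) (4 - 2 * x) x := by
    have := ((hasDerivAt_id x).mul ((hasDerivAt_id x).const_sub 4)).sub_const (ε ^ 2)
    convert! this using 1
    simp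
    ring
  rw [radiusSq', h1.deriv_eq]
  refine HasDerivAt.deriv ?_
  convert! (((hasDerivAt_step x).pow 6).mul h2).const_add (ε ^ 2) using 1

lemma radiusSq''_eq (hx : -1 < x) : radiusSq'' ε x =
    (30 * step x ^ 4 * deriv step x ^ 2 + 6 * step x ^ 5 * deriv (deriv step) x) *
      (x * (4 - x) - ε ^ 2) + 12 * step x ^ 5 * deriv step x * (4 - 2 * x) - 2 * step x ^ 6 := by
  have h1 : radiusSq' ε =ᶠ[𝓝 x] fun y => 6 * step y ^ 5 * deriv step y * (y * (4 - y) - ε ^ 2) +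
      step y ^ 6 * (4 - 2 * y) := by
    filter_upwards [Ioi_mem_nhds hx] with y hy using radiusSq'_eq hy
  have h2 : HasDerivAt (fun y : ℝ => y * (4 - y) - ε ^ 2) (4 - 2 * x) x := by
    have := ((hasDerivAt_id x).mul ((hasDerivAt_id x).const_sub 4)).sub_const (ε ^ 2)
    convert! this using 1
    simp
    ring
  have h3 : HasDerivAt (fun y : ℝ => 4 - 2 * y) (-2) x := by
    simpa using ((hasDerivAt_id x).const_mul 2).const_sub 4
  rw [radiusSq'', h1.deriv_eq]
  refine HasDerivAt.deriv ?_
  convert! (((((hasDerivAt_step x).pow 5).const_mul 6).mul (hasDerivAt_deriv_step x)).mul h2).add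
    (((hasDerivAt_step x).pow 6).mul h3) using 1
  simp
  ring

lemma radiusSq''_of_two_lt (hx : 2 < |x|) : radiusSq'' ε x = -2 := by
  rw [← radiusSq''_abs]
  have h1 : ∀ y, 2 < y → radiusSq' ε y = 4 - 2 * y := by
    intro y hy
    have h1 : radiusSq ε =ᶠ[𝓝 y] fun z => z * (4 - z) := by
      filter_upwards [Ioi_mem_nhds hy] with z hz using radiusSq_of_two_le (le_of_lt hz)
    rw [radiusSq', h1.deriv_eq]
    refine HasDerivAt.deriv ?_
    convert! (hasDerivAt_id y).mul ((hasDerivAt_id y).const_sub 4) using 1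
    simp
    ring
  have h2 : radiusSq' ε =ᶠ[𝓝 |x|] fun z => 4 - 2 * z := by
    filter_upwards [Ioi_mem_nhds hx] with z hz using h1 z hz
  rw [radiusSq'', h2.deriv_eq]
  refine HasDerivAt.deriv ?_
  simpa using ((hasDerivAt_id |x|).const_mul 2).const_sub 4

/-- At `x = 2` the explicit profile is known on one side only, so uniqueness of one-sided
derivatives is used. -/
lemma radiusSq'_of_two_le (hx : 2 ≤ x) : radiusSq' ε x = 4 - 2 * x := by
  have h1 : HasDerivWithinAt (fun z : ℝ => z * (4 - z)) (4 - 2 * x) (Ici 2) x := by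
    have := (hasDerivAt_id x).mul ((hasDerivAt_id x).const_sub 4)
    refine HasDerivAt.hasDerivWithinAt ?_
    convert! this using 1
    simp
    ring
  have h2 : HasDerivWithinAt (fun z : ℝ => z * (4 - z)) (radiusSq' ε x) (Ici 2) x :=
    (hasDerivAt_radiusSq ε x).hasDerivWithinAt.congr
      (fun y hy => (radiusSq_of_two_le hy).symm) (radiusSq_of_two_le hx).symm
  exact (uniqueDiffOn_Ici (2 : ℝ) x hx).eq_deriv _ h2 h1

lemma radiusSq'_of_abs_le (hx : |x| ≤ 1) : radiusSq' ε x = 0 := by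
  -- The derivative is odd; its square is even, which reduces the claim to nonnegative arguments.
  have h : radiusSq' ε |x| ^ 2 = 0 := by
    rw [radiusSq'_eq (by linarith [abs_nonneg x]), step_of_le hx]
    ring
  rw [radiusSq'_sq_abs] at h
  exact pow_eq_zero_iff (two_ne_zero) |>.mp h

lemma exists_bound_deriv_step :
    ∃ M, 0 ≤ M ∧ ∀ x ∈ Icc (0 : ℝ) 2, |deriv step x| ≤ M ∧ |deriv (deriv step) x| ≤ M := by
  have h1 := (contDiff_infty_iff_deriv.mp contDiff_step).2
  have h2 := (contDiff_infty_iff_deriv.mp h1).2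
  obtain ⟨M, hM⟩ := (isCompact_Icc (a := (0 : ℝ)) (b := 2)).exists_bound_of_continuousOn
    h1.continuous.continuousOn
  obtain ⟨N, hN⟩ := (isCompact_Icc (a := (0 : ℝ)) (b := 2)).exists_bound_of_continuousOn
    h2.continuous.continuousOn
  refine ⟨max M N, ?_, fun x hx => ⟨(hM x hx).trans (le_max_left _ _),
    (hN x hx).trans (le_max_right _ _)⟩⟩
  exact (norm_nonneg _).trans ((hM 0 (by simp)).trans (le_max_left _ _))

/-- The neck bends gently, uniformly in the radius of the handle. -/
lemma exists_bound_radiusSq : ∃ C, 0 ≤ C ∧ ∀ ε, 0 < ε → ε ≤ 1 → ∀ x, |x| ≤ 2 →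
    radiusSq' ε x ^ 2 ≤ C * radiusSq ε x ∧ |radiusSq'' ε x| ^ 3 ≤ C * radiusSq ε x ^ 2 := by
  obtain ⟨M, hM0, hM⟩ := exists_bound_deriv_step
  -- The sum of the square of the constant in `e1` and the cube of the constant in `e2` serves both
  -- inequalities.
  refine ⟨(24 * M + 4) ^ 2 + (120 * M ^ 2 + 72 * M + 2) ^ 3, by positivity,
    fun ε hε hε1 x hx => ?_⟩
  rw [← radiusSq'_sq_abs, ← radiusSq_abs, ← radiusSq''_abs,
    radiusSq'_eq (by linarith [abs_nonneg x]), radiusSq''_eq (by linarith [abs_nonneg x])]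
  have hx0 := abs_nonneg x
  set y := |x|
  obtain ⟨hM1, hM2⟩ := hM y ⟨hx0, hx⟩
  have hs := step_pow_le (ε := ε) hx0 hx
  have hs0 := step_nonneg y
  have hs1 := step_le_one y
  set s := step y
  set s1 := deriv step y
  set s2 := deriv (deriv step) y
  set H := radiusSq ε y
  have hq : |y * (4 - y) - ε ^ 2| ≤ 4 := by
    rw [abs_le]
    constructor <;> nlinarith [sq_nonneg (y - 2), mul_nonneg hx0 (sub_nonneg.mpr hx)]
  have hl : |4 - 2 * y| ≤ 4 := by rw [abs_le]; constructor <;> linarith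
  set q := y * (4 - y) - ε ^ 2
  set l := 4 - 2 * y
  -- Each derivative of `s⁶` costs one power of `s`. The surviving powers `s³` and `s⁴` are chosen
  -- so that the square of the first is `s⁶` and the cube of the second is `(s⁶)²`, and `s⁶ ≤ H`.
  have e1 : |6 * s ^ 5 * s1 * q + s ^ 6 * l| ≤ s ^ 3 * (24 * M + 4) := by
    have a1 : |6 * s ^ 5 * s1 * q| ≤ 6 * s ^ 3 * M * 4 := by
      rw [abs_mul, abs_mul, abs_of_nonneg (by positivity : 0 ≤ 6 * s ^ 5)]
      have : s ^ 5 ≤ s ^ 3 := pow_le_pow_of_le_one hs0 hs1 (by norm_num)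
      gcongr
    have a2 : |s ^ 6 * l| ≤ s ^ 3 * 4 := by
      rw [abs_mul, abs_of_nonneg (by positivity : 0 ≤ s ^ 6)]
      have : s ^ 6 ≤ s ^ 3 := pow_le_pow_of_le_one hs0 hs1 (by norm_num)
      gcongr
    linarith [abs_add_le (6 * s ^ 5 * s1 * q) (s ^ 6 * l)]
  have e2 : |(30 * s ^ 4 * s1 ^ 2 + 6 * s ^ 5 * s2) * q + 12 * s ^ 5 * s1 * l - 2 * s ^ 6| ≤
      s ^ 4 * (120 * M ^ 2 + 72 * M + 2) := by
    have b5 : s ^ 5 ≤ s ^ 4 := pow_le_pow_of_le_one hs0 hs1 (by norm_num)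
    have b6 : s ^ 6 ≤ s ^ 4 := pow_le_pow_of_le_one hs0 hs1 (by norm_num)
    have a1 : |30 * s ^ 4 * s1 ^ 2 * q| ≤ 30 * s ^ 4 * M ^ 2 * 4 := by
      rw [abs_mul, abs_mul, abs_of_nonneg (by positivity : 0 ≤ 30 * s ^ 4), abs_pow]
      gcongr
    have a2 : |6 * s ^ 5 * s2 * q| ≤ 6 * s ^ 4 * M * 4 := by
      rw [abs_mul, abs_mul, abs_of_nonneg (by positivity : 0 ≤ 6 * s ^ 5)]
      gcongr
    have a3 : |12 * s ^ 5 * s1 * l| ≤ 12 * s ^ 4 * M * 4 := by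
      rw [abs_mul, abs_mul, abs_of_nonneg (by positivity : 0 ≤ 12 * s ^ 5)]
      gcongr
    have a4 : |2 * s ^ 6| ≤ 2 * s ^ 4 := by
      rw [abs_of_nonneg (by positivity)]
      gcongr
    rw [abs_le] at a1 a2 a3 a4 ⊢
    constructor <;> linarith [a1.1, a1.2, a2.1, a2.2, a3.1, a3.2, a4.1, a4.2]
  have hH0 : 0 ≤ H := le_trans (by positivity) hs
  have hsH : s ^ 6 ≤ H := by linarith [pow_nonneg hs0 6]
  constructor
  · calc _ = |6 * s ^ 5 * s1 * q + s ^ 6 * l| ^ 2 := (sq_abs _).symm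
      _ ≤ (s ^ 3 * (24 * M + 4)) ^ 2 := by gcongr
      _ = (24 * M + 4) ^ 2 * s ^ 6 := by ring
      _ ≤ ((24 * M + 4) ^ 2 + (120 * M ^ 2 + 72 * M + 2) ^ 3) * H := by
        gcongr
        linarith [show 0 ≤ (120 * M ^ 2 + 72 * M + 2) ^ 3 by positivity]
  · calc _ ≤ (s ^ 4 * (120 * M ^ 2 + 72 * M + 2)) ^ 3 := by gcongr
      _ = (120 * M ^ 2 + 72 * M + 2) ^ 3 * (s ^ 6) ^ 2 := by ring
      _ ≤ ((24 * M + 4) ^ 2 + (120 * M ^ 2 + 72 * M + 2) ^ 3) * H ^ 2 := by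
        gcongr
        linarith [show 0 ≤ (24 * M + 4) ^ 2 by positivity]

/-! ### The area density -/

/-- The area density of the dumbbell in cylindrical coordinates. -/
def areaDensity (ε x : ℝ) : ℝ := √(radiusSq ε x + radiusSq' ε x ^ 2 / 4)

lemma areaDensity_abs (ε x : ℝ) : areaDensity ε |x| = areaDensity ε x := by
  rw [areaDensity, areaDensity, radiusSq_abs, radiusSq'_sq_abs]

lemma areaDensity_neg (ε x : ℝ) : areaDensity ε (-x) = areaDensity ε x := by
  rw [← areaDensity_abs, abs_neg, areaDensity_abs]

/-- Archimedes: `x(4 - x) + (2 - x)² = 4`, the area density of a sphere of radius `2` being constant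
along its axis. -/
lemma radicand_of_two_le (hx : 2 ≤ |x|) : radiusSq ε x + radiusSq' ε x ^ 2 / 4 = 4 := by
  rw [← radiusSq_abs, ← radiusSq'_sq_abs, radiusSq_of_two_le hx, radiusSq'_of_two_le hx]
  ring

lemma areaDensity_of_two_le (hx : 2 ≤ |x|) : areaDensity ε x = 2 := by
  rw [areaDensity, radicand_of_two_le hx, show (4 : ℝ) = 2 ^ 2 by norm_num,
    Real.sqrt_sq (by norm_num)]

/-- On the caps the radicand is constant even at and beyond the poles, where the squared radius is
no longer positive. Hence the area density is smooth on the whole line. -/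
lemma radicand_pos (hε : 0 < ε) (x : ℝ) : 0 < radiusSq ε x + radiusSq' ε x ^ 2 / 4 := by
  rcases le_total 2 |x| with h | h
  · rw [radicand_of_two_le h]
    norm_num
  · have := radiusSq_pos hε (show |x| < 4 by linarith)
    positivity

lemma areaDensity_pos (hε : 0 < ε) (x : ℝ) : 0 < areaDensity ε x :=
  Real.sqrt_pos.mpr (radicand_pos hε x)

lemma areaDensity_sq (hε : 0 < ε) (x : ℝ) :
    areaDensity ε x ^ 2 = radiusSq ε x + radiusSq' ε x ^ 2 / 4 :=
  Real.sq_sqrt (radicand_pos hε x).le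

lemma contDiff_areaDensity (hε : 0 < ε) : ContDiff ℝ ∞ (areaDensity ε) := by
  have h1 := contDiff_radiusSq (ε := ε)
  have h2 := contDiff_radiusSq' (ε := ε)
  exact ContDiff.sqrt (by fun_prop) fun x => (radicand_pos hε x).ne'

lemma areaDensity_of_abs_le (hε : 0 < ε) (hx : |x| ≤ 1) : areaDensity ε x = ε := by
  rw [areaDensity, radiusSq_of_abs_le hx, radiusSq'_of_abs_le hx]
  simp [Real.sqrt_sq hε.le]

end Dumbbell

/-! ### The dumbbell and its four charts -/

namespace Dumbbell

/-- The dumbbell of revolution with handle of radius `ε`. -/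
def dumbbell (ε : ℝ) : Set Space := {q | |q 0| ≤ 4 ∧ q 1 ^ 2 + q 2 ^ 2 = radiusSq ε (q 0)}

/-- The sign attached to one of the two halves of the dumbbell. -/
def sgn (b : Bool) : ℝ := if b then 1 else -1

lemma sgn_sq (b : Bool) : sgn b ^ 2 = 1 := by cases b <;> norm_num [sgn]

lemma abs_sgn (b : Bool) : |sgn b| = 1 := by cases b <;> norm_num [sgn]

/-- Cylindrical coordinates. -/
def ofCyl (ε : ℝ) (b : Bool) (y : Plane) : Space :=
  !₂[y 0, sgn b * √(radiusSq ε (y 0)) * Real.cos (y 1),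
    sgn b * √(radiusSq ε (y 0)) * Real.sin (y 1)]

/-- The last two coordinates as a complex number, up to sign. -/
def transverse (b : Bool) (q : Space) : ℂ :=
  ((sgn b * q 1 : ℝ) : ℂ) + ((sgn b * q 2 : ℝ) : ℂ) * Complex.I

lemma transverse_re (b : Bool) (q : Space) : (transverse b q).re = sgn b * q 1 := by
  simp [transverse]

lemma transverse_im (b : Bool) (q : Space) : (transverse b q).im = sgn b * q 2 := by
  simp [transverse]

lemma norm_transverse (b : Bool) (q : Space) : ‖transverse b q‖ = √(q 1 ^ 2 + q 2 ^ 2) := by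
  rw [transverse, Complex.norm_add_mul_I]
  congr 1
  rw [mul_pow, mul_pow, sgn_sq]
  ring

lemma contDiff_coord (i : Fin 3) : ContDiff ℝ ∞ fun q : Space => q i :=
  contDiff_euclidean.mp contDiff_id i

lemma contDiff_coord_plane (i : Fin 2) : ContDiff ℝ ∞ fun y : Plane => y i :=
  contDiff_euclidean.mp contDiff_id i

lemma contDiff_transverse (b : Bool) : ContDiff ℝ ∞ (transverse b) := by
  have h1 := contDiff_coord 1
  have h2 := contDiff_coord 2
  have h3 : ContDiff ℝ ∞ fun x : ℝ => (x : ℂ) := Complex.ofRealCLM.contDiff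
  exact (h3.comp (contDiff_const.mul h1)).add ((h3.comp (contDiff_const.mul h2)).mul contDiff_const)

/-- The inverse of cylindrical coordinates. -/
def toCyl (b : Bool) (q : Space) : Plane := !₂[q 0, (transverse b q).arg]

variable {ε : ℝ}

lemma sqrt_radiusSq_pos (hε : 0 < ε) {x : ℝ} (hx : |x| < 4) : 0 < √(radiusSq ε x) :=
  Real.sqrt_pos.mpr (radiusSq_pos hε hx)

lemma contDiffAt_sqrt_radiusSq (hε : 0 < ε) {x : ℝ} (hx : |x| < 4) :
    ContDiffAt ℝ ∞ (fun x => √(radiusSq ε x)) x :=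
  contDiff_radiusSq.contDiffAt.sqrt (radiusSq_pos hε hx).ne'

lemma contDiffAt_ofCyl (hε : 0 < ε) (b : Bool) {y : Plane} (hy : |y 0| < 4) :
    ContDiffAt ℝ ∞ (ofCyl ε b) y := by
  have h0 := (contDiff_coord_plane 0).contDiffAt (x := y)
  have h1 := (contDiff_coord_plane 1).contDiffAt (x := y)
  have h2 : ContDiffAt ℝ ∞ (fun y : Plane => √(radiusSq ε (y 0))) y :=
    (contDiffAt_sqrt_radiusSq hε hy).comp (f := fun y : Plane => y 0) y h0
  rw [contDiffAt_euclidean]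
  intro i
  fin_cases i
  · exact h0
  · exact (contDiffAt_const.mul h2).mul (Real.contDiff_cos.contDiffAt.comp y h1)
  · exact (contDiffAt_const.mul h2).mul (Real.contDiff_sin.contDiffAt.comp y h1)

lemma contDiffAt_toCyl (b : Bool) {q : Space} (hq : transverse b q ∈ Complex.slitPlane) :
    ContDiffAt ℝ ∞ (toCyl b) q := by
  rw [contDiffAt_euclidean]
  intro i
  fin_cases i
  · exact (contDiff_coord 0).contDiffAt
  · have h1 : ContDiffAt ℝ ∞ Complex.log (transverse b q) :=
      (Complex.contDiffAt_log hq).restrict_scalars ℝ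
    have h2 := Complex.imCLM.contDiff.contDiffAt.comp q
      (h1.comp q (contDiff_transverse b).contDiffAt)
    exact h2.congr_of_eventuallyEq (.of_forall fun q => (Complex.log_im _).symm)

lemma ofCyl_apply_zero (b : Bool) (y : Plane) : ofCyl ε b y 0 = y 0 := rfl

lemma ofCyl_apply_one (b : Bool) (y : Plane) :
    ofCyl ε b y 1 = sgn b * √(radiusSq ε (y 0)) * Real.cos (y 1) := rfl

lemma ofCyl_apply_two (b : Bool) (y : Plane) :
    ofCyl ε b y 2 = sgn b * √(radiusSq ε (y 0)) * Real.sin (y 1) := rfl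

lemma ofCyl_mem (hε : 0 < ε) (b : Bool) {y : Plane} (hy : |y 0| ≤ 4) :
    ofCyl ε b y ∈ dumbbell ε := by
  refine ⟨hy, ?_⟩
  rw [ofCyl_apply_zero, ofCyl_apply_one, ofCyl_apply_two]
  have h := Real.sq_sqrt (radiusSq_nonneg hε hy)
  calc _ = sgn b ^ 2 * √(radiusSq ε (y 0)) ^ 2 * (Real.cos (y 1) ^ 2 + Real.sin (y 1) ^ 2) := by
        ring
    _ = _ := by rw [sgn_sq, h, Real.cos_sq_add_sin_sq]; ring

lemma transverse_ofCyl (b : Bool) (y : Plane) :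
    transverse b (ofCyl ε b y) = (√(radiusSq ε (y 0)) : ℂ) *
      (Complex.cos (y 1) + Complex.sin (y 1) * Complex.I) := by
  have h : (sgn b : ℂ) ^ 2 = 1 := by exact_mod_cast congrArg (fun x : ℝ => (x : ℂ)) (sgn_sq b)
  rw [transverse, ofCyl_apply_one, ofCyl_apply_two]
  push_cast
  linear_combination (√(radiusSq ε (y 0)) : ℂ) *
      (Complex.cos (y 1) + Complex.sin (y 1) * Complex.I) * h

lemma arg_transverse_ofCyl (hε : 0 < ε) (b : Bool) {y : Plane} (hy : |y 0| < 4)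
    (hy1 : y 1 ∈ Ioo (-Real.pi) Real.pi) : (transverse b (ofCyl ε b y)).arg = y 1 := by
  rw [transverse_ofCyl]
  exact Complex.arg_mul_cos_add_sin_mul_I (sqrt_radiusSq_pos hε hy) ⟨hy1.1, hy1.2.le⟩

lemma ofCyl_toCyl (b : Bool) {q : Space} (hq : q ∈ dumbbell ε) : ofCyl ε b (toCyl b q) = q := by
  have h1 : ‖transverse b q‖ = √(radiusSq ε (q 0)) := by rw [norm_transverse, hq.2]
  have h2 := Complex.norm_mul_cos_arg (transverse b q)
  have h3 := Complex.norm_mul_sin_arg (transverse b q)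
  rw [h1, transverse_re] at h2
  rw [h1, transverse_im] at h3
  have h4 := sgn_sq b
  ext i
  fin_cases i
  · rfl
  · change sgn b * √(radiusSq ε (q 0)) * Real.cos (transverse b q).arg = q 1
    linear_combination sgn b * h2 + q 1 * h4
  · change sgn b * √(radiusSq ε (q 0)) * Real.sin (transverse b q).arg = q 2
    linear_combination sgn b * h3 + q 2 * h4

/-- The chart given by cylindrical coordinates. -/
def cylChart (hε : 0 < ε) (b : Bool) : SurfaceChart (dumbbell ε) where
  toPlane := toCyl b
  ofPlane := ofCyl ε b
  source := {q | |q 0| < 4 ∧ transverse b q ∈ Complex.slitPlane}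
  target := {y | |y 0| < 4 ∧ y 1 ∈ Ioo (-Real.pi) Real.pi}
  isOpen_source := (isOpen_lt (contDiff_coord 0).continuous.abs continuous_const).inter
    (Complex.isOpen_slitPlane.preimage (contDiff_transverse b).continuous)
  isOpen_target := (isOpen_lt (contDiff_coord_plane 0).continuous.abs continuous_const).inter
    (isOpen_Ioo.preimage (contDiff_coord_plane 1).continuous)
  smooth_toPlane q hq := (contDiffAt_toCyl b hq.2).contDiffWithinAt
  smooth_ofPlane y hy := (contDiffAt_ofCyl hε b hy.1).contDiffWithinAt
  toPlane_mem q _ hq := by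
    refine ⟨hq.1, Complex.neg_pi_lt_arg _, ?_⟩
    exact lt_of_le_of_ne (Complex.arg_le_pi _) (Complex.mem_slitPlane_iff_arg.mp hq.2).1
  ofPlane_mem y hy := ofCyl_mem hε b hy.1.le
  ofPlane_mem_source y hy := by
    refine ⟨hy.1, Complex.mem_slitPlane_iff_arg.mpr ⟨?_, ?_⟩⟩
    · rw [arg_transverse_ofCyl hε b hy.1 hy.2]
      exact hy.2.2.ne
    · rw [← norm_ne_zero_iff, norm_transverse, (ofCyl_mem hε b hy.1.le).2]
      exact (sqrt_radiusSq_pos hε hy.1).ne'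
  left_inv q hq _ := ofCyl_toCyl b hq
  right_inv y hy := by
    ext i
    fin_cases i
    · rfl
    · exact arg_transverse_ofCyl hε b hy.1 hy.2

/-- Orthographic coordinates near a pole. -/
def ofPole (b : Bool) (y : Plane) : Space :=
  !₂[sgn b * (2 + √(4 - (y 0 ^ 2 + y 1 ^ 2))), y 0, y 1]

lemma ofPole_mem (b : Bool) {y : Plane} (hy : y 0 ^ 2 + y 1 ^ 2 < 1) :
    2 < sgn b * ofPole b y 0 ∧ ofPole b y ∈ dumbbell ε := by
  have h1 : 0 < √(4 - (y 0 ^ 2 + y 1 ^ 2)) := Real.sqrt_pos.mpr (by linarith)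
  have h2 : √(4 - (y 0 ^ 2 + y 1 ^ 2)) ^ 2 = 4 - (y 0 ^ 2 + y 1 ^ 2) := Real.sq_sqrt (by linarith)
  have h3 : ofPole b y 0 = sgn b * (2 + √(4 - (y 0 ^ 2 + y 1 ^ 2))) := rfl
  have h4 : |ofPole b y 0| = 2 + √(4 - (y 0 ^ 2 + y 1 ^ 2)) := by
    rw [h3, abs_mul, abs_sgn, one_mul, abs_of_pos (by linarith)]
  refine ⟨?_, ?_, ?_⟩
  · rw [h3, ← mul_assoc, ← sq, sgn_sq]
    linarith
  · rw [h4]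
    nlinarith [sq_nonneg (y 0), sq_nonneg (y 1)]
  · rw [radiusSq_of_two_le_abs (by linarith), h4]
    change y 0 ^ 2 + y 1 ^ 2 = _
    linear_combination h2

/-- The chart given by orthographic coordinates near a pole. -/
def poleChart (ε : ℝ) (b : Bool) : SurfaceChart (dumbbell ε) where
  toPlane q := !₂[q 1, q 2]
  ofPlane := ofPole b
  source := {q | 2 < sgn b * q 0 ∧ q 1 ^ 2 + q 2 ^ 2 < 1}
  target := {y | y 0 ^ 2 + y 1 ^ 2 < 1}
  isOpen_source := (isOpen_lt continuous_const
    (continuous_const.mul (contDiff_coord 0).continuous)).inter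
    (isOpen_lt (f := fun q : Space => q 1 ^ 2 + q 2 ^ 2)
      (((contDiff_coord 1).continuous.pow 2).add ((contDiff_coord 2).continuous.pow 2))
      continuous_const)
  isOpen_target := isOpen_lt (((contDiff_coord_plane 0).continuous.pow 2).add
    ((contDiff_coord_plane 1).continuous.pow 2)) continuous_const
  smooth_toPlane := by
    refine ContDiff.contDiffOn (contDiff_euclidean.mpr fun i => ?_)
    fin_cases i
    · exact contDiff_coord 1
    · exact contDiff_coord 2
  smooth_ofPlane y hy := by
    refine ContDiffAt.contDiffWithinAt (contDiffAt_euclidean.mpr fun i => ?_)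
    have h0 := (contDiff_coord_plane 0).contDiffAt (x := y)
    have h1 := (contDiff_coord_plane 1).contDiffAt (x := y)
    have hy' : y 0 ^ 2 + y 1 ^ 2 < 1 := hy
    fin_cases i
    · exact contDiffAt_const.mul (contDiffAt_const.add
        ((contDiffAt_const.sub ((h0.pow 2).add (h1.pow 2))).sqrt (by simp only; linarith)))
    · exact h0
    · exact h1
  toPlane_mem _ _ hq := hq.2
  ofPlane_mem _ hy := (ofPole_mem b hy).2
  ofPlane_mem_source _ hy := ⟨(ofPole_mem (ε := ε) b hy).1, hy⟩
  left_inv q hq hs := by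
    have h1 : 2 < sgn b * q 0 := hs.1
    have h2 : sgn b * q 0 = |q 0| := by
      rw [← one_mul |q 0|, ← abs_sgn b, ← abs_mul, abs_of_pos (by linarith)]
    have h3 := hq.2
    rw [radiusSq_of_two_le_abs (by linarith), ← h2] at h3
    have h4 : √(4 - (q 1 ^ 2 + q 2 ^ 2)) = sgn b * q 0 - 2 := by
      rw [show 4 - (q 1 ^ 2 + q 2 ^ 2) = (sgn b * q 0 - 2) ^ 2 by rw [h3]; ring]
      exact Real.sqrt_sq (by linarith)
    ext i
    fin_cases i
    · change sgn b * (2 + √(4 - (q 1 ^ 2 + q 2 ^ 2))) = q 0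
      rw [h4]
      linear_combination q 0 * sgn_sq b
    · rfl
    · rfl
  right_inv y hy := by
    ext i
    fin_cases i <;> rfl

lemma isCompact_dumbbell (hε : 0 < ε) (hε1 : ε ≤ 1) : IsCompact (dumbbell ε) := by
  refine Metric.isCompact_of_isClosed_isBounded ?_ ?_
  · refine (isClosed_le (contDiff_coord 0).continuous.abs continuous_const).inter
      (isClosed_eq (((contDiff_coord 1).continuous.pow 2).add
        ((contDiff_coord 2).continuous.pow 2)) ?_)
    exact contDiff_radiusSq.continuous.comp (contDiff_coord 0).continuous
  · refine (Metric.isBounded_closedBall (x := (0 : Space)) (r := 5)).subset fun q hq => ?_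
    rw [mem_closedBall_zero_iff, EuclideanSpace.norm_eq, Fin.sum_univ_three]
    refine Real.sqrt_le_iff.mpr ⟨by norm_num, ?_⟩
    simp only [Real.norm_eq_abs, sq_abs]
    have h1 := radiusSq_le hε hε1 (x := q 0)
    nlinarith [hq.2, sq_le_sq' (abs_le.mp hq.1).1 (abs_le.mp hq.1).2]

/-- Cylindrical coordinates are continuous up to the poles and map a connected strip onto the
dumbbell. -/
lemma isConnected_dumbbell (hε : 0 < ε) : IsConnected (dumbbell ε) := by
  have h : dumbbell ε = (fun z : ℝ × ℝ => ofCyl ε true !₂[z.1, z.2]) '' (Icc (-4) 4 ×ˢ univ) := by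
    ext q
    constructor
    · intro hq
      refine ⟨(q 0, (transverse true q).arg), ⟨abs_le.mp hq.1, mem_univ _⟩, ?_⟩
      exact ofCyl_toCyl true hq
    · rintro ⟨z, hz, rfl⟩
      exact ofCyl_mem hε true (abs_le.mpr hz.1)
  rw [h]
  refine (((isConnected_Icc (by norm_num)).prod isConnected_univ)).image _
    (Continuous.continuousOn ?_)
  have h1 := (contDiff_radiusSq (ε := ε)).continuous
  refine (PiLp.continuous_toLp 2 _).comp (continuous_pi fun i => ?_)
  fin_cases i
  · exact continuous_fst
  · exact (continuous_const.mul (h1.comp continuous_fst).sqrt).mul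
      (Real.continuous_cos.comp continuous_snd)
  · exact (continuous_const.mul (h1.comp continuous_fst).sqrt).mul
      (Real.continuous_sin.comp continuous_snd)

open Classical in
/-- The index of a chart whose domain contains the point. Orthographic coordinates are used at the
poles only. -/
def chartIndex (q : Space) : Bool × Bool :=
  if q 1 = 0 ∧ q 2 = 0 then (false, decide (0 ≤ q 0))
  else (true, decide (transverse true q ∈ Complex.slitPlane))

lemma abs_eq_four (hε : 0 < ε) {q : Space} (hq : q ∈ dumbbell ε) (h1 : q 1 = 0) (h2 : q 2 = 0) :
    |q 0| = 4 := by
  refine le_antisymm hq.1 (le_of_not_gt fun h => ?_)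
  have := radiusSq_pos hε h
  rw [← hq.2, h1, h2] at this
  norm_num at this

lemma abs_lt_four {q : Space} (hq : q ∈ dumbbell ε) (h : ¬(q 1 = 0 ∧ q 2 = 0)) : |q 0| < 4 := by
  refine lt_of_le_of_ne hq.1 fun h4 => h ?_
  have h3 := hq.2
  rw [radiusSq_of_two_le_abs (by linarith), h4] at h3
  constructor <;> nlinarith [sq_nonneg (q 1), sq_nonneg (q 2)]

lemma transverse_false (q : Space) : transverse false q = -transverse true q := by
  simp [transverse, sgn]
  ring

/-- The dumbbell of revolution as an embedded surface. -/
def surface (hε : 0 < ε) (hε1 : ε ≤ 1) : EmbeddedSurface where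
  carrier := dumbbell ε
  isCompact := isCompact_dumbbell hε hε1
  isConnected := isConnected_dumbbell hε
  Index := Bool × Bool
  chart j := if j.1 then cylChart hε j.2 else poleChart ε j.2
  index p := chartIndex p
  mem_source p := by
    unfold chartIndex
    split_ifs with h h1 h2
    · simp at h1
    · have h4 := abs_eq_four hε p.2 h.1 h.2
      refine ⟨?_, by rw [h.1, h.2]; norm_num⟩
      rcases le_or_gt 0 ((p : Space) 0) with h0 | h0
      · rw [abs_of_nonneg h0] at h4
        simp [sgn, h4]
        norm_num
      · rw [abs_of_neg h0] at h4
        simp [sgn, h0.not_ge]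
        linarith
    · refine ⟨abs_lt_four p.2 h, ?_⟩
      -- A nonzero complex number or its negative lies in the slit plane, so the two cylindrical
      -- charts, which differ by a half turn, cover everything off the axis.
      by_cases hs : transverse true p ∈ Complex.slitPlane
      · simp [hs]
      · have h0 : transverse true p ≠ 0 := by
          intro h0
          have h5 := congrArg Complex.re h0
          have h6 := congrArg Complex.im h0
          rw [transverse_re] at h5
          rw [transverse_im] at h6
          exact h ⟨by simpa [sgn] using h5, by simpa [sgn] using h6⟩
        simp only [hs, decide_false, transverse_false]
        exact Complex.mem_slitPlane_or_neg_mem_slitPlane h0 |>.resolve_left hs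
    · simp at h2

end Dumbbell

/-! ### The first fundamental form in the charts -/

lemma fderiv_apply_coord {F : Plane → Space} {y : Plane} (hF : DifferentiableAt ℝ F y) (v : Plane)
    (i : Fin 3) : fderiv ℝ F y v i = fderiv ℝ (fun z => F z i) y v := by
  have h : HasFDerivAt (fun z => F z i) ((EuclideanSpace.proj i : Space →L[ℝ] ℝ) ∘L fderiv ℝ F y)
      y := (EuclideanSpace.proj i : Space →L[ℝ] ℝ).hasFDerivAt.comp y hF.hasFDerivAt
  rw [h.fderiv]
  rfl

lemma hasFDerivAt_coord (i : Fin 2) (y : Plane) :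
    HasFDerivAt (fun z : Plane => z i) (EuclideanSpace.proj i : Plane →L[ℝ] ℝ) y :=
  (EuclideanSpace.proj i : Plane →L[ℝ] ℝ).hasFDerivAt

lemma fderiv_mul_coord {g k : ℝ → ℝ} {g' k' : ℝ} {y : Plane} (hg : HasDerivAt g g' (y 0))
    (hk : HasDerivAt k k' (y 1)) (v : Plane) :
    fderiv ℝ (fun z : Plane => g (z 0) * k (z 1)) y v = g' * v 0 * k (y 1) + g (y 0) * (k' * v 1) := by
  have h1 := hg.comp_hasFDerivAt y (hasFDerivAt_coord 0 y)
  have h2 := hk.comp_hasFDerivAt y (hasFDerivAt_coord 1 y)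
  have h3 := h1.mul h2
  have h4 := h3.fderiv
  refine (congrArg (fun A : Plane →L[ℝ] ℝ => A v) h4).trans ?_
  simp
  ring

lemma CoordMetric.pd_comp_coord_zero {g : ℝ → ℝ} {g' : ℝ} {y : Plane}
    (hg : HasDerivAt g g' (y 0)) :
    CoordMetric.pd 0 (fun z => g (z 0)) y = g' ∧ CoordMetric.pd 1 (fun z => g (z 0)) y = 0 := by
  have h := (hg.comp_hasFDerivAt y (hasFDerivAt_coord 0 y)).fderiv
  constructor
  · refine (congrArg (fun A : Plane →L[ℝ] ℝ => A (EuclideanSpace.single 0 1)) h).trans ?_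
    simp
  · refine (congrArg (fun A : Plane →L[ℝ] ℝ => A (EuclideanSpace.single 1 1)) h).trans ?_
    simp

namespace Dumbbell

variable {ε : ℝ}

lemma hasDerivAt_sqrt_radiusSq (hε : 0 < ε) {x : ℝ} (hx : |x| < 4) :
    HasDerivAt (fun x => √(radiusSq ε x)) (radiusSq' ε x / (2 * √(radiusSq ε x))) x :=
  (hasDerivAt_radiusSq ε x).sqrt (radiusSq_pos hε hx).ne'

lemma inner_space (v w : Space) : inner ℝ v w = v 0 * w 0 + v 1 * w 1 + v 2 * w 2 := by
  rw [PiLp.inner_apply, Fin.sum_univ_three]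
  simp [mul_comm]

lemma fderiv_ofCyl (hε : 0 < ε) (b : Bool) {y : Plane} (hy : |y 0| < 4) (v : Plane) :
    fderiv ℝ (ofCyl ε b) y v 0 = v 0 ∧
    fderiv ℝ (ofCyl ε b) y v 1 = sgn b * (radiusSq' ε (y 0) / (2 * √(radiusSq ε (y 0)))) * v 0 *
      Real.cos (y 1) - sgn b * √(radiusSq ε (y 0)) * (Real.sin (y 1) * v 1) ∧
    fderiv ℝ (ofCyl ε b) y v 2 = sgn b * (radiusSq' ε (y 0) / (2 * √(radiusSq ε (y 0)))) * v 0 *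
      Real.sin (y 1) + sgn b * √(radiusSq ε (y 0)) * (Real.cos (y 1) * v 1) := by
  have hd : DifferentiableAt ℝ (ofCyl ε b) y :=
    (contDiffAt_ofCyl hε b hy).differentiableAt (by simp)
  have hs := (hasDerivAt_sqrt_radiusSq hε hy).const_mul (sgn b)
  refine ⟨?_, ?_, ?_⟩
  · rw [fderiv_apply_coord hd]
    change fderiv ℝ (fun z : Plane => z 0) y v = _
    rw [(hasFDerivAt_coord 0 y).fderiv]
    rfl
  · rw [fderiv_apply_coord hd]
    refine (fderiv_mul_coord hs (Real.hasDerivAt_cos (y 1)) v).trans ?_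
    ring
  · rw [fderiv_apply_coord hd]
    exact fderiv_mul_coord hs (Real.hasDerivAt_sin (y 1)) v

/-- The first diagonal entry of the metric in cylindrical coordinates. -/
def cylA (ε x : ℝ) : ℝ := areaDensity ε x ^ 2 / radiusSq ε x

/-- Meridians are orthogonal to parallels, and with `h` the squared radius the meridian direction
has squared length `1 + h'²/(4h) = w²/h`. -/
lemma gram_cylChart (hε : 0 < ε) (b : Bool) {y : Plane} (hy : |y 0| < 4) :
    (cylChart hε b).gram y = !![cylA ε (y 0), 0; 0, radiusSq ε (y 0)] := by
  have h0 := radiusSq_pos hε hy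
  have h1 : √(radiusSq ε (y 0)) ^ 2 = radiusSq ε (y 0) := Real.sq_sqrt h0.le
  have h2 := sqrt_radiusSq_pos hε hy
  have h3 := sgn_sq b
  have h4 := Real.sin_sq_add_cos_sq (y 1)
  have hc : ∀ v w, inner ℝ (fderiv ℝ (ofCyl ε b) y v) (fderiv ℝ (ofCyl ε b) y w) =
      v 0 * w 0 * cylA ε (y 0) + v 1 * w 1 * radiusSq ε (y 0) := by
    intro v w
    obtain ⟨a0, a1, a2⟩ := fderiv_ofCyl hε b hy v
    obtain ⟨b0, b1, b2⟩ := fderiv_ofCyl hε b hy w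
    rw [inner_space, a0, a1, a2, b0, b1, b2, cylA, areaDensity_sq hε]
    set s := √(radiusSq ε (y 0))
    rw [← h1]
    have h5 : Real.cos (y 1) ^ 2 = 1 - Real.sin (y 1) ^ 2 := by linarith
    field_simp
    ring_nf
    simp only [h3, h5]
    ring
  ext i j
  refine (hc _ _).trans ?_
  fin_cases i <;> fin_cases j <;> simp

lemma det_gram_cylChart (hε : 0 < ε) (b : Bool) {y : Plane} (hy : |y 0| < 4) :
    √((cylChart hε b).gram y).det = areaDensity ε (y 0) := by
  have h0 := radiusSq_pos hε hy
  rw [gram_cylChart hε b hy, Matrix.det_fin_two_of, cylA, mul_zero, sub_zero,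
    div_mul_cancel₀ _ h0.ne', Real.sqrt_sq (areaDensity_pos hε _).le]

lemma fderiv_ofPole (b : Bool) {y : Plane} (hy : y 0 ^ 2 + y 1 ^ 2 < 1) (v : Plane) :
    fderiv ℝ (ofPole b) y v 0 =
      -(sgn b * (y 0 * v 0 + y 1 * v 1) / √(4 - (y 0 ^ 2 + y 1 ^ 2))) ∧
    fderiv ℝ (ofPole b) y v 1 = v 0 ∧ fderiv ℝ (ofPole b) y v 2 = v 1 := by
  have hd : DifferentiableAt ℝ (ofPole b) y :=
    ((poleChart 1 b).smooth_ofPlane.contDiffAt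
      ((poleChart 1 b).isOpen_target.mem_nhds hy)).differentiableAt (by simp)
  have hp := hasFDerivAt_coord 0 y
  have hq := hasFDerivAt_coord 1 y
  refine ⟨?_, ?_, ?_⟩
  · rw [fderiv_apply_coord hd]
    have h1 : HasFDerivAt (fun z : Plane => 4 - (z 0 ^ 2 + z 1 ^ 2))
      (-(2 * y 0) • (EuclideanSpace.proj 0 : Plane →L[ℝ] ℝ) -
        (2 * y 1) • (EuclideanSpace.proj 1 : Plane →L[ℝ] ℝ)) y := by
      convert! ((hp.pow 2).add (hq.pow 2)).const_sub 4 using 1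
      ext v
      simp
      ring
    have h2 := (((h1.sqrt (by linarith)).const_add 2).const_mul (sgn b)).fderiv
    refine (congrArg (fun A : Plane →L[ℝ] ℝ => A v) h2).trans ?_
    simp
    ring
  · rw [fderiv_apply_coord hd]
    change fderiv ℝ (fun z : Plane => z 0) y v = _
    rw [hp.fderiv]
    rfl
  · rw [fderiv_apply_coord hd]
    change fderiv ℝ (fun z : Plane => z 1) y v = _
    rw [hq.fderiv]
    rfl

/-- The cap is a graph over the disc with gradient proportional to `y`, so the metric is the
identity plus the rank-one matrix `y yᵀ / (4 - |y|²)`. -/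
lemma gram_poleChart (b : Bool) {y : Plane} (hy : y 0 ^ 2 + y 1 ^ 2 < 1) :
    (poleChart ε b).gram y =
      !![1 + y 0 ^ 2 / (4 - (y 0 ^ 2 + y 1 ^ 2)), y 0 * y 1 / (4 - (y 0 ^ 2 + y 1 ^ 2));
        y 0 * y 1 / (4 - (y 0 ^ 2 + y 1 ^ 2)), 1 + y 1 ^ 2 / (4 - (y 0 ^ 2 + y 1 ^ 2))] := by
  have h0 : 0 < 4 - (y 0 ^ 2 + y 1 ^ 2) := by linarith
  have h1 : √(4 - (y 0 ^ 2 + y 1 ^ 2)) ^ 2 = 4 - (y 0 ^ 2 + y 1 ^ 2) := Real.sq_sqrt h0.le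
  have h2 := Real.sqrt_pos.mpr h0
  have hc : ∀ v w, inner ℝ (fderiv ℝ (ofPole b) y v) (fderiv ℝ (ofPole b) y w) =
      v 0 * w 0 + v 1 * w 1 + (y 0 * v 0 + y 1 * v 1) * (y 0 * w 0 + y 1 * w 1) /
        (4 - (y 0 ^ 2 + y 1 ^ 2)) := by
    intro v w
    obtain ⟨a0, a1, a2⟩ := fderiv_ofPole b hy v
    obtain ⟨b0, b1, b2⟩ := fderiv_ofPole b hy w
    rw [inner_space, a0, a1, a2, b0, b1, b2]
    set s := √(4 - (y 0 ^ 2 + y 1 ^ 2))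
    rw [← h1]
    field_simp
    rw [sgn_sq]
    ring
  ext i j
  refine (hc _ _).trans ?_
  fin_cases i <;> fin_cases j <;> simp <;> ring

lemma det_gram_poleChart (b : Bool) {y : Plane} (hy : y 0 ^ 2 + y 1 ^ 2 < 1) :
    √((poleChart ε b).gram y).det = 2 / √(4 - (y 0 ^ 2 + y 1 ^ 2)) := by
  have h0 : 0 < 4 - (y 0 ^ 2 + y 1 ^ 2) := by linarith
  rw [gram_poleChart b hy, Matrix.det_fin_two_of]
  have : (1 + y 0 ^ 2 / (4 - (y 0 ^ 2 + y 1 ^ 2))) * (1 + y 1 ^ 2 / (4 - (y 0 ^ 2 + y 1 ^ 2))) -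
      y 0 * y 1 / (4 - (y 0 ^ 2 + y 1 ^ 2)) * (y 0 * y 1 / (4 - (y 0 ^ 2 + y 1 ^ 2))) =
      2 ^ 2 / (4 - (y 0 ^ 2 + y 1 ^ 2)) := by
    field_simp
    ring
  rw [this, Real.sqrt_div (by norm_num), Real.sqrt_sq (by norm_num)]

end Dumbbell

/-! ### The surface is a dumbbell of revolution -/

lemma hasDerivAt_space {c : ℝ → Space} {c' : Space} {t : ℝ}
    (h : ∀ i, HasDerivAt (fun s => c s i) (c' i) t) : HasDerivAt c c' t := by
  have h1 : HasDerivAt (fun s => (c s).ofLp) c'.ofLp t := hasDerivAt_pi.mpr h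
  exact ((PiLp.continuousLinearEquiv 2 ℝ fun _ : Fin 3 => ℝ).symm :
    (Fin 3 → ℝ) →L[ℝ] Space).hasFDerivAt.comp_hasDerivAt t h1

namespace Dumbbell

variable {ε : ℝ}

lemma isDumbbell_surface (hε : 0 < ε) (hε1 : ε ≤ 1) :
    (surface hε hε1).toSurface.IsDumbbell 2 2 ε := by
  -- The handle is `|x| ≤ 1`, the necks are `1 ≤ |x| ≤ 2`, and the half spheres of radius `2` are
  -- centred at `x = ±2`.
  refine ⟨2, fun x => √(radiusSq ε x), EmbeddedSurface.incl, ?_,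
    EmbeddedSurface.contMDiff_incl _, EmbeddedSurface.injective_incl _, fun p v w => ?_, ?_⟩
  · refine ⟨by norm_num, fun x => by simp only [radiusSq_neg], fun x hx => ?_, fun x hx => ?_,
      fun x hx y hy hxy => ?_, fun x hx => ?_⟩
    · refine (contDiffAt_sqrt_radiusSq hε (abs_lt.mpr ⟨?_, ?_⟩)).contDiffWithinAt
      · linarith [hx.1]
      · linarith [hx.2]
    · have : |x| ≤ 1 := abs_le.mpr ⟨by linarith [hx.1], by linarith [hx.2]⟩
      simp only [radiusSq_of_abs_le this, Real.sqrt_sq hε.le]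
    · rw [show (2 : ℝ) / 2 = 1 by norm_num] at hx hy
      exact Real.sqrt_le_sqrt (monotoneOn_radiusSq hε hε1 hx hy hxy)
    · rw [radiusSq_of_two_le hx.1]
      congr 1
      ring
  · rw [EmbeddedSurface.mfderiv_incl]
    rfl
  · rw [EmbeddedSurface.range_incl]
    ext q
    have h4 : (2 : ℝ) + 2 = 4 := by norm_num
    constructor
    · intro hq
      refine ⟨by rw [h4]; exact hq.1, ?_⟩
      simp only [Real.sq_sqrt (radiusSq_nonneg hε hq.1)]
      exact hq.2
    · rintro ⟨h1, h2⟩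
      rw [h4] at h1
      simp only [Real.sq_sqrt (radiusSq_nonneg hε h1)] at h2
      exact ⟨h1, h2⟩

/-! ### The diameter -/

lemma abs_sgn_mul (b : Bool) (x : ℝ) : |sgn b * x| = |x| := by
  rw [abs_mul, abs_sgn, one_mul]

/-- The point of the dumbbell with given cylindrical coordinates. -/
def cylPoint (hε : 0 < ε) (hε1 : ε ≤ 1) (x θ : ℝ) (hx : |x| ≤ 4) : (surface hε hε1).Point :=
  ⟨ofCyl ε true !₂[x, θ], ofCyl_mem hε true hx⟩

lemma ofCyl_true (x θ : ℝ) : ofCyl ε true !₂[x, θ] =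
    !₂[x, √(radiusSq ε x) * Real.cos θ, √(radiusSq ε x) * Real.sin θ] := by
  simp [ofCyl, sgn]

lemma sqrt_radiusSq_two : √(radiusSq ε 2) = 2 := by
  rw [radiusSq_of_two_le le_rfl, show (2 : ℝ) * (4 - 2) = 2 ^ 2 by norm_num,
    Real.sqrt_sq (by norm_num)]

/-- The radius `√h` has slope `h' / (2√h)`, bounded because `h'² ≤ C h`; so meridians cross handle
and necks at bounded speed, however thin the handle is. -/
lemma edist_meridian_le (hε : 0 < ε) (hε1 : ε ≤ 1) {C : ℝ} (hC0 : 0 ≤ C)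
    (hC : ∀ x, |x| ≤ 2 → radiusSq' ε x ^ 2 ≤ C * radiusSq ε x) {x : ℝ} (hx : |x| ≤ 2) (θ : ℝ) :
    (surface hε hε1).edist (cylPoint hε hε1 x θ (by linarith))
      (cylPoint hε hε1 2 θ (by norm_num)) ≤ ENNReal.ofReal ((1 + C) * 4) := by
  have hx' := abs_le.mp hx
  have hab : ∀ t ∈ Icc x 2, |t| ≤ 2 := fun t ht => abs_le.mpr ⟨by linarith [ht.1], ht.2⟩
  refine ((surface hε hε1).edist_le_of_curve (c := fun t => ofCyl ε true !₂[t, θ]) (a := x)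
    (b := 2) (B := 1 + C) hx'.2 (fun t ht => ?_) (fun t ht => ?_) (fun t ht => ?_) rfl rfl).trans ?_
  · have h4 : |(!₂[t, θ] : Plane) 0| < 4 := lt_of_le_of_lt (hab t ht) (by norm_num)
    have h5 : ContDiffAt ℝ 1 (ofCyl ε true) !₂[t, θ] :=
      (contDiffAt_ofCyl hε true h4).of_le (by norm_cast)
    refine h5.comp t (f := fun t => (!₂[t, θ] : Plane)) ?_
    refine contDiffAt_euclidean.mpr fun i => ?_
    fin_cases i
    · exact contDiffAt_id
    · exact contDiffAt_const
  · exact ofCyl_mem hε true (by have := hab t ht; simp; linarith)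
  · have ht2 := hab t (Ioo_subset_Icc_self ht)
    have h4 : |t| < 4 := by linarith
    have hs := hasDerivAt_sqrt_radiusSq hε h4
    set f' := radiusSq' ε t / (2 * √(radiusSq ε t)) with hf'
    have hd : HasDerivAt (fun t => ofCyl ε true !₂[t, θ])
        !₂[1, f' * Real.cos θ, f' * Real.sin θ] t := by
      simp only [ofCyl_true]
      refine hasDerivAt_space fun i => ?_
      fin_cases i
      · exact hasDerivAt_id t
      · exact hs.mul_const _
      · exact hs.mul_const _
    have h0 := radiusSq_pos hε h4
    have hf : f' ^ 2 ≤ C := by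
      rw [hf', div_pow, mul_pow, Real.sq_sqrt h0.le, div_le_iff₀ (by positivity)]
      have := hC t ht2
      nlinarith [mul_nonneg hC0 h0.le]
    rw [hd.deriv, EuclideanSpace.norm_eq, Fin.sum_univ_three]
    refine Real.sqrt_le_iff.mpr ⟨by linarith, ?_⟩
    simp only [Real.norm_eq_abs, sq_abs]
    change 1 ^ 2 + (f' * Real.cos θ) ^ 2 + (f' * Real.sin θ) ^ 2 ≤ _
    have h5 := Real.sin_sq_add_cos_sq θ
    have : 1 ^ 2 + (f' * Real.cos θ) ^ 2 + (f' * Real.sin θ) ^ 2 = 1 + f' ^ 2 := by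
      linear_combination f' ^ 2 * h5
    nlinarith
  · refine ENNReal.ofReal_le_ofReal ?_
    nlinarith

lemma edist_parallel_le (hε : 0 < ε) (hε1 : ε ≤ 1) {θ θ' : ℝ} (h : θ ≤ θ') :
    (surface hε hε1).edist (cylPoint hε hε1 2 θ (by norm_num))
      (cylPoint hε hε1 2 θ' (by norm_num)) ≤ ENNReal.ofReal (2 * (θ' - θ)) := by
  have hd : ∀ t, HasDerivAt (fun t => ofCyl ε true !₂[2, t])
      !₂[0, 2 * -Real.sin t, 2 * Real.cos t] t := by
    intro t
    simp only [ofCyl_true, sqrt_radiusSq_two]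
    refine hasDerivAt_space fun i => ?_
    fin_cases i
    · exact hasDerivAt_const _ _
    · exact (Real.hasDerivAt_cos t).const_mul 2
    · exact (Real.hasDerivAt_sin t).const_mul 2
  refine (surface hε hε1).edist_le_of_curve (c := fun t => ofCyl ε true !₂[2, t]) h
    (fun t ht => ?_) (fun t ht => ?_) (fun t ht => ?_) rfl rfl
  · simp only [ofCyl_true, sqrt_radiusSq_two]
    refine contDiffAt_euclidean.mpr fun i => ?_
    fin_cases i
    · exact contDiffAt_const
    · exact contDiffAt_const.mul Real.contDiff_cos.contDiffAt
    · exact contDiffAt_const.mul Real.contDiff_sin.contDiffAt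
  · exact ofCyl_mem hε true (by norm_num)
  · rw [(hd t).deriv, EuclideanSpace.norm_eq, Fin.sum_univ_three]
    refine Real.sqrt_le_iff.mpr ⟨by norm_num, ?_⟩
    simp only [Real.norm_eq_abs, sq_abs]
    change (0 : ℝ) ^ 2 + (2 * -Real.sin t) ^ 2 + (2 * Real.cos t) ^ 2 ≤ _
    nlinarith [Real.sin_sq_add_cos_sq t]

/-- The slope of the radius is unbounded near a pole, so the cap is crossed along a great circle
parametrized by its angle. Its length is at most `2 · π/2 ≤ 4`. -/
lemma edist_cap_le (hε : 0 < ε) (hε1 : ε ≤ 1) (b : Bool) {x : ℝ} (hx2 : 2 ≤ x) (hx4 : x ≤ 4)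
    (θ : ℝ) :
    (surface hε hε1).edist (cylPoint hε hε1 (sgn b * 2) θ (by rw [abs_sgn_mul]; norm_num))
      (cylPoint hε hε1 (sgn b * x) θ
        (by rw [abs_sgn_mul, abs_of_nonneg (by linarith)]; exact hx4)) ≤ ENNReal.ofReal 4 := by
  set c : ℝ → Space := fun t => !₂[sgn b * (2 + 2 * Real.sin t), 2 * Real.cos t * Real.cos θ,
    2 * Real.cos t * Real.sin θ] with hc
  have hd : ∀ t, HasDerivAt c !₂[sgn b * (2 * Real.cos t), 2 * -Real.sin t * Real.cos θ,
      2 * -Real.sin t * Real.sin θ] t := by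
    intro t
    refine hasDerivAt_space fun i => ?_
    fin_cases i
    · exact (((Real.hasDerivAt_sin t).const_mul 2).const_add 2).const_mul (sgn b)
    · exact ((Real.hasDerivAt_cos t).const_mul 2).mul_const _
    · exact ((Real.hasDerivAt_cos t).const_mul 2).mul_const _
  have hcp : ∀ t, 0 ≤ Real.sin t → 0 ≤ Real.cos t →
      c t = ofCyl ε true !₂[sgn b * (2 + 2 * Real.sin t), θ] := by
    intro t h1 h2
    have h3 : √(radiusSq ε (sgn b * (2 + 2 * Real.sin t))) = 2 * Real.cos t := by
      have h4 : |sgn b * (2 + 2 * Real.sin t)| = 2 + 2 * Real.sin t := by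
        rw [abs_sgn_mul, abs_of_nonneg (by linarith)]
      rw [radiusSq_of_two_le_abs (by linarith), h4]
      have : (2 + 2 * Real.sin t) * (4 - (2 + 2 * Real.sin t)) = (2 * Real.cos t) ^ 2 := by
        linear_combination (-4) * Real.sin_sq_add_cos_sq t
      rw [this, Real.sqrt_sq (by linarith)]
    rw [ofCyl_true, h3]
  have hs : Real.sin (Real.arcsin ((x - 2) / 2)) = (x - 2) / 2 :=
    Real.sin_arcsin (by linarith) (by linarith)
  have h0 : 0 ≤ Real.arcsin ((x - 2) / 2) := Real.arcsin_nonneg.mpr (by linarith)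
  have hpi : Real.arcsin ((x - 2) / 2) ≤ Real.pi / 2 := Real.arcsin_le_pi_div_two _
  have hsin : ∀ t ∈ Icc 0 (Real.arcsin ((x - 2) / 2)), 0 ≤ Real.sin t := fun t ht =>
    Real.sin_nonneg_of_nonneg_of_le_pi ht.1 (by linarith [ht.2, Real.pi_pos])
  have hcos : ∀ t ∈ Icc 0 (Real.arcsin ((x - 2) / 2)), 0 ≤ Real.cos t := fun t ht =>
    Real.cos_nonneg_of_neg_pi_div_two_le_of_le (by linarith [ht.1, Real.pi_pos])
      (by linarith [ht.2])
  refine ((surface hε hε1).edist_le_of_curve (c := c) (B := 2) h0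
    (fun t ht => ?_) (fun t ht => ?_) (fun t ht => ?_) ?_ ?_).trans ?_
  · refine contDiffAt_euclidean.mpr fun i => ?_
    fin_cases i
    · exact contDiffAt_const.mul (contDiffAt_const.add
        (contDiffAt_const.mul Real.contDiff_sin.contDiffAt))
    · exact (contDiffAt_const.mul Real.contDiff_cos.contDiffAt).mul contDiffAt_const
    · exact (contDiffAt_const.mul Real.contDiff_cos.contDiffAt).mul contDiffAt_const
  · rw [hcp t (hsin t ht) (hcos t ht)]
    refine ofCyl_mem hε true ?_
    change |sgn b * (2 + 2 * Real.sin t)| ≤ 4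
    rw [abs_sgn_mul, abs_of_nonneg (by linarith [hsin t ht])]
    linarith [Real.sin_le_one t]
  · rw [(hd t).deriv, EuclideanSpace.norm_eq, Fin.sum_univ_three]
    refine Real.sqrt_le_iff.mpr ⟨by norm_num, ?_⟩
    simp only [Real.norm_eq_abs, sq_abs]
    change (sgn b * (2 * Real.cos t)) ^ 2 + (2 * -Real.sin t * Real.cos θ) ^ 2 +
      (2 * -Real.sin t * Real.sin θ) ^ 2 ≤ _
    refine le_of_eq ?_
    linear_combination (4 * Real.cos t ^ 2) * sgn_sq b + 4 * Real.sin_sq_add_cos_sq t +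
      4 * Real.sin t ^ 2 * Real.sin_sq_add_cos_sq θ
  · change ofCyl ε true _ = _
    rw [hcp 0 (hsin 0 ⟨le_rfl, h0⟩) (hcos 0 ⟨le_rfl, h0⟩)]
    simp
  · change ofCyl ε true _ = _
    rw [hcp _ (hsin _ ⟨h0, le_rfl⟩) (hcos _ ⟨h0, le_rfl⟩), hs]
    congr 4
    ring
  · refine ENNReal.ofReal_le_ofReal ?_
    linarith [Real.pi_le_four]

lemma exists_diam_bound : ∃ D, 0 < D ∧ ∀ ε (hε : 0 < ε) (hε1 : ε ≤ 1),
    (surface hε hε1).toSurface.diam ≤ ENNReal.ofReal D := by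
  obtain ⟨C, hC0, hC⟩ := exists_bound_radiusSq
  -- Every point reaches the circle `x = 2` by a cap arc, if needed, followed by a meridian, within
  -- `E`. Two points of that circle are at distance at most `2 · 2π ≤ 16`.
  set E := 4 + (1 + C) * 4
  have hE : 0 < E := by positivity
  refine ⟨E + 16 + E, by positivity, fun ε hε hε1 => EmbeddedSurface.diam_le _ fun p q => ?_⟩
  have hCε := fun x hx => (hC ε hε hε1 x hx).1
  have key : ∀ p : (surface hε hε1).Point, (surface hε hε1).edist p
      (cylPoint hε hε1 2 (transverse true (EmbeddedSurface.incl p)).arg (by norm_num)) ≤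
        ENNReal.ofReal E := by
    intro p
    set θ := (transverse true (EmbeddedSurface.incl p)).arg with hθ
    have hp4 : |EmbeddedSurface.incl p 0| ≤ 4 := p.2.1
    obtain ⟨x, hx⟩ : ∃ x, x = EmbeddedSurface.incl p 0 := ⟨_, rfl⟩
    rw [← hx] at hp4
    have hp : p = cylPoint hε hε1 x θ hp4 := by
      refine EmbeddedSurface.injective_incl _ ?_
      have h : ofCyl ε true !₂[EmbeddedSurface.incl p 0, θ] = EmbeddedSurface.incl p :=
        ofCyl_toCyl true p.2
      rw [← hx] at h
      exact h.symm
    -- The angle was defined from the point, which is now to be replaced by its coordinates.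
    clear_value θ
    subst hp
    rcases le_total |x| 2 with h | h
    · refine (edist_meridian_le hε hε1 hC0 hCε h θ).trans (ENNReal.ofReal_le_ofReal ?_)
      linarith
    · obtain ⟨b, z, hz2, hz4, rfl⟩ : ∃ (b : Bool) (z : ℝ), 2 ≤ z ∧ z ≤ 4 ∧ x = sgn b * z := by
        rcases abs_choice x with h1 | h1
        · exact ⟨true, x, h1 ▸ h, h1 ▸ hp4, by simp [sgn]⟩
        · exact ⟨false, -x, h1 ▸ h, h1 ▸ hp4, by simp [sgn]⟩
      refine (EmbeddedSurface.edist_triangle _ _ (cylPoint hε hε1 (sgn b * 2) θ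
        (by rw [abs_sgn_mul]; norm_num)) _).trans ?_
      rw [ENNReal.ofReal_add (by norm_num) (by positivity)]
      refine add_le_add ?_ ?_
      · rw [EmbeddedSurface.edist_comm]
        exact edist_cap_le hε hε1 b hz2 hz4 θ
      · exact edist_meridian_le hε hε1 hC0 hCε (by rw [abs_sgn_mul]; norm_num) θ
  have hpar : ∀ z w : ℂ, (surface hε hε1).edist (cylPoint hε hε1 2 z.arg (by norm_num))
      (cylPoint hε hε1 2 w.arg (by norm_num)) ≤ ENNReal.ofReal 16 := by
    have h1 : ∀ z w : ℂ, 2 * (w.arg - z.arg) ≤ 16 := fun z w => by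
      linarith [Complex.arg_le_pi w, Complex.neg_pi_lt_arg z, Real.pi_le_four]
    intro z w
    rcases le_total z.arg w.arg with h | h
    · exact (edist_parallel_le hε hε1 h).trans (ENNReal.ofReal_le_ofReal (h1 z w))
    · rw [EmbeddedSurface.edist_comm]
      exact (edist_parallel_le hε hε1 h).trans (ENNReal.ofReal_le_ofReal (h1 w z))
  rw [ENNReal.ofReal_add (by positivity) hE.le, ENNReal.ofReal_add hE.le (by norm_num)]
  have kq := key q
  rw [EmbeddedSurface.edist_comm] at kq
  exact (EmbeddedSurface.edist_triangle _ _ _ _).trans (add_le_add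
    ((EmbeddedSurface.edist_triangle _ _ _ _).trans (add_le_add (key p) (hpar _ _))) kq)

end Dumbbell

/-! ### Ricci curvature in cylindrical coordinates -/

namespace CoordMetric

/-- The Christoffel symbols of a diagonal metric that depends on the first coordinate only. -/
lemma christoffel_diagonal {A B : ℝ → ℝ} {A' B' : ℝ} {y : Plane} (hA0 : A (y 0) ≠ 0)
    (hB0 : B (y 0) ≠ 0) (hA : HasDerivAt A A' (y 0)) (hB : HasDerivAt B B' (y 0))
    (k i j : Fin 2) :
    christoffel (fun z => !![A (z 0), 0; 0, B (z 0)]) k i j y =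
      ![!![A' / (2 * A (y 0)), 0; 0, -(B' / (2 * A (y 0)))],
        !![0, B' / (2 * B (y 0)); B' / (2 * B (y 0)), 0]] k i j := by
  have hinv : (!![A (y 0), 0; 0, B (y 0)] : Matrix (Fin 2) (Fin 2) ℝ)⁻¹ =
      !![(A (y 0))⁻¹, 0; 0, (B (y 0))⁻¹] := by
    refine Matrix.inv_eq_right_inv ?_
    ext a b
    fin_cases a <;> fin_cases b <;> simp [Matrix.mul_apply, hA0, hB0]
  obtain ⟨a0, a1⟩ := pd_comp_coord_zero hA
  obtain ⟨b0, b1⟩ := pd_comp_coord_zero hB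
  have c : ∀ a : Fin 2, pd a (fun _ : Plane => (0 : ℝ)) y = 0 := fun a => by simp [pd]
  unfold christoffel
  rw [hinv]
  fin_cases k <;> fin_cases i <;> fin_cases j <;>
    simp [a0, a1, b0, b1, c] <;> field_simp

/-- The Ricci tensor of a diagonal metric that depends on the first coordinate only. -/
lemma ricci_diagonal {A B A' B' P P' Q Q' R R' : ℝ → ℝ} {y : Plane}
    (hA0 : ∀ᶠ x in 𝓝 (y 0), A x ≠ 0) (hB0 : ∀ᶠ x in 𝓝 (y 0), B x ≠ 0)
    (hA : ∀ᶠ x in 𝓝 (y 0), HasDerivAt A (A' x) x) (hB : ∀ᶠ x in 𝓝 (y 0), HasDerivAt B (B' x) x)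
    (hP : ∀ᶠ x in 𝓝 (y 0), A' x / (2 * A x) = P x) (hQ : ∀ᶠ x in 𝓝 (y 0), B' x / (2 * A x) = Q x)
    (hR : ∀ᶠ x in 𝓝 (y 0), B' x / (2 * B x) = R x)
    (hP' : HasDerivAt P (P' (y 0)) (y 0)) (hQ' : HasDerivAt Q (Q' (y 0)) (y 0))
    (hR' : HasDerivAt R (R' (y 0)) (y 0)) :
    ricci (fun z => !![A (z 0), 0; 0, B (z 0)]) y =
      !![-R' (y 0) + P (y 0) * R (y 0) - R (y 0) ^ 2, 0;
        0, -Q' (y 0) - Q (y 0) * P (y 0) + Q (y 0) * R (y 0)] := by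
  have hc : Filter.Tendsto (fun z : Plane => z 0) (𝓝 y) (𝓝 (y 0)) :=
    (EuclideanSpace.proj 0 : Plane →L[ℝ] ℝ).continuous.continuousAt
  have hΓ : ∀ k i j : Fin 2, christoffel (fun z => !![A (z 0), 0; 0, B (z 0)]) k i j =ᶠ[𝓝 y]
      fun z => ![!![P (z 0), 0; 0, -Q (z 0)], !![0, R (z 0); R (z 0), 0]] k i j := by
    intro k i j
    filter_upwards [hc.eventually hA0, hc.eventually hB0, hc.eventually hA, hc.eventually hB,
      hc.eventually hP, hc.eventually hQ, hc.eventually hR] with z z1 z2 z3 z4 z5 z6 z7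
    rw [christoffel_diagonal z1 z2 z3 z4, z5, z6, z7]
  obtain ⟨p0, p1⟩ := pd_comp_coord_zero hP'
  obtain ⟨q0, -⟩ := pd_comp_coord_zero hQ'.neg
  obtain ⟨r0, r1⟩ := pd_comp_coord_zero hR'
  have q0' : pd 0 (fun z : Plane => -Q (z 0)) y = -Q' (y 0) := q0
  have c : ∀ a : Fin 2, pd a (fun _ : Plane => (0 : ℝ)) y = 0 := fun a => by simp [pd]
  unfold ricci
  simp only [pd_congr _ (hΓ _ _ _), (hΓ _ _ _).eq_of_nhds, Fin.sum_univ_two]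
  ext i j
  fin_cases i <;> fin_cases j <;> simp [p0, p1, q0', r0, r1, c] <;> ring

end CoordMetric

namespace Dumbbell

variable {ε : ℝ}

/-- The Gaussian curvature of the dumbbell. -/
def curvature (ε x : ℝ) : ℝ :=
  (radiusSq' ε x ^ 2 - 2 * radiusSq ε x * radiusSq'' ε x) / (4 * areaDensity ε x ^ 4)

/-- The general fact that in dimension two the Ricci tensor is the Gaussian curvature times the
metric, checked from the Christoffel symbols. -/
lemma ricci_cylChart (hε : 0 < ε) (b : Bool) {y : Plane} (hy : |y 0| < 4) :
    CoordMetric.ricci (cylChart hε b).gram y = curvature ε (y 0) • (cylChart hε b).gram y := by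
  have hnh : ∀ᶠ x : ℝ in 𝓝 (y 0), |x| < 4 :=
    continuous_abs.continuousAt.eventually (Iio_mem_nhds hy)
  have hc : Filter.Tendsto (fun z : Plane => z 0) (𝓝 y) (𝓝 (y 0)) :=
    (EuclideanSpace.proj 0 : Plane →L[ℝ] ℝ).continuous.continuousAt
  have hG : (cylChart hε b).gram =ᶠ[𝓝 y] fun z => !![cylA ε (z 0), 0; 0, radiusSq ε (z 0)] := by
    filter_upwards [hc.eventually hnh] with z hz using gram_cylChart hε b hz
  rw [CoordMetric.ricci_congr hG, hG.eq_of_nhds]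
  -- the derivative of the squared area density
  set W : ℝ → ℝ := fun x => radiusSq ε x + radiusSq' ε x ^ 2 / 4 with hW
  set W' : ℝ → ℝ := fun x => radiusSq' ε x + radiusSq' ε x * radiusSq'' ε x / 2 with hW'
  have hWpos : ∀ x, 0 < W x := radicand_pos hε
  have hWd : ∀ x, HasDerivAt W (W' x) x := by
    intro x
    convert! (hasDerivAt_radiusSq ε x).add (((hasDerivAt_radiusSq' ε x).pow 2).div_const 4) using 1
    simp [hW']
    ring
  have hA : ∀ x, cylA ε x = W x / radiusSq ε x := fun x => by rw [cylA, areaDensity_sq hε]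
  set A' : ℝ → ℝ := fun x => (W' x * radiusSq ε x - W x * radiusSq' ε x) / radiusSq ε x ^ 2
  have hAd : ∀ x, |x| < 4 → HasDerivAt (cylA ε) (A' x) x := by
    intro x hx
    rw [show cylA ε = fun x => W x / radiusSq ε x from funext hA]
    exact (hWd x).div (hasDerivAt_radiusSq ε x) (radiusSq_pos hε hx).ne'
  -- `P` and `R` are half the logarithmic derivatives of the two metric coefficients `W/h` and `h`;
  -- `Q` is, up to sign, the remaining Christoffel symbol.
  set P : ℝ → ℝ := fun x => (1 / 2) * (W' x / W x - radiusSq' ε x / radiusSq ε x)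
  set Q : ℝ → ℝ := fun x => radiusSq' ε x * radiusSq ε x / (2 * W x)
  set R : ℝ → ℝ := fun x => radiusSq' ε x / (2 * radiusSq ε x)
  have hW'd : DifferentiableAt ℝ W' (y 0) := by
    have h1 := (contDiff_radiusSq' (ε := ε)).differentiable (by simp)
    have h2 := (contDiff_radiusSq'' (ε := ε)).differentiable (by simp)
    exact (h1.add ((h1.mul h2).div_const 2)) (y 0)
  have h0 := radiusSq_pos hε hy
  have hw0 := hWpos (y 0)
  have d0 := hasDerivAt_radiusSq ε (y 0)
  have d1 := hasDerivAt_radiusSq' ε (y 0)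
  have hP' : DifferentiableAt ℝ P (y 0) :=
    ((hW'd.div (hWd _).differentiableAt hw0.ne').sub
      (d1.differentiableAt.div d0.differentiableAt h0.ne')).const_mul _
  have hQ' := (d1.mul d0).div ((hWd (y 0)).const_mul 2) (by positivity)
  have hR' := d1.div (d0.const_mul 2) (by positivity)
  have key := CoordMetric.ricci_diagonal (A := cylA ε) (B := radiusSq ε) (A' := A')
    (B' := radiusSq' ε) (P := P) (P' := deriv P) (Q := Q) (Q' := fun _ => _) (R := R)
    (R' := fun _ => _) (y := y)
    (hnh.mono fun x hx => by rw [hA]; exact (div_pos (hWpos x) (radiusSq_pos hε hx)).ne')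
    (hnh.mono fun x hx => (radiusSq_pos hε hx).ne') (hnh.mono hAd)
    (.of_forall fun x => hasDerivAt_radiusSq ε x)
    (hnh.mono fun x hx => by
      have h1 := radiusSq_pos hε hx
      have h2 := hWpos x
      simp only [hA, A', P]
      field_simp)
    (hnh.mono fun x hx => by
      have h1 := radiusSq_pos hε hx
      have h2 := hWpos x
      simp only [hA, Q]
      field_simp)
    (.of_forall fun x => rfl) hP'.hasDerivAt hQ' hR'
  rw [key]
  have hκ : curvature ε (y 0) = (radiusSq' ε (y 0) ^ 2 -
      2 * radiusSq ε (y 0) * radiusSq'' ε (y 0)) / (4 * W (y 0) ^ 2) := by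
    have h4 : areaDensity ε (y 0) ^ 2 = W (y 0) := areaDensity_sq hε _
    rw [curvature, ← h4]
    ring
  have hWe : W (y 0) = radiusSq ε (y 0) + radiusSq' ε (y 0) ^ 2 / 4 := rfl
  have hWe' : W' (y 0) = radiusSq' ε (y 0) + radiusSq' ε (y 0) * radiusSq'' ε (y 0) / 2 := rfl
  -- Eliminating `h'²` in favour of `W` and `h` leaves polynomial identities.
  have e1 : radiusSq' ε (y 0) ^ 2 = 4 * (W (y 0) - radiusSq ε (y 0)) := by rw [hWe]; ring
  rw [hκ, hA]
  simp only [P, Q, R, hWe', Pi.mul_apply]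
  generalize W (y 0) = w at *
  generalize radiusSq ε (y 0) = h at *
  generalize radiusSq' ε (y 0) = h' at *
  generalize radiusSq'' ε (y 0) = h'' at *
  have hh := h0.ne'
  have hw := hw0.ne'
  ext i j
  fin_cases i <;> fin_cases j <;> simp
  · field_simp
    ring_nf
    simp only [e1]
    ring
  · field_simp
    ring_nf
    simp only [e1]
    ring

end Dumbbell

/-! ### The integral bound on the curvature -/

namespace Dumbbell

open EmbeddedSurface

variable {ε : ℝ}

lemma index_of_ne {p : Space} (h : ¬(p 1 = 0 ∧ p 2 = 0)) : (chartIndex p).1 = true := by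
  simp [chartIndex, h]

lemma surface_chart (hε : 0 < ε) (hε1 : ε ≤ 1) (j : Bool × Bool) :
    (surface hε hε1).chart j = if j.1 then cylChart hε j.2 else poleChart ε j.2 := rfl

lemma surface_chart_idx (hε : 0 < ε) (hε1 : ε ≤ 1) {p : (surface hε hε1).Point}
    (hp : ¬(incl p 1 = 0 ∧ incl p 2 = 0)) :
    ∃ b, (surface hε hε1).chart ((surface hε hε1).idx p) = cylChart hε b := by
  refine ⟨(chartIndex (incl p)).2, ?_⟩
  exact (surface_chart hε hε1 _).trans (if_pos (index_of_ne hp))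

lemma coord_zero (hε : 0 < ε) (hε1 : ε ≤ 1) {p : (surface hε hε1).Point} {b : Bool}
    (hb : (surface hε hε1).chart ((surface hε hε1).idx p) = cylChart hε b) :
    (surface hε hε1).coord p 0 = incl p 0 := by
  rw [coord, hb]
  rfl

/-- Away from the poles, the Ricci tensor is the Gaussian curvature times the metric. -/
lemma ricciMin_surface (hε : 0 < ε) (hε1 : ε ≤ 1) {p : (surface hε hε1).Point}
    (hp : ¬(incl p 1 = 0 ∧ incl p 2 = 0)) :
    (surface hε hε1).toSurface.ricciMin p = curvature ε (incl p 0) := by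
  obtain ⟨b, hb⟩ := surface_chart_idx hε hε1 hp
  have h0 := coord_zero hε hε1 hb
  have h4 : |(surface hε hε1).coord p 0| < 4 := by
    rw [h0]
    exact abs_lt_four p.2 hp
  have hR := (surface hε hε1).toSurface_ricciMin p
  rw [hb] at hR
  refine hR.trans ?_
  obtain ⟨y, hy⟩ : ∃ y, y = (surface hε hε1).coord p := ⟨_, rfl⟩
  rw [← hy] at h0 h4 ⊢
  change sInf {μ : ℝ | ∃ v : Fin 2 → ℝ, v ≠ 0 ∧ CoordMetric.ricci (cylChart hε b).gram y *ᵥ v =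
    μ • ((cylChart hε b).gram y *ᵥ v)} = _
  rw [ricci_cylChart hε b h4, h0]
  set G := (cylChart hε b).gram y
  have hG : ∀ v : Fin 2 → ℝ, v ≠ 0 → G *ᵥ v ≠ 0 := by
    intro v hv h
    have h1 : G = !![cylA ε (incl p 0), 0; 0, radiusSq ε (incl p 0)] := by
      rw [← h0]
      exact gram_cylChart hε b h4
    have hr : 0 < radiusSq ε (incl p 0) := radiusSq_pos hε (h0 ▸ h4)
    have hA : 0 < cylA ε (incl p 0) := div_pos (pow_pos (areaDensity_pos hε _) 2) hr
    rw [h1] at h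
    have e0 := congrFun h 0
    have e1 := congrFun h 1
    simp [Matrix.mulVec, dotProduct, hr.ne', hA.ne'] at e0 e1
    refine hv (funext fun i => ?_)
    fin_cases i
    · exact e0
    · exact e1
  -- As the Ricci tensor is a multiple of an invertible metric, every nonzero vector is an
  -- eigenvector, with the same eigenvalue.
  have hset : {μ : ℝ | ∃ v : Fin 2 → ℝ, v ≠ 0 ∧
      (curvature ε (incl p 0) • G) *ᵥ v = μ • (G *ᵥ v)} = {curvature ε (incl p 0)} := by
    ext μ
    simp only [mem_ofPred_eq, mem_singleton_iff, Matrix.smul_mulVec]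
    constructor
    · rintro ⟨v, hv, h⟩
      exact (smul_left_injective ℝ (hG v hv) h).symm
    · rintro rfl
      exact ⟨fun _ => 1, fun h => one_ne_zero (congrFun h 0), rfl⟩
  rw [hset, csInf_singleton]

lemma curvature_of_two_lt (hε : 0 < ε) {x : ℝ} (hx : 2 < |x|) : curvature ε x = 1 / 4 := by
  have h1 := areaDensity_sq hε x
  rw [areaDensity_of_two_le hx.le] at h1
  rw [curvature, areaDensity_of_two_le hx.le, radiusSq''_of_two_lt hx]
  linarith

/-- The quantity bounded is the square of `Z^(3/2) w`, with `Z` the negative part of the curvature.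
Only the term with `h h''` can make the curvature negative, so `Z ≤ h |h''| / (2 w⁴)`; then `|h''|³
≤ C h²` leaves `(h/w²)⁵`, which is at most `1`. This balance of powers singles out the exponent
`3/2`. -/
lemma exists_bound_curvature : ∃ C, 0 ≤ C ∧ ∀ ε, 0 < ε → ε ≤ 1 → ∀ x,
    max (-curvature ε x) 0 ^ 3 * areaDensity ε x ^ 2 ≤ C ∧ areaDensity ε x ^ 2 ≤ C := by
  obtain ⟨C, hC0, hC⟩ := exists_bound_radiusSq
  -- The area density decides the constant: `w² = h + h'²/4`, where `h ≤ 4` and `h'² ≤ C h`.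
  refine ⟨4 + C, by positivity, fun ε hε hε1 x => ?_⟩
  rcases lt_or_ge 2 |x| with hx | hx
  · rw [curvature_of_two_lt hε hx, areaDensity_of_two_le hx.le]
    rw [max_eq_right (by norm_num)]
    constructor <;> linarith
  · obtain ⟨h1, h2⟩ := hC ε hε hε1 x hx
    have hw := areaDensity_sq hε x
    have hw0 := areaDensity_pos hε x
    have hh := radiusSq_pos hε (show |x| < 4 by linarith)
    have hle := radiusSq_le hε hε1 (x := x)
    set w := areaDensity ε x
    set h := radiusSq ε x
    have hwh : h ≤ w ^ 2 := by rw [hw]; linarith [sq_nonneg (radiusSq' ε x)]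
    refine ⟨?_, by rw [hw]; nlinarith⟩
    have hZ : max (-curvature ε x) 0 ≤ h * |radiusSq'' ε x| / (2 * w ^ 4) := by
      refine max_le ?_ (by positivity)
      rw [curvature, ← neg_div, div_le_div_iff₀ (by positivity) (by positivity)]
      have h3 : 2 * h * radiusSq'' ε x ≤ 2 * h * |radiusSq'' ε x| :=
        mul_le_mul_of_nonneg_left (le_abs_self _) (by positivity)
      have h4 : 0 ≤ 2 * w ^ 4 := by positivity
      nlinarith [mul_le_mul_of_nonneg_left h3 h4, mul_nonneg h4 (sq_nonneg (radiusSq' ε x))]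
    calc max (-curvature ε x) 0 ^ 3 * w ^ 2
        ≤ (h * |radiusSq'' ε x| / (2 * w ^ 4)) ^ 3 * w ^ 2 := by gcongr
      _ = h ^ 3 * |radiusSq'' ε x| ^ 3 / (8 * (w ^ 2) ^ 5) := by field_simp; ring
      _ ≤ h ^ 3 * (C * h ^ 2) / (8 * (w ^ 2) ^ 5) := by gcongr
      _ = C / 8 * (h ^ 5 / (w ^ 2) ^ 5) := by field_simp
      _ ≤ C / 8 * 1 := by
        gcongr
        exact div_le_one_of_le₀ (by gcongr) (by positivity)
      _ ≤ 4 + C := by linarith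

/-- Since `ρ_K ≤ K + Z`, the bounds on `Z³ w²` and `w²` suffice after squaring, which also removes
the fractional power. -/
lemma exists_bound_rho {K : ℝ} (hK : 0 ≤ K) : ∃ E : ℝ, ∀ ε (hε : 0 < ε) (hε1 : ε ≤ 1)
    (p : (surface hε hε1).Point), ¬(incl p 1 = 0 ∧ incl p 2 = 0) →
    ENNReal.ofReal (areaDensity ε (incl p 0)) *
      ENNReal.ofReal ((surface hε hε1).toSurface.rho K p) ^ (3 / 2 : ℝ) ≤ ENNReal.ofReal E := by
  obtain ⟨C, hC0, hC⟩ := exists_bound_curvature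
  refine ⟨√(4 * (K ^ 3 * C + C)), fun ε hε hε1 p hp => ?_⟩
  obtain ⟨h1, h2⟩ := hC ε hε hε1 (incl p 0)
  have hw0 := areaDensity_pos hε (incl p 0)
  set w := areaDensity ε (incl p 0)
  set Z := max (-curvature ε (incl p 0)) 0
  have hZ0 : 0 ≤ Z := le_max_right _ _
  have hρ0 : 0 ≤ (surface hε hε1).toSurface.rho K p := le_max_right _ _
  have hρ : (surface hε hε1).toSurface.rho K p ≤ K + Z := by
    refine max_le ?_ (by positivity)
    rw [ricciMin_surface hε hε1 hp]
    linarith [le_max_left (-curvature ε (incl p 0)) 0]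
  set ρ := (surface hε hε1).toSurface.rho K p
  rw [ENNReal.ofReal_rpow_of_nonneg hρ0 (by norm_num), ← ENNReal.ofReal_mul hw0.le]
  refine ENNReal.ofReal_le_ofReal (Real.le_sqrt_of_sq_le ?_)
  have h3 : (ρ ^ (3 / 2 : ℝ)) ^ 2 = ρ ^ 3 := by
    rw [← Real.rpow_natCast, ← Real.rpow_mul hρ0, ← Real.rpow_natCast]
    norm_num
  have h4 : (K + Z) ^ 3 ≤ 4 * (K ^ 3 + Z ^ 3) := by
    nlinarith [mul_nonneg (add_nonneg hK hZ0) (sq_nonneg (K - Z))]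
  calc (w * ρ ^ (3 / 2 : ℝ)) ^ 2 = ρ ^ 3 * w ^ 2 := by rw [mul_pow, h3, mul_comm]
    _ ≤ (K + Z) ^ 3 * w ^ 2 := by gcongr
    _ ≤ 4 * (K ^ 3 + Z ^ 3) * w ^ 2 := by gcongr
    _ = 4 * (K ^ 3 * w ^ 2 + Z ^ 3 * w ^ 2) := by ring
    _ ≤ 4 * (K ^ 3 * C + C) := by gcongr

/-- Coordinate domains of bounded size turn the pointwise bound on the integrand into a bound on the
integral. -/
lemma target_subset (hε : 0 < ε) (hε1 : ε ≤ 1) (j : Bool × Bool) :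
    ((surface hε hε1).chart j).target ⊆ Metric.closedBall 0 10 := by
  have key : ∀ y : Plane, |y 0| ≤ 4 → |y 1| ≤ 4 → y ∈ Metric.closedBall (0 : Plane) 10 := by
    intro y h0 h1
    rw [mem_closedBall_zero_iff, EuclideanSpace.norm_eq, Fin.sum_univ_two]
    refine Real.sqrt_le_iff.mpr ⟨by norm_num, ?_⟩
    simp only [Real.norm_eq_abs]
    nlinarith [abs_nonneg (y 0), abs_nonneg (y 1)]
  rw [surface_chart]
  split_ifs
  · rintro y ⟨h0, h1⟩
    exact key y h0.le (abs_le.mpr ⟨by linarith [h1.1, Real.pi_le_four],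
      by linarith [h1.2, Real.pi_le_four]⟩)
  · intro y hy
    have hy' : y 0 ^ 2 + y 1 ^ 2 < 1 := hy
    exact key y (abs_le_of_sq_le_sq (by nlinarith [sq_nonneg (y 1)]) (by norm_num))
      (abs_le_of_sq_le_sq (by nlinarith [sq_nonneg (y 0)]) (by norm_num))

/-- Off the coordinate origin, the coordinate area density is at most that of cylindrical
coordinates. -/
lemma sqrt_det_gram_le (hε : 0 < ε) (hε1 : ε ≤ 1) (j : Bool × Bool) {y : Plane}
    (hy : y ∈ ((surface hε hε1).chart j).target) (hy0 : y ≠ 0) :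
    ¬(incl (((surface hε hε1).pointChart j).symm y) 1 = 0 ∧
      incl (((surface hε hε1).pointChart j).symm y) 2 = 0) ∧
    √(((surface hε hε1).chart j).gram y).det ≤
      areaDensity ε (incl (((surface hε hε1).pointChart j).symm y) 0) := by
  have hm := ((surface hε hε1).chart j).ofPlane_mem y hy
  rw [(surface hε hε1).incl_pointChart_symm hy]
  rw [surface_chart] at hy hm ⊢
  split_ifs at hy hm ⊢ with h
  · refine ⟨fun h0 => ?_, (det_gram_cylChart hε j.2 hy.1).le⟩
    have h4 := abs_eq_four hε hm h0.1 h0.2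
    have h5 : |y 0| < 4 := hy.1
    exact h5.ne h4
  · have hy' : y 0 ^ 2 + y 1 ^ 2 < 1 := hy
    refine ⟨fun h0 => hy0 ?_, ?_⟩
    · ext i
      fin_cases i
      · exact h0.1
      · exact h0.2
    · have h2 := (ofPole_mem (ε := ε) j.2 hy').1
      have h3 : 2 ≤ |ofPole j.2 y 0| := by
        rw [← abs_sgn_mul j.2]
        exact h2.le.trans (le_abs_self _)
      have h4 : areaDensity ε ((poleChart ε j.2).ofPlane y 0) = 2 := areaDensity_of_two_le h3
      refine (det_gram_poleChart j.2 hy').trans_le ?_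
      refine (?_ : _ ≤ (2 : ℝ)).trans_eq h4.symm
      refine div_le_self (by norm_num) (Real.one_le_sqrt.mpr (by linarith))

/-- The pole on the right. -/
def pole (hε : 0 < ε) (hε1 : ε ≤ 1) : (surface hε hε1).Point :=
  ⟨ofPole true 0, (ofPole_mem true (by norm_num)).2⟩

/-- The area density `2 / √(4 - |y|²)` of the polar chart is at least `1`, so one cap bounds the
area below, independently of `ε`. -/
lemma le_area_surface (hε : 0 < ε) (hε1 : ε ≤ 1) :
    volume {y : Plane | y 0 ^ 2 + y 1 ^ 2 < 1} ≤ (surface hε hε1).toSurface.area univ := by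
  have hc : (surface hε hε1).chart ((surface hε hε1).idx (pole hε hε1)) = poleChart ε
      (chartIndex (incl (pole hε hε1))).2 := by
    refine (surface_chart hε hε1 _).trans (if_neg ?_)
    have h1 : incl (pole hε hε1) 1 = 0 := rfl
    have h2 : incl (pole hε hε1) 2 = 0 := rfl
    change ¬(chartIndex (incl (pole hε hε1))).1 = true
    simp [chartIndex, h1, h2]
  refine le_trans ?_ ((surface hε hε1).le_area (pole hε hε1))
  rw [hc]
  have ht := (poleChart ε (chartIndex (incl (pole hε hε1))).2).isOpen_target.measurableSet
  change volume (poleChart ε (chartIndex (incl (pole hε hε1))).2).target ≤ _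
  rw [← setLIntegral_one]
  refine setLIntegral_mono' ht fun y hy => ?_
  have hy' : y 0 ^ 2 + y 1 ^ 2 < 1 := hy
  rw [← ENNReal.ofReal_one]
  refine ENNReal.ofReal_le_ofReal (le_of_le_of_eq ?_ (det_gram_poleChart _ hy').symm)
  have h0 : 0 < √(4 - (y 0 ^ 2 + y 1 ^ 2)) := Real.sqrt_pos.mpr (by linarith)
  rw [le_div_iff₀ h0, one_mul]
  exact Real.sqrt_le_iff.mpr ⟨by norm_num, by nlinarith [sq_nonneg (y 0), sq_nonneg (y 1)]⟩

lemma exists_kbar_bound {K : ℝ} (hK : 0 ≤ K) : ∃ C, 0 < C ∧ ∀ ε (hε : 0 < ε) (hε1 : ε ≤ 1),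
    (surface hε hε1).toSurface.kbar (3 / 2) K ≤ ENNReal.ofReal C := by
  obtain ⟨E, hE⟩ := exists_bound_rho hK
  set V : ℝ≥0∞ := volume (Metric.closedBall (0 : Plane) 10)
  set V₀ : ℝ≥0∞ := volume {y : Plane | y 0 ^ 2 + y 1 ^ 2 < 1}
  have hV : V ≠ ⊤ := measure_closedBall_lt_top.ne
  have hV₀ : V₀ ≠ 0 := by
    have h1 : IsOpen {y : Plane | y 0 ^ 2 + y 1 ^ 2 < 1} := (poleChart 1 true).isOpen_target
    exact (h1.measure_pos volume ⟨0, by simp⟩).ne'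
  -- The factor `4` is the number of charts.
  set B : ℝ≥0∞ := (V₀⁻¹ * (4 * (ENNReal.ofReal E * V))) ^ (1 / (3 / 2) : ℝ)
  have hB : B ≠ ⊤ := by
    refine ENNReal.rpow_ne_top_of_nonneg (by norm_num) ?_
    exact ENNReal.mul_ne_top (ENNReal.inv_ne_top.mpr hV₀) (ENNReal.mul_ne_top (by norm_num)
      (ENNReal.mul_ne_top ENNReal.ofReal_ne_top hV))
  refine ⟨B.toReal + 1, by positivity, fun ε hε hε1 => ?_⟩
  have hint : ∫⁻ p, ENNReal.ofReal ((surface hε hε1).toSurface.rho K p) ^ (3 / 2 : ℝ)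
      ∂(surface hε hε1).toSurface.area ≤ 4 * (ENNReal.ofReal E * V) := by
    let _ : Fintype (surface hε hε1).Index := inferInstanceAs (Fintype (Bool × Bool))
    refine ((surface hε hε1).lintegral_area_le
      fun p => ENNReal.ofReal ((surface hε hε1).toSurface.rho K p) ^ (3 / 2 : ℝ)).trans ?_
    have hj : ∀ j, ∫⁻ y in ((surface hε hε1).chart j).target,
        ENNReal.ofReal √(((surface hε hε1).chart j).gram y).det *
          ENNReal.ofReal ((surface hε hε1).toSurface.rho K
            (((surface hε hε1).pointChart j).symm y)) ^ (3 / 2 : ℝ) ≤ ENNReal.ofReal E * V := by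
      intro j
      refine (lintegral_mono_ae (g := fun _ => ENNReal.ofReal E) ?_).trans ?_
      -- The poles, where the Ricci tensor has not been computed, are at the origin of the polar
      -- charts; a null set is discarded.
      · filter_upwards [ae_restrict_mem ((surface hε hε1).chart j).isOpen_target.measurableSet,
          ae_restrict_of_ae (compl_mem_ae_iff.mpr (measure_singleton (0 : Plane)))] with y hy hy0
        obtain ⟨h1, h2⟩ := sqrt_det_gram_le hε hε1 j hy hy0
        exact (mul_le_mul_left (ENNReal.ofReal_le_ofReal h2) _).trans (hE ε hε hε1 _ h1)
      · rw [setLIntegral_const]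
        exact mul_le_mul_right (measure_mono (target_subset hε hε1 j)) _
    refine (Finset.sum_le_sum fun j _ => hj j).trans (le_of_eq ?_)
    rw [Finset.sum_const, nsmul_eq_mul]
    congr 1
  refine le_trans (b := B) ?_ ?_
  · refine ENNReal.rpow_le_rpow ?_ (by norm_num)
    exact mul_le_mul' (ENNReal.inv_le_inv.mpr (le_area_surface hε hε1)) hint
  · rw [← ENNReal.ofReal_toReal hB]
    exact ENNReal.ofReal_le_ofReal (by rw [ENNReal.toReal_ofReal ENNReal.toReal_nonneg]; linarith)

end Dumbbell

/-! ### The singular initial value problem `(t u' / r)' = -c w u`, `u(0) = 1` -/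

namespace Singular

/-- The mean value `s⁻¹ ∫_0^s f` (extended to `s = 0`). -/
def avg (f : ℝ → ℝ) (s : ℝ) : ℝ := ∫ σ in (0 : ℝ)..1, f (σ * s)

lemma continuous_avg {f : ℝ → ℝ} (hf : Continuous f) : Continuous (avg f) := by
  refine intervalIntegral.continuous_parametric_intervalIntegral_of_continuous' ?_ 0 1
  exact hf.comp (continuous_snd.mul continuous_fst)

lemma mul_avg (f : ℝ → ℝ) (s : ℝ) : s * avg f s = ∫ t in (0 : ℝ)..s, f t := by
  rw [avg, ← smul_eq_mul, intervalIntegral.smul_integral_comp_mul_right, zero_mul, one_mul]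

lemma avg_nonneg {f : ℝ → ℝ} {s b : ℝ} (hs : s ∈ Icc 0 b) (hf : ∀ t ∈ Icc 0 b, 0 ≤ f t) :
    0 ≤ avg f s := by
  refine intervalIntegral.integral_nonneg zero_le_one fun σ hσ => hf _ ⟨mul_nonneg hσ.1 hs.1, ?_⟩
  nlinarith [hσ.1, hσ.2, hs.1, hs.2]

lemma hasDerivAt_avg {f f' : ℝ → ℝ} (hf : ∀ t, HasDerivAt f (f' t) t) (hf' : Continuous f')
    (s : ℝ) : HasDerivAt (avg f) (∫ σ in (0 : ℝ)..1, f' (σ * s) * σ) s := by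
  have hc : Continuous f := continuous_iff_continuousAt.mpr fun t => (hf t).continuousAt
  obtain ⟨C, hC⟩ := (isCompact_Icc (a := -(|s| + 1)) (b := |s| + 1)).exists_bound_of_continuousOn
    hf'.continuousOn
  refine (intervalIntegral.hasDerivAt_integral_of_dominated_loc_of_deriv_le
    (F := fun s σ => f (σ * s)) (F' := fun s σ => f' (σ * s) * σ) (bound := fun _ => C)
    (Metric.ball_mem_nhds s one_pos) (.of_forall fun t => ?_) ?_ ?_ ?_ ?_ ?_).2
  · exact (hc.comp (continuous_id.mul continuous_const)).aestronglyMeasurable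
  · exact (hc.comp (continuous_id.mul continuous_const)).intervalIntegrable _ _
  · exact ((hf'.comp (continuous_id.mul continuous_const)).mul continuous_id).aestronglyMeasurable
  · refine .of_forall fun σ hσ t ht => ?_
    rw [uIoc_of_le zero_le_one] at hσ
    rw [Metric.mem_ball, Real.dist_eq] at ht
    have h1 : |t| ≤ |s| + 1 := by
      have := abs_sub_abs_le_abs_sub t s
      linarith
    have h2 : |σ * t| ≤ |s| + 1 := by
      rw [abs_mul, abs_of_pos hσ.1]
      nlinarith [abs_nonneg t, hσ.1, hσ.2]
    rw [norm_mul, Real.norm_of_nonneg hσ.1.le]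
    have h3 := hC _ (abs_le.mp h2)
    nlinarith [norm_nonneg (f' (σ * t)), hσ.1, hσ.2]
  · exact intervalIntegrable_const
  · refine .of_forall fun σ _ t _ => ?_
    exact (hf (σ * t)).comp t ((hasDerivAt_id t).const_mul σ |>.congr_deriv (mul_one σ))

/-- The mean value keeps its regularity at `s = 0`, where dividing the primitive by `s` would be
delicate. This gives the regularity of the eigenfunction at the poles. -/
lemma contDiff_avg {f f' : ℝ → ℝ} (hf : ∀ t, HasDerivAt f (f' t) t) (hf' : Continuous f') :
    ContDiff ℝ 1 (avg f) := by
  refine contDiff_one_iff_deriv.mpr ⟨fun s => (hasDerivAt_avg hf hf' s).differentiableAt, ?_⟩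
  rw [funext fun s => (hasDerivAt_avg hf hf' s).deriv]
  refine intervalIntegral.continuous_parametric_intervalIntegral_of_continuous' ?_ 0 1
  exact (hf'.comp (continuous_snd.mul continuous_fst)).mul continuous_snd

/-- The coefficients of the power series in `-c` of the solution. -/
def coeff (r w : ℝ → ℝ) : ℕ → ℝ → ℝ
  | 0 => fun _ => 1
  | n + 1 => fun t => ∫ s in (0 : ℝ)..t, r s * avg (fun x => w x * coeff r w n x) s

/-- The solution. -/
def sol (r w : ℝ → ℝ) (c t : ℝ) : ℝ := ∑' n, (-c) ^ n * coeff r w n t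

variable {r w : ℝ → ℝ} {R W : ℝ}

lemma continuous_coeff (hr : Continuous r) (hw : Continuous w) :
    ∀ n, Continuous (coeff r w n)
  | 0 => continuous_const
  | n + 1 => intervalIntegral.continuous_primitive
      (fun _ _ => (hr.mul (continuous_avg (hw.mul (continuous_coeff hr hw n)))).intervalIntegrable
        _ _) 0

lemma abs_avg_le {f : ℝ → ℝ} {C : ℝ} {n : ℕ}
    (h : ∀ t, |f t| ≤ C * |t| ^ n) (s : ℝ) : |avg f s| ≤ C * |s| ^ n := by
  have hC : 0 ≤ C * |s| ^ n := (abs_nonneg _).trans (h s)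
  have := intervalIntegral.norm_integral_le_of_norm_le_const (a := 0) (b := 1)
    (f := fun σ => f (σ * s)) (C := C * |s| ^ n) fun σ hσ => ?_
  · simpa [avg] using this
  rw [uIoc_of_le zero_le_one] at hσ
  refine (h _).trans ?_
  rw [abs_mul, mul_pow, abs_of_pos hσ.1, mul_left_comm]
  exact mul_le_of_le_one_left hC (pow_le_one₀ hσ.1.le hσ.2)

/-- Averaging preserves a bound by a multiple of `|t|ⁿ`, and the outer integration contributes
`1/(n+1)`. The resulting factorial makes the series converge for all `c` and `t`. -/
lemma abs_coeff_le (hR : ∀ t, |r t| ≤ R)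
    (hW : ∀ t, |w t| ≤ W) (n : ℕ) (t : ℝ) :
    |coeff r w n t| ≤ (R * W) ^ n / n.factorial * |t| ^ n := by
  induction n generalizing t with
  | zero => simp [coeff]
  | succ n ih =>
    have hR0 : 0 ≤ R := (abs_nonneg _).trans (hR 0)
    have hW0 : 0 ≤ W := (abs_nonneg _).trans (hW 0)
    set C := (R * W) ^ n / n.factorial with hC
    have hC0 : 0 ≤ C := by positivity
    have h1 : ∀ s, |avg (fun x => w x * coeff r w n x) s| ≤ W * C * |s| ^ n := by
      refine abs_avg_le fun x => ?_
      rw [abs_mul, mul_assoc]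
      exact mul_le_mul (hW x) (ih x) (abs_nonneg _) hW0
    have h2 : ∀ s, ‖r s * avg (fun x => w x * coeff r w n x) s‖ ≤ R * W * C * |s| ^ n := by
      intro s
      rw [Real.norm_eq_abs, abs_mul, mul_assoc R, mul_assoc R]
      exact mul_le_mul (hR s) (h1 s) (abs_nonneg _) hR0
    have key : R * W * C / (n + 1) * |t| ^ (n + 1) =
        (R * W) ^ (n + 1) / (n + 1).factorial * |t| ^ (n + 1) := by
      rw [hC, Nat.factorial_succ]
      push_cast
      field_simp
      ring
    rw [← key]
    change ‖∫ s in (0 : ℝ)..t, r s * avg (fun x => w x * coeff r w n x) s‖ ≤ _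
    have hint : ∀ a : ℝ, 0 ≤ a → ∫ s in (0 : ℝ)..a, R * W * C * s ^ n =
        R * W * C / (n + 1) * a ^ (n + 1) := by
      intro a _
      rw [intervalIntegral.integral_const_mul, integral_pow]
      simp
      ring
    rcases le_total 0 t with ht | ht
    · refine (intervalIntegral.norm_integral_le_of_norm_le ht (g := fun s => R * W * C * s ^ n)
        (.of_forall fun s hs => ?_) ((by fun_prop : Continuous _).intervalIntegrable _ _)).trans ?_
      · simpa [abs_of_pos hs.1] using h2 s
      · rw [hint t ht, abs_of_nonneg ht]
    -- For negative `t` the integral is reflected to a positive interval.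
    · have hneg : ∫ s in (0 : ℝ)..t, r s * avg (fun x => w x * coeff r w n x) s =
          -∫ s in (0 : ℝ)..(-t), r (-s) * avg (fun x => w x * coeff r w n x) (-s) := by
        rw [intervalIntegral.integral_comp_neg
          (fun s => r s * avg (fun x => w x * coeff r w n x) s), neg_neg, neg_zero,
          intervalIntegral.integral_symm]
      rw [hneg, norm_neg]
      refine (intervalIntegral.norm_integral_le_of_norm_le (neg_nonneg.mpr ht)
        (g := fun s => R * W * C * s ^ n)
        (.of_forall fun s hs => ?_) ((by fun_prop : Continuous _).intervalIntegrable _ _)).trans ?_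
      · simpa [abs_of_pos hs.1] using h2 (-s)
      · rw [hint _ (neg_nonneg.mpr ht), abs_of_nonpos ht]

lemma abs_term_le (hR : ∀ t, |r t| ≤ R)
    (hW : ∀ t, |w t| ≤ W) (n : ℕ) {c t b : ℝ} (hc : |c| ≤ b) (ht : |t| ≤ b) :
    ‖(-c) ^ n * coeff r w n t‖ ≤ (b * (R * W) * b) ^ n / n.factorial := by
  have hR0 : 0 ≤ R := (abs_nonneg _).trans (hR 0)
  have hW0 : 0 ≤ W := (abs_nonneg _).trans (hW 0)
  rw [norm_mul, norm_pow, norm_neg, Real.norm_eq_abs, Real.norm_eq_abs]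
  calc |c| ^ n * |coeff r w n t| ≤ b ^ n * ((R * W) ^ n / n.factorial * b ^ n) := by
        have hb : 0 ≤ b := (abs_nonneg c).trans hc
        gcongr
        exact (abs_coeff_le hR hW n t).trans (by gcongr)
    _ = _ := by rw [mul_pow, mul_pow]; ring

/-- The series converges locally uniformly in both variables. Joint continuity is needed to vary `c`
and take minima over `t`. -/
lemma continuous_sol (hr : Continuous r) (hw : Continuous w) (hR : ∀ t, |r t| ≤ R)
    (hW : ∀ t, |w t| ≤ W) : Continuous fun z : ℝ × ℝ => sol r w z.1 z.2 := by
  refine continuous_iff_continuousAt.mpr fun z => ?_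
  set b := max |z.1| |z.2| + 1
  have hU : {z : ℝ × ℝ | |z.1| ≤ b ∧ |z.2| ≤ b} ∈ 𝓝 z := by
    refine mem_of_superset (((isOpen_lt continuous_fst.abs continuous_const).inter
      (isOpen_lt continuous_snd.abs continuous_const)).mem_nhds
      (x := z) (s := {z : ℝ × ℝ | |z.1| < b} ∩ {z : ℝ × ℝ | |z.2| < b}) ⟨?_, ?_⟩)
      fun y hy => ⟨le_of_lt hy.1, le_of_lt hy.2⟩
    · exact (le_max_left |z.1| |z.2|).trans_lt (lt_add_one _)
    · exact (le_max_right |z.1| |z.2|).trans_lt (lt_add_one _)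
  refine (continuousOn_tsum (fun n => ?_) (Real.summable_pow_div_factorial (b * (R * W) * b))
    fun n y hy => abs_term_le hR hW n hy.1 hy.2).continuousAt hU
  exact ((continuous_fst.neg.pow n).mul
    ((continuous_coeff hr hw n).comp continuous_snd)).continuousOn

lemma hasSum_sol (hR : ∀ t, |r t| ≤ R)
    (hW : ∀ t, |w t| ≤ W) (c t : ℝ) :
    HasSum (fun n => (-c) ^ n * coeff r w n t) (sol r w c t) := by
  refine Summable.hasSum (Summable.of_norm_bounded (Real.summable_pow_div_factorial _)
    fun n => abs_term_le hR hW n (le_max_left |c| |t|) (le_max_right |c| |t|))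

lemma sol_zero_left (t : ℝ) : sol r w 0 t = 1 := by
  rw [sol, tsum_eq_single 0]
  · simp [coeff]
  · intro n hn
    simp [hn]

/-- Summing the recursion of the coefficients, with sum and integrals exchanged by dominated
convergence, gives the integral equation; `h1` treats the mean value and `h2` the outer integral. -/
lemma sol_eq (hr : Continuous r) (hw : Continuous w) (hR : ∀ t, |r t| ≤ R)
    (hW : ∀ t, |w t| ≤ W) (c t : ℝ) :
    sol r w c t = 1 - c * ∫ s in (0 : ℝ)..t, r s * avg (fun x => w x * sol r w c x) s := by
  have hW0 : 0 ≤ W := (abs_nonneg _).trans (hW 0)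
  have hR0 : 0 ≤ R := (abs_nonneg _).trans (hR 0)
  have h1 : ∀ s, HasSum (fun n => (-c) ^ n * avg (fun x => w x * coeff r w n x) s)
      (avg (fun x => w x * sol r w c x) s) := by
    intro s
    set b := max |c| |s|
    have := intervalIntegral.hasSum_integral_of_dominated_convergence (μ := volume)
      (a := 0) (b := 1)
      (F := fun n σ => (-c) ^ n * (w (σ * s) * coeff r w n (σ * s)))
      (f := fun σ => w (σ * s) * sol r w c (σ * s))
      (fun n _ => W * ((b * (R * W) * b) ^ n / n.factorial)) (fun n => ?_) (fun n => ?_) ?_ ?_ ?_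
    · simpa [avg, intervalIntegral.integral_const_mul] using this
    · have := continuous_coeff hr hw n
      exact (by fun_prop : Continuous _).aestronglyMeasurable
    · refine .of_forall fun σ hσ => ?_
      rw [uIoc_of_le zero_le_one] at hσ
      rw [mul_left_comm, norm_mul]
      refine mul_le_mul (hW _) (abs_term_le hR hW n (le_max_left _ _) ?_) (norm_nonneg _) hW0
      rw [abs_mul, abs_of_pos hσ.1]
      exact (mul_le_of_le_one_left (abs_nonneg s) hσ.2).trans (le_max_right _ _)
    · exact .of_forall fun σ _ => (Real.summable_pow_div_factorial _).mul_left W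
    · exact intervalIntegrable_const
    · refine .of_forall fun σ _ => ?_
      simp only [mul_left_comm _ (w _)]
      exact (hasSum_sol hR hW c (σ * s)).mul_left _
  have h2 : HasSum (fun n => (-c) ^ n * coeff r w (n + 1) t)
      (∫ s in (0 : ℝ)..t, r s * avg (fun x => w x * sol r w c x) s) := by
    set b := max |c| |t|
    have := intervalIntegral.hasSum_integral_of_dominated_convergence (μ := volume)
      (a := 0) (b := t)
      (F := fun n s => (-c) ^ n * (r s * avg (fun x => w x * coeff r w n x) s))
      (f := fun s => r s * avg (fun x => w x * sol r w c x) s)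
      (fun n _ => R * (W * ((b * (R * W) * b) ^ n / n.factorial))) (fun n => ?_) (fun n => ?_)
      ?_ ?_ ?_
    · simpa [coeff, intervalIntegral.integral_const_mul] using this
    · exact (continuous_const.mul (hr.mul (continuous_avg
        (hw.mul (continuous_coeff hr hw n))))).aestronglyMeasurable
    · refine .of_forall fun s hs => ?_
      rw [mul_left_comm, norm_mul]
      refine mul_le_mul (hR _) ?_ (norm_nonneg _) hR0
      have hs' : |s| ≤ b := by
        have : |s| ≤ |t| := by
          rcases le_total 0 t with ht | ht
          · rw [uIoc_of_le ht] at hs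
            rw [abs_of_pos hs.1, abs_of_nonneg ht]
            exact hs.2
          · rw [uIoc_of_ge ht] at hs
            rw [abs_of_nonpos hs.2, abs_of_nonpos ht]
            linarith [hs.1]
        exact this.trans (le_max_right _ _)
      rw [avg, ← intervalIntegral.integral_const_mul]
      refine (intervalIntegral.norm_integral_le_of_norm_le_const
        (C := W * ((b * (R * W) * b) ^ n / n.factorial)) fun σ hσ => ?_).trans (by simp)
      rw [uIoc_of_le zero_le_one] at hσ
      rw [mul_left_comm, norm_mul]
      refine mul_le_mul (hW _) (abs_term_le hR hW n (le_max_left _ _) ?_) (norm_nonneg _) hW0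
      rw [abs_mul, abs_of_pos hσ.1]
      exact (mul_le_of_le_one_left (abs_nonneg s) hσ.2).trans hs'
    · exact .of_forall fun s _ => ((Real.summable_pow_div_factorial _).mul_left W).mul_left R
    · exact intervalIntegrable_const
    · refine .of_forall fun s _ => ?_
      simp only [mul_left_comm _ (r _)]
      exact (h1 s).mul_left _
  have h3 : HasSum (fun n => (-c) ^ (n + 1) * coeff r w (n + 1) t) (sol r w c t - 1) := by
    have := (hasSum_nat_add_iff' 1).mpr (hasSum_sol hR hW c t)
    simpa [coeff] using this
  have h4 := h2.mul_left (-c)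
  simp only [← mul_assoc, ← pow_succ'] at h4
  linarith [h3.unique h4]

/-- The derivative of the solution. -/
def sol' (r w : ℝ → ℝ) (c t : ℝ) : ℝ := -c * (r t * avg (fun x => w x * sol r w c x) t)

lemma continuous_sol_right (hr : Continuous r) (hw : Continuous w) (hR : ∀ t, |r t| ≤ R)
    (hW : ∀ t, |w t| ≤ W) (c : ℝ) : Continuous (sol r w c) :=
  (continuous_sol hr hw hR hW).comp (continuous_const.prodMk continuous_id)

lemma continuous_sol' (hr : Continuous r) (hw : Continuous w) (hR : ∀ t, |r t| ≤ R)
    (hW : ∀ t, |w t| ≤ W) (c : ℝ) : Continuous (sol' r w c) :=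
  continuous_const.mul (hr.mul (continuous_avg (hw.mul (continuous_sol_right hr hw hR hW c))))

lemma hasDerivAt_sol (hr : Continuous r) (hw : Continuous w) (hR : ∀ t, |r t| ≤ R)
    (hW : ∀ t, |w t| ≤ W) (c t : ℝ) : HasDerivAt (sol r w c) (sol' r w c t) t := by
  have h1 := hr.mul (continuous_avg (hw.mul (continuous_sol_right hr hw hR hW c)))
  have h2 := ((intervalIntegral.integral_hasDerivAt_right (h1.intervalIntegrable 0 t)
    (h1.stronglyMeasurableAtFilter _ _) h1.continuousAt).const_mul c).const_sub 1
  rw [funext fun t => sol_eq hr hw hR hW c t, sol', neg_mul]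
  exact h2

lemma sol_zero_right (hr : Continuous r) (hw : Continuous w) (hR : ∀ t, |r t| ≤ R)
    (hW : ∀ t, |w t| ≤ W) (c : ℝ) : sol r w c 0 = 1 := by
  rw [sol_eq hr hw hR hW, intervalIntegral.integral_same, mul_zero, sub_zero]

end Singular

/-! ### Monotonicity, and a parameter for which the solution vanishes at the end point -/

namespace Singular

variable {r w : ℝ → ℝ} {R W b c : ℝ}

/-- The derivative is `-c` times `r` times a mean value of `w u`, hence nonpositive as long as `u`
is nonnegative. -/
lemma antitoneOn_sol (hr : Continuous r) (hw : Continuous w) (hR : ∀ t, |r t| ≤ R)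
    (hW : ∀ t, |w t| ≤ W) (hr0 : ∀ t ∈ Icc 0 b, 0 ≤ r t) (hw0 : ∀ t ∈ Icc 0 b, 0 ≤ w t)
    (hc : 0 ≤ c) (hs : ∀ t ∈ Icc 0 b, 0 ≤ sol r w c t) : AntitoneOn (sol r w c) (Icc 0 b) := by
  refine antitoneOn_of_hasDerivWithinAt_nonpos (f' := sol' r w c) (convex_Icc 0 b)
    (continuous_sol_right hr hw hR hW c).continuousOn
    (fun t _ => (hasDerivAt_sol hr hw hR hW c t).hasDerivWithinAt) fun t ht => ?_
  have ht' := interior_subset ht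
  rw [sol', neg_mul, neg_nonpos]
  exact mul_nonneg hc (mul_nonneg (hr0 t ht')
    (avg_nonneg ht' fun x hx => mul_nonneg (hw0 x hx) (hs x hx)))

/-- The minimum of the solution over `[0, b]` depends continuously on the parameter, equals `1` at
`0` and is nonpositive at `c`. Where it vanishes, the solution is nonnegative, hence decreasing, so
the minimum is attained at `b`. -/
lemma exists_first_root (hr : Continuous r) (hw : Continuous w) (hR : ∀ t, |r t| ≤ R)
    (hW : ∀ t, |w t| ≤ W) (hr0 : ∀ t ∈ Icc 0 b, 0 ≤ r t) (hw0 : ∀ t ∈ Icc 0 b, 0 ≤ w t)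
    (hb : 0 ≤ b) (hc : 0 ≤ c) (h : ∃ t ∈ Icc 0 b, sol r w c t ≤ 0) :
    ∃ l ∈ Ioc 0 c, (∀ t ∈ Icc 0 b, 0 ≤ sol r w l t) ∧ sol r w l b = 0 := by
  set m : ℝ → ℝ := fun l => sInf (sol r w l '' Icc 0 b)
  have hcont : Continuous m := isCompact_Icc.continuous_sInf (f := sol r w)
    (continuous_sol hr hw hR hW)
  have hmin : ∀ l, ∃ t ∈ Icc 0 b, sol r w l t = m l := fun l =>
    (isCompact_Icc.image (continuous_sol_right hr hw hR hW l)).sInf_mem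
      ((nonempty_Icc.mpr hb).image _)
  have hle : ∀ l, ∀ t ∈ Icc 0 b, m l ≤ sol r w l t := fun l t ht =>
    csInf_le (isCompact_Icc.image (continuous_sol_right hr hw hR hW l)).bddBelow
      (mem_image_of_mem _ ht)
  have h0 : m 0 = 1 := by
    obtain ⟨t, _, ht⟩ := hmin 0
    rw [← ht, sol_zero_left]
  obtain ⟨t, ht, htc⟩ := h
  obtain ⟨l, hl, hml⟩ := intermediate_value_Icc' hc hcont.continuousOn
    (show (0 : ℝ) ∈ Icc (m c) (m 0) from ⟨(hle c t ht).trans htc, h0 ▸ zero_le_one⟩)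
  have hl0 : l ≠ 0 := by
    rintro rfl
    linarith
  have hnn : ∀ t ∈ Icc 0 b, 0 ≤ sol r w l t := fun t ht => hml ▸ hle l t ht
  refine ⟨l, ⟨lt_of_le_of_ne hl.1 hl0.symm, hl.2⟩, hnn, le_antisymm ?_ (hnn b ⟨hb, le_rfl⟩)⟩
  obtain ⟨t₀, ht₀, h0⟩ := hmin l
  rw [← hml, ← h0]
  exact antitoneOn_sol hr hw hR hW hr0 hw0 hl.1 hnn ht₀ ⟨hb, le_rfl⟩ ht₀.2

end Singular

/-! ### Rotationally symmetric eigenfunctions of the dumbbell -/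

namespace Dumbbell

open Singular

variable {ε c x t : ℝ}

/-- The quotient of the squared radius by the distance `4 - x` to the right pole. -/
def reducedSq (ε x : ℝ) : ℝ := step x ^ 6 * x + ε ^ 2 * (1 - step x ^ 6) / (4 - min x 2)

/-- Truncating at `2` keeps the denominator away from zero and costs nothing: beyond `2` its
numerator vanishes. -/
lemma four_sub_mul_reducedSq (hx : 0 ≤ x) : (4 - x) * reducedSq ε x = radiusSq ε x := by
  rw [radiusSq_eq_rightSq (by linarith), rightSq_eq, reducedSq]
  rcases le_total x 2 with h | h
  · rw [min_eq_left h]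
    have : 4 - x ≠ 0 := by linarith
    field_simp
    ring
  · rw [step_of_ge h]
    ring

lemma reducedSq_pos (hε : 0 < ε) (x : ℝ) : 0 < reducedSq ε x := by
  have h1 : step x ^ 6 ≤ 1 := pow_le_one₀ (step_nonneg x) (step_le_one x)
  have h0 : 0 ≤ step x ^ 6 := by have := step_nonneg x; positivity
  have h2 : 0 < 4 - min x 2 := by linarith [min_le_right x 2]
  rw [reducedSq]
  rcases le_total x 1 with h | h
  · rw [step_of_le h]
    have : 0 < ε ^ 2 / (4 - min x 2) := by positivity
    simpa using this
  · rcases h0.eq_or_lt with h3 | h3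
    · rw [← h3]
      have : 0 < ε ^ 2 / (4 - min x 2) := by positivity
      simpa using this
    · have := sub_nonneg.mpr h1
      have : 0 < step x ^ 6 * x := mul_pos h3 (by linarith)
      positivity

lemma continuous_reducedSq : Continuous (reducedSq ε) := by
  have := contDiff_step.continuous
  refine (by fun_prop : Continuous fun x => step x ^ 6 * x).add (Continuous.div
    (by fun_prop) (by fun_prop) fun x => ?_)
  linarith [min_le_right x 2]

/-- The projection of the real line onto `[-4, 4]`. -/
def clamp (t : ℝ) : ℝ := max (-4) (min t 4)

lemma continuous_clamp : Continuous clamp := by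
  unfold clamp
  fun_prop

lemma clamp_mem (t : ℝ) : clamp t ∈ Icc (-4 : ℝ) 4 :=
  ⟨le_max_left _ _, max_le (by norm_num) (min_le_right _ _)⟩

lemma clamp_of_mem (ht : t ∈ Icc (-4 : ℝ) 4) : clamp t = t := by
  rw [clamp, min_eq_left ht.2, max_eq_right ht.1]

/-- The area density, as a function of the distance to the right pole along the axis. -/
def weight (ε t : ℝ) : ℝ := areaDensity ε (4 - clamp t)

/-- The coefficient `r` for which the equation of rotationally symmetric eigenfunctions of the
Laplacian takes the form `(t u' / r)' = -c w u`. -/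
def ratio (ε t : ℝ) : ℝ := areaDensity ε (4 - clamp t) / reducedSq ε (4 - clamp t)

lemma continuous_weight (hε : 0 < ε) : Continuous (weight ε) :=
  (contDiff_areaDensity hε).continuous.comp (continuous_const.sub continuous_clamp)

lemma continuous_ratio (hε : 0 < ε) : Continuous (ratio ε) :=
  (continuous_weight hε).div (continuous_reducedSq.comp (continuous_const.sub continuous_clamp))
    fun _ => (reducedSq_pos hε _).ne'

lemma weight_pos (hε : 0 < ε) (t : ℝ) : 0 < weight ε t := areaDensity_pos hε _

lemma ratio_pos (hε : 0 < ε) (t : ℝ) : 0 < ratio ε t :=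
  div_pos (areaDensity_pos hε _) (reducedSq_pos hε _)

lemma weight_of_mem (ht : t ∈ Icc (-4 : ℝ) 4) : weight ε t = areaDensity ε (4 - t) := by
  rw [weight, clamp_of_mem ht]

lemma ratio_mul (hε : 0 < ε) (ht : t ∈ Icc (-4 : ℝ) 4) :
    ratio ε t * radiusSq ε (4 - t) = t * areaDensity ε (4 - t) := by
  rw [ratio, clamp_of_mem ht, ← four_sub_mul_reducedSq (by linarith [ht.2])]
  have := (reducedSq_pos hε (4 - t)).ne'
  field_simp
  ring

/-- The series estimates ask for coefficients bounded on the whole line. Since the clamped range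
extends to `-4`, the pole `t = 0` is interior to the region where the coefficients are the true
ones. -/
lemma exists_bound_comp_clamp {f : ℝ → ℝ} (hf : Continuous f) (h : ∀ t, f t = f (clamp t)) :
    ∃ C, ∀ t, |f t| ≤ C := by
  obtain ⟨C, hC⟩ := (isCompact_Icc (a := (-4 : ℝ)) (b := 4)).exists_bound_of_continuousOn
    hf.continuousOn
  exact ⟨C, fun t => h t ▸ hC _ (clamp_mem t)⟩

lemma exists_bound_weight (hε : 0 < ε) : ∃ W, ∀ t, |weight ε t| ≤ W :=
  exists_bound_comp_clamp (continuous_weight hε) fun t => by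
    rw [weight, weight, clamp_of_mem (clamp_mem t)]

lemma exists_bound_ratio (hε : 0 < ε) : ∃ R, ∀ t, |ratio ε t| ≤ R :=
  exists_bound_comp_clamp (continuous_ratio hε) fun t => by
    rw [ratio, ratio, clamp_of_mem (clamp_mem t)]

lemma weight_of_le_two (ht : t ∈ Icc (-4 : ℝ) 2) : weight ε t = 2 := by
  rw [weight_of_mem ⟨ht.1, by linarith [ht.2]⟩]
  exact areaDensity_of_two_le (by rw [abs_of_nonneg] <;> linarith [ht.2])

lemma ratio_of_le_two (ht : t ∈ Icc (-4 : ℝ) 2) : ratio ε t = 2 / (4 - t) := by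
  have h : areaDensity ε (4 - t) = 2 :=
    areaDensity_of_two_le (by rw [abs_of_nonneg] <;> linarith [ht.2])
  rw [ratio, clamp_of_mem ⟨ht.1, by linarith [ht.2]⟩, h, reducedSq,
    step_of_ge (by linarith [ht.2])]
  simp

/-- The solution of the equation for rotationally symmetric eigenfunctions which is regular at the
right pole, as a function of the distance to the pole along the axis. -/
def radial (ε c : ℝ) : ℝ → ℝ := sol (ratio ε) (weight ε) c

/-- The derivative of `radial`. -/
def radial' (ε c : ℝ) : ℝ → ℝ := sol' (ratio ε) (weight ε) c

lemma hasDerivAt_radial (hε : 0 < ε) (c t : ℝ) : HasDerivAt (radial ε c) (radial' ε c t) t := by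
  obtain ⟨R, hR⟩ := exists_bound_ratio hε
  obtain ⟨W, hW⟩ := exists_bound_weight hε
  exact hasDerivAt_sol (continuous_ratio hε) (continuous_weight hε) hR hW c t

lemma continuous_radial (hε : 0 < ε) (c : ℝ) : Continuous (radial ε c) :=
  continuous_iff_continuousAt.mpr fun t => (hasDerivAt_radial hε c t).continuousAt

lemma continuous_radial' (hε : 0 < ε) (c : ℝ) : Continuous (radial' ε c) := by
  obtain ⟨R, hR⟩ := exists_bound_ratio hε
  obtain ⟨W, hW⟩ := exists_bound_weight hε
  exact continuous_sol' (continuous_ratio hε) (continuous_weight hε) hR hW c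

lemma radial_zero (hε : 0 < ε) (c : ℝ) : radial ε c 0 = 1 := by
  obtain ⟨R, hR⟩ := exists_bound_ratio hε
  obtain ⟨W, hW⟩ := exists_bound_weight hε
  exact sol_zero_right (continuous_ratio hε) (continuous_weight hε) hR hW c

/-- The singular factor `t` contained in the squared radius turns the mean value back into an
integral. -/
lemma mul_radial' (hε : 0 < ε) (c : ℝ) (ht : t ∈ Icc (-4 : ℝ) 4) :
    radiusSq ε (4 - t) * radial' ε c t =
      -c * areaDensity ε (4 - t) * ∫ s in (0 : ℝ)..t, weight ε s * radial ε c s := by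
  rw [← mul_avg (fun s => weight ε s * radial ε c s)]
  change radiusSq ε (4 - t) * (-c * (ratio ε t *
    avg (fun s => weight ε s * radial ε c s) t)) = _
  linear_combination -c * avg (fun s => weight ε s * radial ε c s) t * ratio_mul hε ht

/-- At the parameter `ε`, the solution does not stay positive, because of its rapid decay along the
handle. -/
lemma exists_radial_nonpos (hε : 0 < ε) (hε1 : ε ≤ 3 / 8) :
    ∃ t ∈ Icc (0 : ℝ) 4, radial ε ε t ≤ 0 := by
  by_contra! hpos
  obtain ⟨R, hR⟩ := exists_bound_ratio hε
  obtain ⟨W, hW⟩ := exists_bound_weight hε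
  have hanti : AntitoneOn (radial ε ε) (Icc 0 4) :=
    antitoneOn_sol (continuous_ratio hε) (continuous_weight hε) hR hW
      (fun t _ => (ratio_pos hε t).le) (fun t _ => (weight_pos hε t).le) hε.le
      (fun t ht => (hpos t ht).le)
  have hle1 : ∀ t ∈ Icc (0 : ℝ) 4, radial ε ε t ≤ 1 := fun t ht =>
    (hanti ⟨le_rfl, by norm_num⟩ ht ht.1).trans_eq (radial_zero hε ε)
  have hcont : Continuous fun s => weight ε s * radial ε ε s :=
    (continuous_weight hε).mul (continuous_radial hε ε)
  -- On this part of the cap `w = 2`, `u ≤ 1` and `r = 2/(4 - t) ≤ 2/3`, so `-u' ≤ ε · (2/3) · 2`.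
  have hder : ∀ t ∈ Icc (0 : ℝ) 1, -(4 / 3) * ε ≤ radial' ε ε t := by
    intro t ht
    have h1 : avg (fun s => weight ε s * radial ε ε s) t ≤ 2 := by
      have : avg (fun s => weight ε s * radial ε ε s) t ≤ ∫ σ in (0 : ℝ)..1, (2 : ℝ) := by
        refine intervalIntegral.integral_mono_on zero_le_one
          ((hcont.comp (by fun_prop : Continuous fun σ : ℝ => σ * t)).intervalIntegrable _ _)
          (by simp) fun σ hσ => ?_
        have h0 : 0 ≤ σ * t := mul_nonneg hσ.1 ht.1
        have h1 : σ * t ≤ 1 := mul_le_one₀ hσ.2 ht.1 ht.2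
        beta_reduce
        rw [weight_of_le_two ⟨by linarith, by linarith⟩]
        linarith [hle1 (σ * t) ⟨h0, by linarith⟩]
      simpa using this
    have h2 : ratio ε t ≤ 2 / 3 := by
      rw [ratio_of_le_two ⟨by linarith [ht.1], by linarith [ht.2]⟩]
      exact div_le_div_of_nonneg_left (by norm_num) (by norm_num) (by linarith [ht.2])
    have h3 := ratio_pos hε t
    change _ ≤ -ε * (ratio ε t * avg (fun s => weight ε s * radial ε ε s) t)
    have h4 : ratio ε t * avg (fun s => weight ε s * radial ε ε s) t ≤ 4 / 3 := by nlinarith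
    nlinarith
  -- This is where `3/8` comes from: `1 - (4/3)(3/8) = 1/2`.
  have hhalf : ∀ t ∈ Icc (0 : ℝ) 1, 1 / 2 ≤ radial ε ε t := by
    intro t ht
    have := (convex_Icc (0 : ℝ) 1).mul_sub_le_image_sub_of_le_deriv
      (continuous_radial hε ε).continuousOn
      (fun x _ => (hasDerivAt_radial hε ε x).differentiableAt.differentiableWithinAt)
      (C := -(4 / 3) * ε)
      (fun x hx => by
        rw [(hasDerivAt_radial hε ε x).deriv]
        exact hder x (interior_subset hx)) 0 ⟨le_rfl, zero_le_one⟩ t ht ht.1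
    rw [radial_zero hε] at this
    nlinarith [ht.1, ht.2]
  have hint : ∀ t ∈ Icc (1 : ℝ) 4, 1 ≤ ∫ s in (0 : ℝ)..t, weight ε s * radial ε ε s := by
    intro t ht
    have h1 : (∫ s in (0 : ℝ)..1, (1 : ℝ)) ≤ ∫ s in (0 : ℝ)..1, weight ε s * radial ε ε s := by
      refine intervalIntegral.integral_mono_on zero_le_one (by simp)
        (hcont.intervalIntegrable _ _) fun s hs => ?_
      rw [weight_of_le_two ⟨by linarith [hs.1], by linarith [hs.2]⟩]
      linarith [hhalf s hs]
    have h2 : 0 ≤ ∫ s in (1 : ℝ)..t, weight ε s * radial ε ε s :=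
      intervalIntegral.integral_nonneg ht.1 fun s hs =>
        mul_nonneg (weight_pos hε s).le (hpos s ⟨by linarith [hs.1], hs.2.trans ht.2⟩).le
    rw [← intervalIntegral.integral_add_adjacent_intervals (hcont.intervalIntegrable 0 1)
      (hcont.intervalIntegrable 1 t)]
    simp at h1
    linarith
  -- On the handle the squared radius is `ε²` and the density is `ε`; with parameter `ε` all powers
  -- cancel and `u'` is minus the integral of `w u`, which is at least `1`.
  have hder2 : ∀ t ∈ Icc (3 : ℝ) 4, radial' ε ε t ≤ -1 := by
    intro t ht
    have h0 : |4 - t| ≤ 1 := abs_le.mpr ⟨by linarith [ht.2], by linarith [ht.1]⟩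
    have h1 := mul_radial' hε ε (t := t) ⟨by linarith [ht.1], ht.2⟩
    rw [radiusSq_of_abs_le h0, areaDensity_of_abs_le hε h0] at h1
    have h2 := hint t ⟨by linarith [ht.1], ht.2⟩
    have h3 : radial' ε ε t = -∫ s in (0 : ℝ)..t, weight ε s * radial ε ε s := by
      refine mul_left_cancel₀ (pow_pos hε 2).ne' (h1.trans ?_)
      ring
    linarith
  -- Over the unit length of the half handle `u` loses at least `1`, starting from at most `1`,
  -- which contradicts positivity at `4`.
  have h34 := (convex_Icc (3 : ℝ) 4).image_sub_le_mul_sub_of_deriv_le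
    (continuous_radial hε ε).continuousOn
    (fun x _ => (hasDerivAt_radial hε ε x).differentiableAt.differentiableWithinAt)
    (C := -1)
    (fun x hx => by
      rw [(hasDerivAt_radial hε ε x).deriv]
      exact hder2 x (interior_subset hx)) 3 ⟨le_rfl, by norm_num⟩ 4 ⟨by norm_num, le_rfl⟩
      (by norm_num)
  have h3 := hle1 3 ⟨by norm_num, by norm_num⟩
  have h4 := hpos 4 ⟨by norm_num, le_rfl⟩
  linarith

lemma exists_radial_eq_zero (hε : 0 < ε) (hε1 : ε ≤ 3 / 8) :
    ∃ c ∈ Ioc 0 ε, radial ε c 4 = 0 := by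
  obtain ⟨R, hR⟩ := exists_bound_ratio hε
  obtain ⟨W, hW⟩ := exists_bound_weight hε
  obtain ⟨c, hc, -, h⟩ := exists_first_root (continuous_ratio hε) (continuous_weight hε) hR hW
    (fun t _ => (ratio_pos hε t).le) (fun t _ => (weight_pos hε t).le) (by norm_num) hε.le
    (exists_radial_nonpos hε hε1)
  exact ⟨c, hc, h⟩

/-- The odd extension of `radial`, as a function on the axis. -/
def oddRadial (ε c x : ℝ) : ℝ := ∫ y in (0 : ℝ)..x, -radial' ε c (4 - |y|)

/-- The derivative of `oddRadial`. -/
def oddRadial' (ε c x : ℝ) : ℝ := -radial' ε c (4 - |x|)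

lemma continuous_oddRadial' (hε : 0 < ε) (c : ℝ) : Continuous (oddRadial' ε c) :=
  ((continuous_radial' hε c).comp (continuous_const.sub continuous_abs)).neg

lemma hasDerivAt_oddRadial (hε : 0 < ε) (c x : ℝ) :
    HasDerivAt (oddRadial ε c) (oddRadial' ε c x) x := by
  have h := continuous_oddRadial' hε c
  exact intervalIntegral.integral_hasDerivAt_right (h.intervalIntegrable 0 x)
    (h.stronglyMeasurableAtFilter _ _) h.continuousAt

lemma continuous_oddRadial (hε : 0 < ε) (c : ℝ) : Continuous (oddRadial ε c) :=
  continuous_iff_continuousAt.mpr fun t => (hasDerivAt_oddRadial hε c t).continuousAt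

lemma oddRadial'_neg (ε c x : ℝ) : oddRadial' ε c (-x) = oddRadial' ε c x := by
  rw [oddRadial', abs_neg, oddRadial']

lemma oddRadial_neg (ε c x : ℝ) : oddRadial ε c (-x) = -oddRadial ε c x := by
  rw [oddRadial, oddRadial, ← intervalIntegral.integral_symm]
  have := intervalIntegral.integral_comp_neg (a := 0) (b := -x)
    (fun y => -radial' ε c (4 - |y|))
  simpa using this

/-- The vanishing of `radial` in the middle of the handle fixes the constant of integration. -/
lemma oddRadial_of_nonneg (hε : 0 < ε) (hc : radial ε c 4 = 0) (hx : 0 ≤ x) :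
    oddRadial ε c x = radial ε c (4 - x) := by
  have h : oddRadial ε c x = ∫ y in (0 : ℝ)..x, -radial' ε c (4 - y) := by
    refine intervalIntegral.integral_congr fun y hy => ?_
    rw [uIcc_of_le hx] at hy
    simp only [abs_of_nonneg hy.1]
  rw [h, intervalIntegral.integral_eq_sub_of_hasDerivAt (f := fun y => radial ε c (4 - y))
    (f' := fun y => -radial' ε c (4 - y)) (fun y _ => ?_) (Continuous.intervalIntegrable
      ((continuous_radial' hε c).comp (continuous_const.sub continuous_id)).neg _ _)]
  · simp [hc]
  · exact ((hasDerivAt_radial hε c (4 - y)).comp y ((hasDerivAt_id y).const_sub 4)).congr_deriv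
      (mul_neg_one _)

/-- The equation of rotationally symmetric eigenfunctions in integrated form. -/
lemma mul_oddRadial' (hε : 0 < ε) (hc : radial ε c 4 = 0) (hx : |x| ≤ 4) :
    radiusSq ε x * oddRadial' ε c x =
      c * areaDensity ε x * ∫ y in x..4, areaDensity ε y * oddRadial ε c y := by
  have hcont : Continuous fun y => areaDensity ε y * oddRadial ε c y :=
    (contDiff_areaDensity hε).continuous.mul (continuous_oddRadial hε c)
  have hpos : ∀ x, 0 ≤ x → x ≤ 4 → radiusSq ε x * oddRadial' ε c x =
      c * areaDensity ε x * ∫ y in x..4, areaDensity ε y * oddRadial ε c y := by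
    intro x h0 h4
    have h1 := mul_radial' hε c (t := 4 - x) ⟨by linarith, by linarith⟩
    rw [sub_sub_cancel] at h1
    have h2 : ∫ s in (0 : ℝ)..(4 - x), weight ε s * radial ε c s =
        ∫ y in x..4, areaDensity ε y * oddRadial ε c y := by
      have := intervalIntegral.integral_comp_sub_left (a := x) (b := 4)
        (fun s => weight ε s * radial ε c s) 4
      rw [sub_self] at this
      rw [← this]
      refine intervalIntegral.integral_congr fun y hy => ?_
      rw [uIcc_of_le h4] at hy
      rw [weight_of_mem ⟨by linarith [hy.2], by linarith [hy.1]⟩, sub_sub_cancel,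
        oddRadial_of_nonneg hε hc (h0.trans hy.1)]
    rw [oddRadial', abs_of_nonneg h0, ← h2]
    linarith
  rcases le_total 0 x with h | h
  · exact hpos x h ((le_abs_self x).trans hx)
  -- For negative `x` the right side is the one at `-x`, because the odd integrand contributes
  -- nothing over `[x, -x]`.
  · have h1 := hpos (-x) (by linarith) ((neg_le_abs x).trans hx)
    rw [radiusSq_neg, oddRadial'_neg, areaDensity_neg] at h1
    rw [h1, ← intervalIntegral.integral_add_adjacent_intervals (hcont.intervalIntegrable x (-x))
      (hcont.intervalIntegrable (-x) 4)]
    have h2 : ∫ y in x..(-x), areaDensity ε y * oddRadial ε c y = 0 := by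
      have := intervalIntegral.integral_comp_neg (a := x) (b := -x)
        (fun y => areaDensity ε y * oddRadial ε c y)
      rw [neg_neg] at this
      simp only [areaDensity_neg, oddRadial_neg, mul_neg, intervalIntegral.integral_neg] at this
      linarith
    rw [h2, zero_add]

/-- The equation of rotationally symmetric eigenfunctions. -/
lemma hasDerivAt_flux (hε : 0 < ε) (hc : radial ε c 4 = 0) (hx : |x| < 4) :
    HasDerivAt (fun y => radiusSq ε y / areaDensity ε y * oddRadial' ε c y)
      (-c * (areaDensity ε x * oddRadial ε c x)) x := by
  have hcont : Continuous fun y => areaDensity ε y * oddRadial ε c y :=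
    (contDiff_areaDensity hε).continuous.mul (continuous_oddRadial hε c)
  have h1 := (intervalIntegral.integral_hasDerivAt_left (hcont.intervalIntegrable x 4)
    (hcont.stronglyMeasurableAtFilter _ _) hcont.continuousAt).const_mul c
  rw [mul_neg, ← neg_mul] at h1
  refine h1.congr_of_eventuallyEq ?_
  filter_upwards [(isOpen_lt continuous_abs continuous_const).mem_nhds hx] with y hy
  have h2 := mul_oddRadial' hε hc (le_of_lt hy : |y| ≤ 4)
  rw [div_mul_eq_mul_div, h2]
  have := (areaDensity_pos hε y).ne'
  field_simp

lemma contDiffAt_succ_of_hasDerivAt {f f' : ℝ → ℝ} (hf : ∀ x, HasDerivAt f (f' x) x) {x : ℝ}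
    (h : ContDiffAt ℝ 1 f' x) : ContDiffAt ℝ 2 f x := by
  have h2 : ((1 : ℕ) : WithTop ℕ∞) + 1 = 2 := one_add_one_eq_two
  rw [← h2, contDiffAt_succ_iff_hasFDerivAt]
  refine ⟨fun x => (ContinuousLinearMap.toSpanSingleton ℝ (f' x)),
    ⟨univ, univ_mem, fun x _ => (hf x).hasFDerivAt⟩, ?_⟩
  exact ((ContinuousLinearMap.toSpanSingletonCLE (𝕜 := ℝ) (E := ℝ)).contDiff.contDiffAt).comp x h

/-- Away from the poles the integrated equation is solved for the derivative by dividing by the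
squared radius. -/
lemma contDiffAt_oddRadial'_of_abs_lt (hε : 0 < ε) (hc : radial ε c 4 = 0) (hx : |x| < 4) :
    ContDiffAt ℝ 1 (oddRadial' ε c) x := by
  have hcont : Continuous fun y => areaDensity ε y * oddRadial ε c y :=
    (contDiff_areaDensity hε).continuous.mul (continuous_oddRadial hε c)
  have h1 : ContDiff ℝ 1 fun x => ∫ y in x..4, areaDensity ε y * oddRadial ε c y := by
    have hd : ∀ x, HasDerivAt (fun x => ∫ y in x..4, areaDensity ε y * oddRadial ε c y)
        (-(areaDensity ε x * oddRadial ε c x)) x := fun x =>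
      intervalIntegral.integral_hasDerivAt_left (hcont.intervalIntegrable x 4)
        (hcont.stronglyMeasurableAtFilter _ _) hcont.continuousAt
    refine contDiff_one_iff_deriv.mpr ⟨fun x => (hd x).differentiableAt, ?_⟩
    rw [funext fun x => (hd x).deriv]
    exact hcont.neg
  have h2 : ContDiffAt ℝ 1 (fun x => c * areaDensity ε x *
      (∫ y in x..4, areaDensity ε y * oddRadial ε c y) / radiusSq ε x) x :=
    ((contDiffAt_const.mul ((contDiff_areaDensity hε).contDiffAt.of_le (by simp))).mul
      h1.contDiffAt).div (contDiff_radiusSq.contDiffAt.of_le (by simp)) (radiusSq_pos hε hx).ne'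
  refine h2.congr_of_eventuallyEq ?_
  filter_upwards [(isOpen_lt continuous_abs continuous_const).mem_nhds hx] with y hy
  rw [← mul_oddRadial' hε hc (le_of_lt hy : |y| ≤ 4), mul_div_cancel_left₀ _
    (radiusSq_pos hε hy).ne']

/-- On the cap the derivative is explicitly `c (2/x)` times the mean value of `2u`, regular across
the pole `x = 4`. The bound `8` corresponds to `t > -4`. -/
lemma contDiffAt_oddRadial'_of_two_lt (hε : 0 < ε) (hx : 2 < x) (hx8 : x < 8) :
    ContDiffAt ℝ 1 (oddRadial' ε c) x := by
  have h1 := contDiff_avg (f := fun s => 2 * radial ε c s) (f' := fun s => 2 * radial' ε c s)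
    (fun t => (hasDerivAt_radial hε c t).const_mul 2)
    (continuous_const.mul (continuous_radial' hε c))
  have h2 : ContDiffAt ℝ 1 (fun x => c * (2 / x * avg (fun s => 2 * radial ε c s) (4 - x))) x :=
    contDiffAt_const.mul ((contDiffAt_const.div contDiffAt_id (by simp; linarith)).mul
      (h1.contDiffAt.comp x (contDiffAt_const.sub contDiffAt_id)))
  refine h2.congr_of_eventuallyEq ?_
  filter_upwards [Ioo_mem_nhds hx hx8] with y hy
  rw [oddRadial', abs_of_pos (by linarith [hy.1])]
  change -(-c * (ratio ε (4 - y) * avg (fun s => weight ε s * radial ε c s) (4 - y))) = _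
  have h3 : avg (fun s => weight ε s * radial ε c s) (4 - y) =
      avg (fun s => 2 * radial ε c s) (4 - y) := by
    refine intervalIntegral.integral_congr fun σ hσ => ?_
    rw [uIcc_of_le zero_le_one] at hσ
    simp only
    rw [weight_of_le_two ⟨by nlinarith [hσ.1, hσ.2, hy.1, hy.2],
      by nlinarith [hσ.1, hσ.2, hy.1, hy.2]⟩]
  rw [h3, ratio_of_le_two ⟨by linarith [hy.2], by linarith [hy.1]⟩, sub_sub_cancel]
  ring

lemma contDiffAt_oddRadial' (hε : 0 < ε) (hc : radial ε c 4 = 0) (hx : |x| ≤ 4) :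
    ContDiffAt ℝ 1 (oddRadial' ε c) x := by
  rcases lt_or_ge |x| 4 with h | h
  · exact contDiffAt_oddRadial'_of_abs_lt hε hc h
  · rcases le_total 0 x with h0 | h0
    · rw [abs_of_nonneg h0] at h hx
      exact contDiffAt_oddRadial'_of_two_lt hε (by linarith) (by linarith)
    · rw [abs_of_nonpos h0] at h hx
      have h1 := contDiffAt_oddRadial'_of_two_lt (c := c) hε (x := -x) (by linarith) (by linarith)
      have h2 := h1.comp x contDiffAt_id.neg
      exact h2.congr_of_eventuallyEq (.of_forall fun y => (oddRadial'_neg ε c y).symm)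

lemma contDiffAt_oddRadial (hε : 0 < ε) (hc : radial ε c 4 = 0) (hx : |x| ≤ 4) :
    ContDiffAt ℝ 2 (oddRadial ε c) x :=
  contDiffAt_succ_of_hasDerivAt (hasDerivAt_oddRadial hε c) (contDiffAt_oddRadial' hε hc hx)

lemma oddRadial_four (hε : 0 < ε) (hc : radial ε c 4 = 0) : oddRadial ε c 4 = 1 := by
  rw [oddRadial_of_nonneg hε hc (by norm_num), sub_self, radial_zero hε]

/-- At `t = 0` the ratio is `1/2` and the mean value is `2`. This value of the derivative yields the
eigenvalue equation at the pole. -/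
lemma oddRadial'_four (hε : 0 < ε) : oddRadial' ε c 4 = c := by
  rw [oddRadial', abs_of_pos (by norm_num), sub_self]
  change -(-c * (ratio ε 0 * avg (fun s => weight ε s * radial ε c s) 0)) = _
  have h1 : avg (fun s => weight ε s * radial ε c s) 0 = 2 := by
    simp [avg, radial_zero hε, weight_of_le_two (ε := ε) (t := 0) ⟨by norm_num, by norm_num⟩]
  rw [h1, ratio_of_le_two ⟨by norm_num, by norm_num⟩]
  ring

end Dumbbell

/-! ### The small eigenvalue -/

namespace Dumbbell

open EmbeddedSurface

variable {ε c : ℝ}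

/-- For a function of `x` alone the Laplacian is `w⁻¹ (h u' / w)'`, so the claim reduces to
`hasDerivAt_flux`. -/
lemma laplacian_cylChart (hε : 0 < ε) (hc : radial ε c 4 = 0) (b : Bool) {y : Plane}
    (hy : |y 0| < 4) :
    CoordMetric.div (cylChart hε b).gram (CoordMetric.grad (cylChart hε b).gram
      ((fun q : Space => oddRadial ε c (q 0)) ∘ (cylChart hε b).ofPlane)) y =
      -c * oddRadial ε c (y 0) := by
  have hU : {z : Plane | |z 0| < 4} ∈ 𝓝 y :=
    (isOpen_lt (contDiff_coord_plane 0).continuous.abs continuous_const).mem_nhds hy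
  have hpd : ∀ z : Plane,
      CoordMetric.pd 0 ((fun q : Space => oddRadial ε c (q 0)) ∘ (cylChart hε b).ofPlane) z =
        oddRadial' ε c (z 0) ∧
      CoordMetric.pd 1 ((fun q : Space => oddRadial ε c (q 0)) ∘ (cylChart hε b).ofPlane) z = 0 :=
    fun z => CoordMetric.pd_comp_coord_zero (hasDerivAt_oddRadial hε c (z 0))
  have hinv : ∀ z : Plane, |z 0| < 4 → ((cylChart hε b).gram z)⁻¹ =
      !![(cylA ε (z 0))⁻¹, 0; 0, (radiusSq ε (z 0))⁻¹] := by
    intro z hz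
    have hr := (radiusSq_pos hε hz).ne'
    have hA : cylA ε (z 0) ≠ 0 := div_ne_zero (pow_ne_zero 2 (areaDensity_pos hε _).ne') hr
    refine Matrix.inv_eq_right_inv ?_
    rw [gram_cylChart hε b hz, Matrix.mul_fin_two, Matrix.one_fin_two]
    simp [hr, hA]
  have h0 : (fun z => √((cylChart hε b).gram z).det * CoordMetric.grad (cylChart hε b).gram
      ((fun q : Space => oddRadial ε c (q 0)) ∘ (cylChart hε b).ofPlane) 0 z) =ᶠ[𝓝 y]
      fun z => radiusSq ε (z 0) / areaDensity ε (z 0) * oddRadial' ε c (z 0) := by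
    filter_upwards [hU] with z hz
    have hw := (areaDensity_pos hε (z 0)).ne'
    rw [det_gram_cylChart hε b hz, CoordMetric.grad, Fin.sum_univ_two, (hpd z).1, (hpd z).2,
      hinv z hz, cylA]
    simp only [Matrix.of_apply, Matrix.cons_val_zero, Matrix.cons_val_one, Matrix.cons_val',
      mul_zero, add_zero]
    field_simp
  have h1 : (fun z => √((cylChart hε b).gram z).det * CoordMetric.grad (cylChart hε b).gram
      ((fun q : Space => oddRadial ε c (q 0)) ∘ (cylChart hε b).ofPlane) 1 z) =ᶠ[𝓝 y]
      fun _ => 0 := by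
    filter_upwards [hU] with z hz
    rw [CoordMetric.grad, Fin.sum_univ_two, (hpd z).1, (hpd z).2, hinv z hz]
    simp
  have hw := (areaDensity_pos hε (y 0)).ne'
  rw [CoordMetric.div, Fin.sum_univ_two, CoordMetric.pd_congr 0 h0, CoordMetric.pd_congr 1 h1,
    det_gram_cylChart hε b hy, (CoordMetric.pd_comp_coord_zero (hasDerivAt_flux hε hc hy)).1]
  simp only [CoordMetric.pd, fderiv_fun_const, Pi.zero_apply, zero_apply,
    add_zero]
  field_simp

lemma pd_mul_coord_self {F : Plane → ℝ} (hF : DifferentiableAt ℝ F 0) (i : Fin 2) :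
    CoordMetric.pd i (fun z => F z * z i) 0 = F 0 := by
  have h := (hF.hasFDerivAt.mul (hasFDerivAt_coord i 0)).fderiv
  refine (congrArg (fun A : Plane →L[ℝ] ℝ => A (EuclideanSpace.single i 1)) h).trans ?_
  simp

lemma oddRadial_sgn (ε c : ℝ) (b : Bool) (x : ℝ) :
    oddRadial ε c (sgn b * x) = sgn b * oddRadial ε c x := by
  cases b <;> simp [sgn, oddRadial_neg]

lemma oddRadial'_sgn (ε c : ℝ) (b : Bool) (x : ℝ) :
    oddRadial' ε c (sgn b * x) = oddRadial' ε c x := by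
  cases b <;> simp [sgn, oddRadial'_neg]

/-- The gradient times the area density is a scalar function times the position vector, so its
divergence at the origin is twice the value of that scalar, `-(sgn b / 2) c`. -/
lemma laplacian_poleChart (hε : 0 < ε) (hc : radial ε c 4 = 0) (b : Bool) :
    CoordMetric.div (poleChart ε b).gram (CoordMetric.grad (poleChart ε b).gram
      ((fun q : Space => oddRadial ε c (q 0)) ∘ (poleChart ε b).ofPlane)) 0 = -c * sgn b := by
  set U : Set Plane := {z : Plane | z 0 ^ 2 + z 1 ^ 2 < 1}
  have hU : U ∈ 𝓝 (0 : Plane) := (poleChart ε b).isOpen_target.mem_nhds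
    (show (0 : Plane) 0 ^ 2 + (0 : Plane) 1 ^ 2 < 1 by simp)
  have hd : ∀ z ∈ U, DifferentiableAt ℝ (ofPole b) z := fun z hz =>
    ((poleChart ε b).smooth_ofPlane.contDiffAt
      ((poleChart ε b).isOpen_target.mem_nhds hz)).differentiableAt (by simp)
  have hd0 : ∀ z ∈ U, HasFDerivAt (fun z => ofPole b z 0)
      ((EuclideanSpace.proj 0 : Space →L[ℝ] ℝ) ∘L fderiv ℝ (ofPole b) z) z := fun z hz =>
    (EuclideanSpace.proj 0 : Space →L[ℝ] ℝ).hasFDerivAt.comp z (hd z hz).hasFDerivAt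
  have hpd : ∀ i, ∀ z ∈ U, CoordMetric.pd i
      ((fun q : Space => oddRadial ε c (q 0)) ∘ (poleChart ε b).ofPlane) z =
      oddRadial' ε c (ofPole b z 0) * -(sgn b * z i / √(4 - (z 0 ^ 2 + z 1 ^ 2))) := by
    intro i z hz
    have h := ((hasDerivAt_oddRadial hε c (ofPole b z 0)).comp_hasFDerivAt z (hd0 z hz)).fderiv
    refine (congrArg (fun A : Plane →L[ℝ] ℝ => A (EuclideanSpace.single i 1)) h).trans ?_
    change oddRadial' ε c (ofPole b z 0) * fderiv ℝ (ofPole b) z (EuclideanSpace.single i 1) 0 = _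
    rw [(fderiv_ofPole b hz _).1]
    fin_cases i <;> simp
  -- Sherman–Morrison: the inverse of `I + z zᵀ / (4 - |z|²)` is `I - z zᵀ / 4`.
  have hinv : ∀ z ∈ U, ((poleChart ε b).gram z)⁻¹ =
      !![1 - z 0 ^ 2 / 4, -(z 0 * z 1 / 4); -(z 0 * z 1 / 4), 1 - z 1 ^ 2 / 4] := by
    intro z hz
    have hz' : z 0 ^ 2 + z 1 ^ 2 < 1 := hz
    have h0 : 4 - (z 0 ^ 2 + z 1 ^ 2) ≠ 0 := by linarith
    refine Matrix.inv_eq_right_inv ?_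
    rw [gram_poleChart b hz', Matrix.mul_fin_two, Matrix.one_fin_two]
    ext i j
    fin_cases i <;> fin_cases j <;> simp <;> field_simp <;> ring
  have hX : ∀ i, (fun z => √((poleChart ε b).gram z).det * CoordMetric.grad (poleChart ε b).gram
      ((fun q : Space => oddRadial ε c (q 0)) ∘ (poleChart ε b).ofPlane) i z) =ᶠ[𝓝 0]
      fun z => -(sgn b / 2) * oddRadial' ε c (ofPole b z 0) * z i := by
    intro i
    filter_upwards [hU] with z hz
    have hz' : z 0 ^ 2 + z 1 ^ 2 < 1 := hz
    have h0 : 0 < √(4 - (z 0 ^ 2 + z 1 ^ 2)) := Real.sqrt_pos.mpr (by linarith)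
    have h1 : √(4 - (z 0 ^ 2 + z 1 ^ 2)) ^ 2 = 4 - (z 0 ^ 2 + z 1 ^ 2) := Real.sq_sqrt (by linarith)
    rw [det_gram_poleChart b hz', CoordMetric.grad, Fin.sum_univ_two, hpd 0 z hz, hpd 1 z hz,
      hinv z hz]
    set s := √(4 - (z 0 ^ 2 + z 1 ^ 2))
    set D := oddRadial' ε c (ofPole b z 0)
    -- The position vector is an eigenvector of the inverse metric, with eigenvalue `1 - |z|²/4 =
    -- s²/4`, so the factors `s` cancel.
    have key : ∀ a, 2 / s * (-(sgn b * D / s) * (z i * (s ^ 2 / 4))) = a →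
        -(sgn b / 2) * D * z i = a := by
      rintro _ rfl
      field_simp
      ring
    refine (key _ ?_).symm
    rw [h1]
    fin_cases i <;> simp <;> field_simp <;> ring
  have hF : DifferentiableAt ℝ (fun z => -(sgn b / 2) * oddRadial' ε c (ofPole b z 0)) 0 := by
    have h4 : |ofPole b 0 0| ≤ 4 := (ofPole_mem (ε := ε) b (by simp)).2.1
    have h1 := ((contDiffAt_oddRadial' hε hc h4).differentiableAt one_ne_zero)
    exact (h1.comp (0 : Plane) (hd0 0 (mem_of_mem_nhds hU)).differentiableAt).const_mul _
  have h4 : √(4 : ℝ) = 2 := by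
    rw [show (4 : ℝ) = 2 ^ 2 by norm_num, Real.sqrt_sq (by norm_num)]
  have hv : ofPole b 0 0 = sgn b * 4 := by
    change sgn b * (2 + √(4 - ((0 : ℝ) ^ 2 + (0 : ℝ) ^ 2))) = _
    norm_num [h4]
  rw [CoordMetric.div, Fin.sum_univ_two, CoordMetric.pd_congr 0 (hX 0),
    CoordMetric.pd_congr 1 (hX 1), pd_mul_coord_self hF, pd_mul_coord_self hF,
    det_gram_poleChart b (by simp), hv, oddRadial'_sgn, oddRadial'_four hε]
  simp [h4]
  ring

lemma surface_chart_idx_of_pole (hε : 0 < ε) (hε1 : ε ≤ 1) {p : (surface hε hε1).Point}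
    (hp : incl p 1 = 0 ∧ incl p 2 = 0) :
    ∃ b, (surface hε hε1).chart ((surface hε hε1).idx p) = poleChart ε b ∧
      incl p 0 = sgn b * 4 := by
  have hi : chartIndex (incl p) = (false, decide (0 ≤ incl p 0)) := if_pos hp
  have h4 := abs_eq_four hε p.2 hp.1 hp.2
  change |incl p 0| = 4 at h4
  refine ⟨decide (0 ≤ incl p 0), ?_, ?_⟩
  · refine (surface_chart hε hε1 _).trans ?_
    change (if (chartIndex (incl p)).1 then _ else poleChart ε (chartIndex (incl p)).2) = _
    rw [hi]
    rfl
  · rcases le_or_gt 0 (incl p 0) with h | h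
    · rw [abs_of_nonneg h] at h4
      simp [sgn, h4]
    · rw [abs_of_neg h] at h4
      simp [sgn, h.not_ge]
      linarith

lemma isEigenvalue_surface (hε : 0 < ε) (hε1 : ε ≤ 1) (hc : radial ε c 4 = 0) :
    (surface hε hε1).toSurface.IsEigenvalue c := by
  refine ⟨(fun q : Space => oddRadial ε c (q 0)) ∘ incl, ?_, fun h => ?_, fun p => ?_⟩
  · refine (surface hε hε1).contMDiff_comp_incl fun q hq => ?_
    exact (contDiffAt_oddRadial hε hc hq.1).comp q ((contDiff_coord 0).contDiffAt.of_le (by norm_cast))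
  · have h0 : incl (pole hε hε1) 0 = 4 := by
      change 1 * (2 + √(4 - ((0 : ℝ) ^ 2 + (0 : ℝ) ^ 2))) = _
      rw [show 4 - ((0 : ℝ) ^ 2 + (0 : ℝ) ^ 2) = 2 ^ 2 by norm_num, Real.sqrt_sq (by norm_num)]
      norm_num
    have h1 : oddRadial ε c (incl (pole hε hε1) 0) = 0 := congrFun h (pole hε hε1)
    rw [h0, oddRadial_four hε hc] at h1
    exact one_ne_zero h1
  · have h1 := (surface hε hε1).toSurface_laplacian (fun q => oddRadial ε c (q 0)) p
    rw [neg_eq_iff_eq_neg, ← neg_mul]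
    refine h1.trans ?_
    by_cases hp : incl p 1 = 0 ∧ incl p 2 = 0
    · obtain ⟨b, hb, hb4⟩ := surface_chart_idx_of_pole hε hε1 hp
      have h0 : (surface hε hε1).coord p = 0 := by
        rw [coord, hb]
        ext i
        fin_cases i
        · exact hp.1
        · exact hp.2
      rw [hb, h0]
      refine (laplacian_poleChart hε hc b).trans ?_
      change _ = -c * oddRadial ε c (incl p 0)
      rw [hb4, oddRadial_sgn, oddRadial_four hε hc, mul_one]
    · obtain ⟨b, hb⟩ := surface_chart_idx hε hε1 hp
      have h0 := coord_zero hε hε1 hb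
      have h4 : |(surface hε hε1).coord p 0| < 4 := by
        rw [h0]
        exact abs_lt_four p.2 hp
      rw [hb]
      refine (laplacian_cylChart hε hc b h4).trans ?_
      rw [h0]
      rfl

/-- Any positive eigenvalue bounds the infimum from above, and one has been found in `(0, ε]`. -/
lemma lambda1_surface_le (hε : 0 < ε) (hε1 : ε ≤ 1) (h : ε ≤ 3 / 8) :
    (surface hε hε1).toSurface.lambda1 ≤ ENNReal.ofReal ε := by
  obtain ⟨c, hc, h0⟩ := exists_radial_eq_zero hε h
  exact (iInf₂_le c ⟨hc.1, isEigenvalue_surface hε hε1 h0⟩).trans (ENNReal.ofReal_le_ofReal hc.2)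

end Dumbbell
end

theorem theorem1p1 (K : ℝ) (hK : 0 ≤ K) :
    ∃ p C D R L : ℝ, 1 < p ∧ p = 3 / 2 ∧ 0 < C ∧ 0 < D ∧ 1 < R ∧ 0 < L ∧
      ∃ S : ℕ → ClosedRiemannianSurface,
        (∀ i, (S i).IsDumbbell R L (1 / ((i : ℝ) + 1))) ∧
        (∀ i, (S i).diam ≤ ENNReal.ofReal D) ∧
        (∀ i, (S i).kbar p K ≤ ENNReal.ofReal C) ∧
        Tendsto (fun i => (S i).lambda1) atTop (𝓝 0) := by
  obtain ⟨C, hC, hk⟩ := Dumbbell.exists_kbar_bound hK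
  obtain ⟨D, hD, hd⟩ := Dumbbell.exists_diam_bound
  have hε : ∀ i : ℕ, 0 < 1 / ((i : ℝ) + 1) := fun i => Nat.one_div_pos_of_nat
  have hε1 : ∀ i : ℕ, 1 / ((i : ℝ) + 1) ≤ 1 := fun i =>
    div_le_one_of_le₀ (by linarith [i.cast_nonneg (α := ℝ)]) (by positivity)
  refine ⟨3 / 2, C, D, 2, 2, by norm_num, rfl, hC, hD, by norm_num, by norm_num,
    fun i => (Dumbbell.surface (hε i) (hε1 i)).toSurface,
    fun i => Dumbbell.isDumbbell_surface (hε i) (hε1 i), fun i => hd _ (hε i) (hε1 i),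
    fun i => hk _ (hε i) (hε1 i), ?_⟩
  have hlim : Tendsto (fun i : ℕ => 1 / ((i : ℝ) + 1)) atTop (𝓝 0) :=
    tendsto_one_div_add_atTop_nhds_zero_nat
  have hlim' := ENNReal.tendsto_ofReal hlim
  rw [ENNReal.ofReal_zero] at hlim'
  refine tendsto_of_tendsto_of_tendsto_of_le_of_le' tendsto_const_nhds hlim'
    (.of_forall fun _ => zero_le) ?_
  -- The eigenvalue bound requires a handle of radius at most `3/8`, which holds eventually.
  filter_upwards [hlim.eventually (Iic_mem_nhds (show (0 : ℝ) < 3 / 8 by norm_num))] with i hi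
  exact Dumbbell.lambda1_surface_le (hε i) (hε1 i) hi
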